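/- Let $n\ge 1$, $\mathcal A=\mathbb Z[v^{\pm1},t^{\pm1}]\subset\mathbb Q(v,t)$ and $\mathfrak R=\mathbb Q(v,t)[v',t']$. For $d\ge 1$ let $\Theta_d$ be the set of $n\times n$ matrices over $\mathbb N$ with entries of sum $d$. Over a finite field $\mathbb F_q$ of odd characteristic, the $GL_d(\mathbb F_q)$-orbits $\mathcal O_A$ on pairs $(V,V')$ of $n$-step flags $0=V_0\subseteq V_1\subseteq\dots\subseteq V_n=\mathbb F_q^d$ are indexed by $A=(a_{ij})\in\Theta_d$ with $a_{ij}=\dim\frac{V_{i-1}+V_i\cap V'_j}{V_{i-1}+V_i\cap V'_{j-1}}$. Let $\mathcal S_d$ be the free $\mathcal A$-module with basis $(e_A)_{A\in\Theta_d}$ and product $e_A*e_B=\sum_{C}g_{A,B,C}(v^2)\,e_C$, where $g_{A,B,C}\in\mathbb Z[x]$ is the polynomial such that, for all such $q$ and all $(V,V')\in\mathcal O_C$, $g_{A,B,C}(q)$ is the number of flags $W$ with $(V,W)\in\mathcal O_A$ and $(W,V')\in\mathcal O_B$. Put $\{A\}=v^{-(d(A)-r(A))}t^{\,d(A)-r(A)}e_A$,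 where $d(A)$ is the dimension of the orbit $\mathcal O_A$ over an algebraically closed field and $r(A)=d(B)$ for the diagonal matrix $B$ with $b_{ii}=\sum_k a_{ik}$. Let $\widetilde\Theta$ be the set of $n\times n$ integer matrices with nonnegative off-diagonal entries, and for $A\in\widetilde\Theta$ let $\mathrm{ro}(A)$, $\mathrm{co}(A)\in\mathbb Z^n$ be its vectors of row and column sums and ${}_pA=A+pI$. Call a sequence $A_1,\dots,A_r\in\widetilde\Theta$ ($r\ge2$) composable if $\mathrm{co}(A_i)=\mathrm{ro}(A_{i+1})$ for $1\le i\le r-1$. (1) For every composable sequence $A_1,\dots,A_r$ there are $m\ge0$, pairwise distinct $Z_1,\dots,Z_m\in\widetilde\Theta$, polynomials $G_j(v,v',t,t')\in\mathfrak R$ ($1\le j\le m$) and $p_0\in\mathbb N$ such that for all $p\ge p_0$ there is $d\ge1$ for which all the matrices ${}_pA_i$ and ${}_pZ_j$ lie in $\Theta_d$, all $G_j(v,v^{-p},t,t^p)$ lie in $\mathcal A$, and in $\mathcal S_d$ $$\{{}_pA_1\}*\{{}_pA_2\}*\cdots*\{{}_pA_r\}=\sum_{j=1}^m G_j(v,v^{-p},t,t^p)\,\{{}_pZ_j\}.$$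 (2) Let $\mathcal K$ be the free $\mathcal A$-module on the symbols $\{A\}$, $A\in\widetilde\Theta$. There is a unique $\mathcal A$-bilinear associative product on $\mathcal K$ such that $\{A\}\cdot\{B\}=0$ whenever $\mathrm{co}(A)\ne\mathrm{ro}(B)$, and such that $$\{A_1\}\cdot\{A_2\}\cdots\{A_r\}=\sum_{j=1}^m G_j(v,1,t,1)\,\{Z_j\},\qquad G_j(v,1,t,1)\in\mathcal A,$$ for every composable sequence $A_1,\dots,A_r$ ($r\ge2$) and all $Z_j$, $G_j$ as in (1). The algebra $\mathcal K$ with this product has no unit element. -/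

import Mathlib

namespace QSchur

/-! The coefficient rings. -/

/-- The field `ℚ(v, t)`. -/
abbrev Qvt : Type := FractionRing (MvPolynomial (Fin 2) ℚ)

/-- The indeterminate `v` of `ℚ(v, t)`. -/
noncomputable def vK : Qvt := algebraMap (MvPolynomial (Fin 2) ℚ) Qvt (MvPolynomial.X 0)

/-- The indeterminate `t` of `ℚ(v, t)`. -/
noncomputable def tK : Qvt := algebraMap (MvPolynomial (Fin 2) ℚ) Qvt (MvPolynomial.X 1)

theorem vK_ne_zero : vK ≠ 0 := by
  unfold vK
  rw [Ne, IsFractionRing.to_map_eq_zero_iff]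
  exact MvPolynomial.X_ne_zero 0

theorem tK_ne_zero : tK ≠ 0 := by
  unfold tK
  rw [Ne, IsFractionRing.to_map_eq_zero_iff]
  exact MvPolynomial.X_ne_zero 1

/-- The Laurent polynomial ring `𝒜 = ℤ[v, v⁻¹, t, t⁻¹]`, as a subring of `ℚ(v, t)`. -/
noncomputable abbrev LaurentA : Subalgebra ℤ Qvt :=
  Algebra.adjoin ℤ {vK, vK⁻¹, tK, tK⁻¹}

/-- `v` as a unit of `𝒜`. -/
noncomputable def vA : LaurentAˣ where
  val := ⟨vK, Algebra.subset_adjoin (by simp)⟩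
  inv := ⟨vK⁻¹, Algebra.subset_adjoin (by simp)⟩
  val_inv := Subtype.ext (mul_inv_cancel₀ vK_ne_zero)
  inv_val := Subtype.ext (inv_mul_cancel₀ vK_ne_zero)

/-- `t` as a unit of `𝒜`. -/
noncomputable def tA : LaurentAˣ where
  val := ⟨tK, Algebra.subset_adjoin (by simp)⟩
  inv := ⟨tK⁻¹, Algebra.subset_adjoin (by simp)⟩
  val_inv := Subtype.ext (mul_inv_cancel₀ tK_ne_zero)
  inv_val := Subtype.ext (inv_mul_cancel₀ tK_ne_zero)

/-- The polynomial ring `ℚ(v, t)[v', t']`; the variable `0` is `v'`, the variable `1` is `t'`. -/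
abbrev PolyR : Type := MvPolynomial (Fin 2) Qvt

/-- The value `G(v, x, t, y)` of `G ∈ ℚ(v, t)[v', t']` at `v' = x`, `t' = y`. -/
noncomputable def evalR (x y : Qvt) (G : PolyR) : Qvt := MvPolynomial.eval ![x, y] G

/-! Matrices. -/

/-- The vector of row sums. -/
def ro {n : ℕ} {R : Type} [AddCommMonoid R] (A : Matrix (Fin n) (Fin n) R) : Fin n → R :=
  fun i => ∑ j, A i j

/-- The vector of column sums. -/
def co {n : ℕ} {R : Type} [AddCommMonoid R] (A : Matrix (Fin n) (Fin n) R) : Fin n → R :=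
  fun j => ∑ i, A i j

/-- `Θ_d`: the `n × n` matrices over `ℕ` whose entries add up to `d`. -/
def Theta (n d : ℕ) : Type := {A : Matrix (Fin n) (Fin n) ℕ // ∑ i, ∑ j, A i j = d}

instance (n d : ℕ) : Finite (Theta n d) := by
  have hle : ∀ (A : Theta n d) (i j : Fin n), A.1 i j < d + 1 := by
    intro A i j
    have h1 : A.1 i j ≤ ∑ j', A.1 i j' :=
      Finset.single_le_sum (f := fun j' => A.1 i j') (fun _ _ => Nat.zero_le _)
        (Finset.mem_univ j)
    have h2 : ∑ j', A.1 i j' ≤ ∑ i', ∑ j', A.1 i' j' :=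
      Finset.single_le_sum (f := fun i' => ∑ j', A.1 i' j') (fun _ _ => Nat.zero_le _)
        (Finset.mem_univ i)
    have h3 := A.2
    omega
  refine Finite.of_injective
    (fun (A : Theta n d) (i j : Fin n) => (⟨A.1 i j, hle A i j⟩ : Fin (d + 1))) ?_
  intro A B h
  apply Subtype.ext
  ext i j
  exact congrArg Fin.val (congrFun (congrFun h i) j)

instance (n d : ℕ) : DecidableEq (Theta n d) :=
  inferInstanceAs (DecidableEq {A : Matrix (Fin n) (Fin n) ℕ // ∑ i, ∑ j, A i j = d})

noncomputable instance (n d : ℕ) : Fintype (Theta n d) := Fintype.ofFinite _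

/-- `Θ̃`: the `n × n` matrices over `ℤ` whose off-diagonal entries are nonnegative. -/
def ThetaTilde (n : ℕ) : Type :=
  {A : Matrix (Fin n) (Fin n) ℤ // ∀ i j, i ≠ j → 0 ≤ A i j}

/-- `ₚA = A + p I`. -/
def shift {n : ℕ} (p : ℕ) (A : ThetaTilde n) : Matrix (Fin n) (Fin n) ℤ :=
  A.1 + (p : ℤ) • (1 : Matrix (Fin n) (Fin n) ℤ)

/-! Partial flags and their relative positions. -/

/-- An `n`-step flag `0 = V_0 ⊆ V_1 ⊆ ⋯ ⊆ V_n = E` of subspaces of `E`. -/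
structure StepFlag (F E : Type) [Field F] [AddCommGroup E] [Module F E] (n : ℕ) where
  /-- the subspaces of the flag -/
  sub : Fin (n + 1) → Submodule F E
  sub_mono : Monotone sub
  sub_zero : sub 0 = ⊥
  sub_last : sub (Fin.last n) = ⊤

/-- The matrix of a pair of flags: for `1 ≤ i, j ≤ n` its entry is
`dim (V_{i-1} + V_i ∩ V'_j) / (V_{i-1} + V_i ∩ V'_{j-1})`
(the index `i : Fin n` stands for `i + 1` in this formula). It classifies the orbits of `GL(E)` on
pairs of flags. -/
noncomputable def relPos {F E : Type} [Field F] [AddCommGroup E] [Module F E] {n : ℕ}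
    (V V' : StepFlag F E n) : Matrix (Fin n) (Fin n) ℕ := fun i j =>
  Module.finrank F
    (↥(V.sub i.castSucc ⊔ V.sub i.succ ⊓ V'.sub j.succ) ⧸
      (V.sub i.castSucc ⊔ V.sub i.succ ⊓ V'.sub j.castSucc).submoduleOf
        (V.sub i.castSucc ⊔ V.sub i.succ ⊓ V'.sub j.succ))

/-! The convolution algebra `𝒮_d`. -/

/-- `g` is the structure polynomial for `A, B, C ∈ Θ_d`: for every finite field `F` of odd
characteristic with `q` elements and every pair `(V, V')` in the orbit of `C`, the number of flags
`W` with `(V, W)` in the orbit of `A` and `(W, V')` in the orbit of `B` is `g(q)`. -/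
def IsStructPoly {n d : ℕ} (A B C : Theta n d) (g : Polynomial ℤ) : Prop :=
  ∀ (F : Type) [Field F] [Finite F], ringChar F ≠ 2 →
    ∀ V V' : StepFlag F (Fin d → F) n, relPos V V' = C.1 →
      (Nat.card {W : StepFlag F (Fin d → F) n // relPos V W = A.1 ∧ relPos W V' = B.1} : ℤ) =
        g.eval (Nat.card F : ℤ)

open Classical in
/-- The structure polynomial. It exists and is unique, so the value `0` of the `else` branch is
never taken. -/
noncomputable def structPoly {n d : ℕ} (A B C : Theta n d) : Polynomial ℤ :=
  if h : ∃ g, IsStructPoly A B C g then h.choose else 0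

/-- The module underlying `𝒮_d`: the `𝒜`-valued invariant functions on pairs of flags, that is, the
`𝒜`-valued functions on the set `Θ_d` of orbits. The characteristic function `e_A` of the orbit of
`A` is `Pi.single A 1`. -/
abbrev SchurAlg (n d : ℕ) : Type := Theta n d → LaurentA

/-- The convolution product `*` of `𝒮_d`: it is `𝒜`-bilinear and
`e_A * e_B = ∑_C g_{A,B,C}(v²) e_C`, which for `v = √q` is the convolution
`(f * g)(V, V') = ∑_W f(V, W) g(W, V')` over the field with `q` elements. -/
noncomputable def conv {n d : ℕ} (f g : SchurAlg n d) : SchurAlg n d := fun C =>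
  ∑ A, ∑ B, f A * g B * Polynomial.aeval ((vA : LaurentA) ^ 2) (structPoly A B C)

/-! Orbit dimensions and the basis `{A}`. -/

/-- The cells of `A`: `a_{ij}` cells in each position `(i, j)`. -/
def Cell {n : ℕ} (A : Matrix (Fin n) (Fin n) ℕ) : Type :=
  (p : Fin n × Fin n) × Fin (A p.1 p.2)

instance {n : ℕ} (A : Matrix (Fin n) (Fin n) ℕ) : Fintype (Cell A) :=
  inferInstanceAs (Fintype ((p : Fin n × Fin n) × Fin (A p.1 p.2)))

instance {n : ℕ} (A : Matrix (Fin n) (Fin n) ℕ) : DecidableEq (Cell A) :=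
  inferInstanceAs (DecidableEq ((p : Fin n × Fin n) × Fin (A p.1 p.2)))

/-- The cells at position `(i, j)`. -/
def cellAt {n : ℕ} (A : Matrix (Fin n) (Fin n) ℕ) (i j : Fin n) (x : Fin (A i j)) : Cell A :=
  ⟨(i, j), x⟩

theorem cellAt_injective {n : ℕ} (A : Matrix (Fin n) (Fin n) ℕ) (i j : Fin n) :
    Function.Injective (cellAt A i j) :=
  fun _ _ h => eq_of_heq (Sigma.mk.inj h).2

theorem mem_range_cellAt {n : ℕ} (A : Matrix (Fin n) (Fin n) ℕ) (i j : Fin n) (c : Cell A) :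
    c ∈ Set.range (cellAt A i j) ↔ (c.1.1 : ℕ) = i ∧ (c.1.2 : ℕ) = j := by
  constructor
  · rintro ⟨x, rfl⟩
    exact ⟨rfl, rfl⟩
  · obtain ⟨⟨a, b⟩, x⟩ := c
    rintro ⟨ha, hb⟩
    obtain rfl := Fin.ext ha
    obtain rfl := Fin.ext hb
    exact ⟨x, rfl⟩

/-- The coordinate flag of the space with basis the cells of `A`, given by a function `f` on the
positions: its `a`-th member is spanned by the cells at positions with `f < a`. -/
noncomputable def coordFlag (K : Type) [Field K] {n : ℕ} (A : Matrix (Fin n) (Fin n) ℕ)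
    (f : Fin n × Fin n → Fin n) : StepFlag K (Cell A →₀ K) n where
  sub a := Finsupp.supported K K {c : Cell A | (f c.1 : ℕ) < a}
  sub_mono a b h := Finsupp.supported_mono (fun c hc =>
    lt_of_lt_of_le (show (f c.1 : ℕ) < (a : ℕ) from hc) (Fin.le_def.mp h))
  sub_zero := by simp
  sub_last := by simp

/-- A pair `(V, V')` of flags in the orbit of `A`: the flags given by rows and by columns. -/
noncomputable abbrev rowFlag (K : Type) [Field K] {n : ℕ} (A : Matrix (Fin n) (Fin n) ℕ) :
    StepFlag K (Cell A →₀ K) n := coordFlag K A Prod.fst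

/-- See `rowFlag`. -/
noncomputable abbrev colFlag (K : Type) [Field K] {n : ℕ} (A : Matrix (Fin n) (Fin n) ℕ) :
    StepFlag K (Cell A →₀ K) n := coordFlag K A Prod.snd

theorem relPos_rowFlag_colFlag (K : Type) [Field K] {n : ℕ} (A : Matrix (Fin n) (Fin n) ℕ) :
    relPos (rowFlag K A) (colFlag K A) = A := by
  classical
  have hfin : ∀ s : Set (Cell A), Module.finrank K (Finsupp.supported K K s) = Nat.card s := by
    intro s
    rw [(Finsupp.supportedEquivFinsupp s).finrank_eq, Module.finrank_finsupp_self,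
      Nat.card_eq_fintype_card]
  ext i j
  set S : Set (Cell A) := {c | (c.1.1 : ℕ) < i} ∪ {c | (c.1.1 : ℕ) < i + 1 ∧ (c.1.2 : ℕ) < j + 1}
    with hS
  set T : Set (Cell A) := {c | (c.1.1 : ℕ) < i} ∪ {c | (c.1.1 : ℕ) < i + 1 ∧ (c.1.2 : ℕ) < j}
    with hT
  have h1 : (rowFlag K A).sub i.castSucc ⊔ (rowFlag K A).sub i.succ ⊓ (colFlag K A).sub j.succ =
      Finsupp.supported K K S := by
    simp only [coordFlag, ← Finsupp.supported_inter, ← Finsupp.supported_union, hS]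
    rfl
  have h2 : (rowFlag K A).sub i.castSucc ⊔
      (rowFlag K A).sub i.succ ⊓ (colFlag K A).sub j.castSucc = Finsupp.supported K K T := by
    simp only [coordFlag, ← Finsupp.supported_inter, ← Finsupp.supported_union, hT]
    rfl
  have memS : ∀ c : Cell A, c ∈ S ↔
      (c.1.1 : ℕ) < i ∨ ((c.1.1 : ℕ) < i + 1 ∧ (c.1.2 : ℕ) < j + 1) := fun _ => Iff.rfl
  have memT : ∀ c : Cell A, c ∈ T ↔
      (c.1.1 : ℕ) < i ∨ ((c.1.1 : ℕ) < i + 1 ∧ (c.1.2 : ℕ) < j) := fun _ => Iff.rfl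
  have hTS : T ⊆ S := by
    rintro c (hc | hc)
    · exact Or.inl hc
    · exact Or.inr ⟨hc.1, hc.2.trans (Nat.lt_succ_self _)⟩
  unfold relPos
  rw [h1, h2]
  have h3 := Submodule.finrank_quotient_add_finrank (R := K) (M := ↥(Finsupp.supported K K S))
    ((Finsupp.supported K K T).submoduleOf (Finsupp.supported K K S))
  rw [(Submodule.submoduleOfEquivOfLe (Finsupp.supported_mono hTS)).finrank_eq, hfin, hfin] at h3
  have h4 : Nat.card S = Nat.card T + A i j := by
    have hdiff : S = T ∪ Set.range (cellAt A i j) := by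
      apply Set.ext
      intro c
      refine Iff.trans (memS c) (Iff.trans ?_ (Iff.symm (Set.mem_union c _ _)))
      rw [memT, mem_range_cellAt]
      omega
    have hdisj : Disjoint T (Set.range (cellAt A i j)) := by
      rw [Set.disjoint_left]
      intro c hc hc'
      rw [memT] at hc
      rw [mem_range_cellAt] at hc'
      omega
    simp only [Nat.card_coe_set_eq]
    rw [hdiff, Set.ncard_union_eq hdisj (Set.toFinite _) (Set.toFinite _),
      ← Nat.card_coe_set_eq (Set.range _), Nat.card_range_of_injective (cellAt_injective A i j), Nat.card_fin]
  omega

/-- The algebra of endomorphisms that preserve both flags. Its group of units is the stabilizer of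
the pair in `GL(E)`. -/
def stabAlg {K E : Type} [Field K] [AddCommGroup E] [Module K E] {n : ℕ}
    (V V' : StepFlag K E n) : Submodule K (E →ₗ[K] E) where
  carrier := {T | ∀ a, (∀ x ∈ V.sub a, T x ∈ V.sub a) ∧ (∀ x ∈ V'.sub a, T x ∈ V'.sub a)}
  add_mem' hS hT a := ⟨fun x hx => add_mem ((hS a).1 x hx) ((hT a).1 x hx),
    fun x hx => add_mem ((hS a).2 x hx) ((hT a).2 x hx)⟩
  zero_mem' _ := ⟨fun _ _ => zero_mem _, fun _ _ => zero_mem _⟩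
  smul_mem' r _ hT a := ⟨fun x hx => Submodule.smul_mem _ r ((hT a).1 x hx),
    fun x hx => Submodule.smul_mem _ r ((hT a).2 x hx)⟩

/-- The dimension over `K` of the orbit of `A`, that is `dim GL(E)` minus the dimension of the
stabilizer of a pair in the orbit. The stabilizer is a nonempty Zariski open subset of the linear
space `stabAlg`, so its dimension is the linear dimension. -/
noncomputable def orbitDimOver (K : Type) [Field K] {n : ℕ} (A : Matrix (Fin n) (Fin n) ℕ) : ℤ :=
  (Module.finrank K ((Cell A →₀ K) →ₗ[K] (Cell A →₀ K)) : ℤ) -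
    Module.finrank K (stabAlg (rowFlag K A) (colFlag K A))

theorem mem_stabAlg_iff (K : Type) [Field K] {n : ℕ} (A : Matrix (Fin n) (Fin n) ℕ)
    (T : (Cell A →₀ K) →ₗ[K] (Cell A →₀ K)) :
    T ∈ stabAlg (rowFlag K A) (colFlag K A) ↔
      ∀ c c' : Cell A, ¬ (c'.1.1 ≤ c.1.1 ∧ c'.1.2 ≤ c.1.2) → T (Finsupp.single c 1) c' = 0 := by
  have key : ∀ f : Fin n × Fin n → Fin n,
      (∀ a, ∀ x ∈ (coordFlag K A f).sub a, T x ∈ (coordFlag K A f).sub a) ↔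
        ∀ c c' : Cell A, ¬ f c'.1 ≤ f c.1 → T (Finsupp.single c 1) c' = 0 := by
    intro f
    constructor
    · intro h c c' hcc
      have h1 := h (f c.1).succ (Finsupp.single c 1)
        (Finsupp.single_mem_supported K 1 (by simp))
      by_contra h0
      have h2 := (Finsupp.mem_supported K _).1 h1 (Finsupp.mem_support_iff.2 h0)
      have h3 : (f c'.1 : ℕ) < (f c.1 : ℕ) + 1 := h2
      exact hcc (Fin.le_def.2 (by omega))
    · intro h a x hx
      refine (Finsupp.mem_supported' K _).2 fun c' hc' => ?_
      have hx' := (Finsupp.mem_supported' K _).1 hx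
      rw [← Finsupp.sum_single x, Finsupp.sum, map_sum, Finsupp.finsetSum_apply]
      refine Finset.sum_eq_zero fun c _ => ?_
      have h1 : Finsupp.single c (x c) = x c • Finsupp.single c (1 : K) := by simp
      rw [h1, map_smul, Finsupp.smul_apply]
      by_cases hc : (f c.1 : ℕ) < a
      · rw [h c c' ?_, smul_zero]
        intro hle
        exact hc' (lt_of_le_of_lt (Fin.le_def.1 hle) hc)
      · rw [hx' c hc, zero_smul]
  have h1 := key Prod.fst
  have h2 := key Prod.snd
  constructor
  · intro h c c' hcc
    by_cases hr : c'.1.1 ≤ c.1.1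
    · exact h2.1 (fun a => (h a).2) c c' fun hc => hcc ⟨hr, hc⟩
    · exact h1.1 (fun a => (h a).1) c c' hr
  · intro h a
    exact ⟨h1.2 (fun c c' hr => h c c' fun hh => hr hh.1) a,
      h2.2 (fun c c' hr => h c c' fun hh => hr hh.2) a⟩

theorem finrank_stabAlg (K : Type) [Field K] {n : ℕ} (A : Matrix (Fin n) (Fin n) ℕ) :
    Module.finrank K (stabAlg (rowFlag K A) (colFlag K A)) =
      Fintype.card {x : Cell A × Cell A // x.2.1.1 ≤ x.1.1.1 ∧ x.2.1.2 ≤ x.1.1.2} := by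
  let L : stabAlg (rowFlag K A) (colFlag K A) →ₗ[K]
      ({x : Cell A × Cell A // x.2.1.1 ≤ x.1.1.1 ∧ x.2.1.2 ≤ x.1.1.2} → K) :=
    { toFun := fun T x => T.1 (Finsupp.single x.1.1 1) x.1.2
      map_add' := fun _ _ => rfl
      map_smul' := fun _ _ => rfl }
  have hL : Function.Bijective L := by
    constructor
    · intro S T h
      apply Subtype.ext
      refine Finsupp.lhom_ext' fun c => LinearMap.ext_ring ?_
      ext c'
      by_cases hc : c'.1.1 ≤ c.1.1 ∧ c'.1.2 ≤ c.1.2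
      · exact congrFun h ⟨(c, c'), hc⟩
      · exact ((mem_stabAlg_iff K A S.1).1 S.2 c c' hc).trans
          ((mem_stabAlg_iff K A T.1).1 T.2 c c' hc).symm
    · intro g
      let T : (Cell A →₀ K) →ₗ[K] (Cell A →₀ K) :=
        Finsupp.linearCombination K fun c => Finsupp.equivFunOnFinite.symm fun c' =>
          if h : c'.1.1 ≤ c.1.1 ∧ c'.1.2 ≤ c.1.2 then g ⟨(c, c'), h⟩ else 0
      refine ⟨⟨T, (mem_stabAlg_iff K A T).2 fun c c' h => ?_⟩, ?_⟩
      · simp [T, h]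
      · funext x
        change T (Finsupp.single x.1.1 1) x.1.2 = g x
        simp [T, x.2]
  rw [(LinearEquiv.ofBijective L hL).finrank_eq, Module.finrank_fintype_fun_eq_card]

theorem sum_cell {n : ℕ} (A : Matrix (Fin n) (Fin n) ℕ) (f : Fin n → Fin n → ℤ) :
    ∑ c : Cell A, f c.1.1 c.1.2 = ∑ i, ∑ j, (A i j : ℤ) * f i j := by
  rw [← Fintype.sum_prod_type' fun i j => (A i j : ℤ) * f i j]
  refine (Fintype.sum_sigma (fun c : (p : Fin n × Fin n) × Fin (A p.1 p.2) =>
    f c.1.1 c.1.2)).trans (Finset.sum_congr rfl fun p _ => ?_)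
  simp

/-- The dimension of the orbit of `A`, over every field. -/
theorem orbitDimOver_eq (K : Type) [Field K] {n : ℕ} (A : Matrix (Fin n) (Fin n) ℕ) :
    orbitDimOver K A = ∑ i, ∑ j, ∑ k, ∑ l, if i < k ∨ j < l then (A i j : ℤ) * A k l else 0 := by
  have h1 : (Module.finrank K ((Cell A →₀ K) →ₗ[K] (Cell A →₀ K)) : ℤ) =
      ∑ _c : Cell A, ∑ _c' : Cell A, (1 : ℤ) := by
    rw [Module.finrank_linearMap, Module.finrank_finsupp_self]
    simp
  have h2 : (Module.finrank K (stabAlg (rowFlag K A) (colFlag K A)) : ℤ) =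
      ∑ c : Cell A, ∑ c' : Cell A, if c'.1.1 ≤ c.1.1 ∧ c'.1.2 ≤ c.1.2 then (1 : ℤ) else 0 := by
    rw [finrank_stabAlg, Fintype.card_subtype, Finset.card_filter]
    push_cast
    rw [← Fintype.sum_prod_type']
  have h3 : orbitDimOver K A =
      ∑ c : Cell A, ∑ c' : Cell A, if c.1.1 < c'.1.1 ∨ c.1.2 < c'.1.2 then (1 : ℤ) else 0 := by
    unfold orbitDimOver
    rw [h1, h2, ← Finset.sum_sub_distrib]
    refine Finset.sum_congr rfl fun c _ => ?_
    rw [← Finset.sum_sub_distrib]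
    refine Finset.sum_congr rfl fun c' _ => ?_
    by_cases h : c'.1.1 ≤ c.1.1 ∧ c'.1.2 ≤ c.1.2
    · have h' : ¬ (c.1.1 < c'.1.1 ∨ c.1.2 < c'.1.2) := by
        rintro (hh | hh)
        · exact absurd h.1 (not_le.2 hh)
        · exact absurd h.2 (not_le.2 hh)
      simp [h, h']
    · have h' : c.1.1 < c'.1.1 ∨ c.1.2 < c'.1.2 := by
        by_contra hh
        push Not at hh
        exact h hh
      simp only [h, h', if_true, if_false, sub_zero]
  rw [h3]
  have h4 : ∀ c : Cell A,
      (∑ c' : Cell A, if c.1.1 < c'.1.1 ∨ c.1.2 < c'.1.2 then (1 : ℤ) else 0) =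
        ∑ k, ∑ l, (A k l : ℤ) * if c.1.1 < k ∨ c.1.2 < l then (1 : ℤ) else 0 := fun c =>
    sum_cell A fun k l => if c.1.1 < k ∨ c.1.2 < l then (1 : ℤ) else 0
  rw [Finset.sum_congr rfl fun c _ => h4 c]
  rw [sum_cell A fun i j => ∑ k, ∑ l, (A k l : ℤ) * if i < k ∨ j < l then (1 : ℤ) else 0]
  refine Finset.sum_congr rfl fun i _ => Finset.sum_congr rfl fun j _ => ?_
  rw [Finset.mul_sum]
  refine Finset.sum_congr rfl fun k _ => ?_
  rw [Finset.mul_sum]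
  refine Finset.sum_congr rfl fun l _ => ?_
  split_ifs <;> simp

/-- `d(A)`, the dimension of the orbit of `A` over an algebraically closed field (it does not depend
on the field, see `orbitDimOver_eq`). -/
noncomputable def orbitDim {n : ℕ} (A : Matrix (Fin n) (Fin n) ℕ) : ℤ :=
  orbitDimOver (AlgebraicClosure (ZMod 3)) A

/-- `d(A) - r(A)`, where `r(A) = d(B)` for the diagonal matrix `B` with `b_{ii} = ∑_k a_{ik}`. -/
noncomputable def braceExp {n : ℕ} (A : Matrix (Fin n) (Fin n) ℕ) : ℤ :=
  orbitDim A - orbitDim (Matrix.diagonal (ro A))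

theorem braceExp_eq {n : ℕ} (A : Matrix (Fin n) (Fin n) ℕ) :
    braceExp A = ∑ i, ∑ j, ∑ k, ∑ l, if k ≤ i ∧ j < l then (A i j : ℤ) * A k l else 0 := by
  have hd : orbitDim (Matrix.diagonal (ro A)) =
      ∑ i, ∑ j, ∑ k, ∑ l, if i < k then (A i j : ℤ) * A k l else 0 := by
    unfold orbitDim
    rw [orbitDimOver_eq]
    refine Finset.sum_congr rfl fun i _ => ?_
    rw [Finset.sum_eq_single i (fun j _ hj => by simp [Matrix.diagonal_apply_ne' _ hj]) (by simp)]
    conv_rhs => rw [Finset.sum_comm]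
    refine Finset.sum_congr rfl fun k _ => ?_
    rw [Finset.sum_eq_single k
      (fun j _ hj => by rw [Matrix.diagonal_apply_ne' _ hj]; simp) (by simp)]
    by_cases h : i < k
    · simp [h, ro, Finset.sum_mul_sum]
    · simp [h]
  unfold braceExp
  rw [hd, orbitDim, orbitDimOver_eq]
  simp only [← Finset.sum_sub_distrib]
  refine Finset.sum_congr rfl fun i _ => Finset.sum_congr rfl fun j _ =>
    Finset.sum_congr rfl fun k _ => Finset.sum_congr rfl fun l _ => ?_
  by_cases h1 : i < k <;> by_cases h2 : j < l <;> simp [h1, h2, not_le.2, not_lt.1]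

/-- `{A} = v^{-(d(A)-r(A))} t^{d(A)-r(A)} e_A` in `𝒮_d`. -/
noncomputable def brace {n d : ℕ} (A : Theta n d) : SchurAlg n d :=
  Pi.single A ((vA ^ (-braceExp A.1) * tA ^ braceExp A.1 : LaurentAˣ) : LaurentA)

/-- The integer matrix `M` lies in `Θ_d`. -/
def InTheta {n : ℕ} (d : ℕ) (M : Matrix (Fin n) (Fin n) ℤ) : Prop :=
  (∀ i j, 0 ≤ M i j) ∧ ∑ i, ∑ j, M i j = (d : ℤ)

/-- An integer matrix in `Θ_d`, as an element of `Θ_d`. -/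
def InTheta.toTheta {n d : ℕ} {M : Matrix (Fin n) (Fin n) ℤ} (h : InTheta d M) : Theta n d :=
  ⟨fun i j => (M i j).toNat, by
    have h2 : ((∑ i, ∑ j, (M i j).toNat : ℕ) : ℤ) = (d : ℤ) := by
      rw [← h.2]
      push_cast
      exact Finset.sum_congr rfl fun i _ => Finset.sum_congr rfl fun j _ =>
        Int.toNat_of_nonneg (h.1 i j)
    exact_mod_cast h2⟩

/-! Products, stabilization, and the module `𝒦`. -/

/-- The product `(⋯((x_1 x_2) x_3)⋯) x_r` of a nonempty list. -/
def chainProd {M : Type} [Zero M] (mul : M → M → M) : List M → M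
  | [] => 0
  | x :: l => l.foldl mul x

/-- `co(A_i) = ro(A_{i+1})` for all `i < r`. -/
def Composable {n r : ℕ} (A : Fin r → ThetaTilde n) : Prop :=
  ∀ i j : Fin r, (i : ℕ) + 1 = j → co (A i).1 = ro (A j).1

/-- For all `p ≥ p₀` the matrices `ₚA_i` and `ₚZ_j` lie in a common `Θ_d`, the values
`G_j(v, v^{-p}, t, t^p)` lie in `𝒜`, and
`{ₚA_1} * ⋯ * {ₚA_r} = ∑_j G_j(v, v^{-p}, t, t^p) {ₚZ_j}` in `𝒮_d`; the `Z_j` are distinct. -/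
def Stabilizes {n r : ℕ} (A : Fin r → ThetaTilde n) {m : ℕ} (Z : Fin m → ThetaTilde n)
    (G : Fin m → PolyR) (p₀ : ℕ) : Prop :=
  Function.Injective Z ∧
  ∀ p : ℕ, p₀ ≤ p → ∃ d : ℕ, 0 < d ∧
    ∃ (hA : ∀ i, InTheta d (shift p (A i))) (hZ : ∀ j, InTheta d (shift p (Z j)))
      (c : Fin m → LaurentA),
      (∀ j, (c j : Qvt) = evalR (vK ^ (-(p : ℤ))) (tK ^ p) (G j)) ∧
      chainProd conv (List.ofFn fun i => brace (hA i).toTheta) =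
        ∑ j, c j • brace (hZ j).toTheta

/-- The free `𝒜`-module `𝒦` on the symbols `{A}`, `A ∈ Θ̃`. -/
abbrev KMod (n : ℕ) : Type := ThetaTilde n →₀ LaurentA

/-- The basis element `{A}` of `𝒦`. -/
noncomputable def kBrace {n : ℕ} (A : ThetaTilde n) : KMod n := Finsupp.single A 1

/-- The `𝒜`-bilinear product `mul` on `𝒦` is associative and is the specialization of the
stabilized products at `v' = 1`, `t' = 1`: one has
`{A_1} ⋯ {A_r} = ∑_j G_j(v, 1, t, 1) {Z_j}` (with coefficients in `𝒜`) whenever `r ≥ 2`,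
the `A_i` are composable and their products stabilize with `Z_j` and `G_j`; and
`{A} {B} = 0` if `co(A) ≠ ro(B)`. -/
def IsLimitProduct {n : ℕ} (mul : KMod n →ₗ[LaurentA] KMod n →ₗ[LaurentA] KMod n) : Prop :=
  (∀ x y z, mul (mul x y) z = mul x (mul y z)) ∧
  (∀ A B : ThetaTilde n, co A.1 ≠ ro B.1 → mul (kBrace A) (kBrace B) = 0) ∧
  (∀ r : ℕ, 2 ≤ r → ∀ A : Fin r → ThetaTilde n, Composable A →
    ∀ (m : ℕ) (Z : Fin m → ThetaTilde n) (G : Fin m → PolyR) (p₀ : ℕ), Stabilizes A Z G p₀ →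
      ∃ c : Fin m → LaurentA, (∀ j, (c j : Qvt) = evalR 1 1 (G j)) ∧
        chainProd (fun x y => mul x y) (List.ofFn fun i => kBrace (A i)) =
          ∑ j, c j • kBrace (Z j))

end QSchur

open QSchur

/-! Products with a matrix that has one off-diagonal unit, next to the diagonal, can be computed by
hand. If `V` and `W` differ in one subspace only, with codimension one there, then passing from `(W,
V')` to `(V, V')` moves one unit of the relative position between two adjacent rows, inside some
column `w`. For a given pair `(V, V')` the number of such `W` is a power of `q` times a `q`-integer
(`card_elemMat`), because it is a difference of two numbers of hyperplanes, or of lines, between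
fixed subspaces.

These elementary products generate everything triangularly. Each non-diagonal `A` is the term `w =
u` in the product of an elementary matrix with some `A'`, where `A'` and all the other admissible
terms are closer to the diagonal for the quadratic weight `spread` (`exists_move`). Induction on
`spread` is used twice. Over finite fields it gives the structure polynomials
(`isPolyFamily_orbitMatrix_mul`): the coefficient of `A` is monic in `q` and the counts are
integers, so the division can be carried out in `ℤ[X]`. Associativity of the structure constants
then comes from that of matrices indexed by flags. Over `ℚ(v, t)` it gives stabilization
(`leftStable`): after the rescaling to `{A}`, the coefficients of an elementary product at `A + pI`
are polynomials in `v^{-p}` and `t^p` (`moveVal_shiftZ`), and the coefficient to be inverted is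
nonzero and independent of `p`.

Monomials in `v^{-p}, t^p` are exponential functions of `p` with distinct bases, so a polynomial `G`
is determined by its values for large `p` (`eq_of_eventually_evalAt_eq`). Hence the stable structure
constants are unique and inherit associativity, already before `v' = t' = 1` is substituted.
Integrality survives this substitution because the values of `G` satisfy a linear recurrence over
`𝒜` whose constant term is a unit; it can be run backwards from large `p` down to `p = 0`, where
`v^{-p} = t^p = 1` (`evalR_one_mem`).

There is no unit because an element of `𝒦` has finite support, while a diagonal matrix can be chosen
whose row sums match the column sums of nothing in that support. -/

namespace QSchur

/-! ### Lines and hyperplanes between two subspaces -/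

section Counting

variable {F E : Type} [Field F] [AddCommGroup E] [Module F E]

theorem finrank_comap_mkQ [FiniteDimensional F E] (X : Submodule F E) (H : Submodule F (E ⧸ X)) :
    Module.finrank F (H.comap X.mkQ) = Module.finrank F X + Module.finrank F H := by
  have h := LinearMap.finrank_range_add_finrank_ker (X.mkQ.domRestrict (H.comap X.mkQ))
  rw [LinearMap.range_domRestrict, Submodule.map_comap_eq_of_surjective X.mkQ_surjective,
    LinearMap.ker_domRestrict, Submodule.ker_mkQ] at h
  have hX : X ≤ H.comap X.mkQ := by
    intro x hx
    rw [Submodule.mem_comap, Submodule.mkQ_apply, (Submodule.Quotient.mk_eq_zero X).2 hx]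
    exact H.zero_mem
  have h2 := (Submodule.submoduleOfEquivOfLe hX).finrank_eq
  unfold Submodule.submoduleOf at h2
  omega

/-- Such subspaces correspond to the points of the projective space of `Y / X`, realized here as the
image of `Y` in `E ⧸ X`. -/
theorem card_lines_between [Finite F] [FiniteDimensional F E] {X Y : Submodule F E} (hXY : X ≤ Y) :
    Nat.card {L : Submodule F E // X ≤ L ∧ L ≤ Y ∧
      Module.finrank F L = Module.finrank F X + 1} =
      ∑ i ∈ Finset.range (Module.finrank F Y - Module.finrank F X), Nat.card F ^ i := by
  set Z : Submodule F (E ⧸ X) := Y.map X.mkQ with hZ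
  have hYZ : Z.comap X.mkQ = Y := by
    rw [hZ, Submodule.comap_map_eq, Submodule.ker_mkQ, sup_eq_left.2 hXY]
  have hfin : Module.finrank F Z = Module.finrank F Y - Module.finrank F X := by
    have := finrank_comap_mkQ X Z
    rw [hYZ] at this
    omega
  rw [← Projectivization.card_of_finrank F Z hfin,
    Nat.card_congr (Projectivization.equivSubmodule F Z)]
  symm
  have hle : ∀ H : Submodule F (E ⧸ X), X ≤ H.comap X.mkQ := fun H => by
    intro x hx
    rw [Submodule.mem_comap, Submodule.mkQ_apply, (Submodule.Quotient.mk_eq_zero X).2 hx]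
    exact H.zero_mem
  have hr : ∀ H : Submodule F Z, Module.finrank F (H.map Z.subtype) = Module.finrank F H := fun H =>
    (Submodule.equivMapOfInjective Z.subtype Z.injective_subtype H).finrank_eq.symm
  refine Nat.card_congr (Equiv.ofBijective (fun H => ⟨(H.1.map Z.subtype).comap X.mkQ, hle _, ?_, ?_⟩)
    ⟨?_, ?_⟩)
  · rw [← hYZ]
    exact Submodule.comap_mono (Submodule.map_subtype_le Z H.1)
  · rw [finrank_comap_mkQ, hr, H.2]
  · intro H H' h
    have h1 := congrArg Subtype.val h
    have h2 := Submodule.comap_injective_of_surjective X.mkQ_surjective h1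
    exact Subtype.ext (Submodule.map_injective_of_injective Z.injective_subtype h2)
  · rintro ⟨L, hXL, hLY, hL⟩
    have h1 : (L.map X.mkQ).comap X.mkQ = L := by
      rw [Submodule.comap_map_eq, Submodule.ker_mkQ, sup_eq_left.2 hXL]
    have h2 : ((L.map X.mkQ).comap Z.subtype).map Z.subtype = L.map X.mkQ := by
      rw [Submodule.map_comap_subtype, inf_eq_right.2 (Submodule.map_mono hLY)]
    refine ⟨⟨(L.map X.mkQ).comap Z.subtype, ?_⟩, ?_⟩
    · have := finrank_comap_mkQ X (L.map X.mkQ)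
      rw [← hr, h2]
      rw [h1] at this
      omega
    · apply Subtype.ext
      simp only [h2, h1]

/-- Annihilators reverse inclusions and turn dimension into codimension, so this is the count of
lines in the dual space. -/
theorem card_hyperplanes_between [Finite F] [FiniteDimensional F E] {X Y : Submodule F E}
    (hXY : X ≤ Y) :
    Nat.card {H : Submodule F E // X ≤ H ∧ H ≤ Y ∧
      Module.finrank F H + 1 = Module.finrank F Y} =
      ∑ i ∈ Finset.range (Module.finrank F Y - Module.finrank F X), Nat.card F ^ i := by
  have hann := fun W : Submodule F E => Subspace.finrank_add_finrank_dualAnnihilator_eq (K := F) W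
  have h := card_lines_between (F := F) (Submodule.dualAnnihilator_anti hXY)
  have h3 : Module.finrank F X.dualAnnihilator - Module.finrank F Y.dualAnnihilator =
      Module.finrank F Y - Module.finrank F X := by
    have := hann X
    have := hann Y
    omega
  rw [← h3, ← h]
  let e := (Subspace.orderIsoFiniteDimensional (K := F) (V := E)).toEquiv.trans OrderDual.ofDual
  refine Nat.card_congr (e.subtypeEquiv fun H => ?_)
  have he : e H = H.dualAnnihilator := rfl
  rw [he, Subspace.dualAnnihilator_le_dualAnnihilator_iff,
    Subspace.dualAnnihilator_le_dualAnnihilator_iff]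
  have := hann H
  have := hann Y
  constructor
  · rintro ⟨h1, h2, h3⟩
    exact ⟨h2, h1, by omega⟩
  · rintro ⟨h1, h2, h3⟩
    exact ⟨h2, h1, by omega⟩

end Counting

/-! ### Partial sums of vectors and matrices -/

/-- The sum of `g k` over `k < i`. -/
def psum {n : ℕ} (g : Fin n → ℤ) (i : Fin (n + 1)) : ℤ := ∑ k : Fin n, if (k : ℕ) < i then g k else 0

theorem psum_zero {n : ℕ} (g : Fin n → ℤ) : psum g 0 = 0 := by simp [psum]

theorem psum_last {n : ℕ} (g : Fin n → ℤ) : psum g (Fin.last n) = ∑ k, g k := by simp [psum]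

theorem psum_succ {n : ℕ} (g : Fin n → ℤ) (i : Fin n) :
    psum g i.succ = psum g i.castSucc + g i := by
  unfold psum
  have : g i = ∑ k, if k = i then g k else 0 := by simp
  rw [this, ← Finset.sum_add_distrib]
  refine Finset.sum_congr rfl fun k _ => ?_
  have hk : k = i ↔ (k : ℕ) = i := Fin.ext_iff
  simp only [Fin.val_succ, Fin.val_castSucc, hk]
  split_ifs <;> omega

theorem psum_add {n : ℕ} (g g' : Fin n → ℤ) (i : Fin (n + 1)) :
    psum (fun k => g k + g' k) i = psum g i + psum g' i := by
  unfold psum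
  rw [← Finset.sum_add_distrib]
  exact Finset.sum_congr rfl fun k _ => by split_ifs <;> simp

theorem psum_sub {n : ℕ} (g g' : Fin n → ℤ) (i : Fin (n + 1)) :
    psum (fun k => g k - g' k) i = psum g i - psum g' i := by
  unfold psum
  rw [← Finset.sum_sub_distrib]
  exact Finset.sum_congr rfl fun k _ => by split_ifs <;> simp

theorem psum_single {n : ℕ} (b : Fin n) (x : ℤ) (i : Fin (n + 1)) :
    psum (Pi.single b x) i = if (b : ℕ) < i then x else 0 := by
  unfold psum
  rw [Finset.sum_eq_single b (fun k _ hk => by simp [hk]) (by simp)]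
  simp

theorem eq_psum {n : ℕ} {R : Fin (n + 1) → ℤ} {g : Fin n → ℤ} (h0 : R 0 = 0)
    (h : ∀ i, R i.succ - R i.castSucc = g i) (i : Fin (n + 1)) : R i = psum g i := by
  induction i using Fin.induction with
  | zero => rw [h0, psum_zero]
  | succ i ih => rw [psum_succ, ← ih, ← h i]; ring

/-- The sum of the entries of `A` at positions `(k, l)` with `k < i` and `l < j`. -/
def cum {n : ℕ} (A : Matrix (Fin n) (Fin n) ℤ) (i j : Fin (n + 1)) : ℤ :=
  psum (fun k => psum (A k) j) i

theorem cum_add {n : ℕ} (A B : Matrix (Fin n) (Fin n) ℤ) (i j : Fin (n + 1)) :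
    cum (A + B) i j = cum A i j + cum B i j := by
  unfold cum
  rw [← psum_add]
  congr 1
  funext k
  exact psum_add _ _ j

theorem cum_sub {n : ℕ} (A B : Matrix (Fin n) (Fin n) ℤ) (i j : Fin (n + 1)) :
    cum (A - B) i j = cum A i j - cum B i j := by
  unfold cum
  rw [← psum_sub]
  congr 1
  funext k
  exact psum_sub _ _ j

theorem cum_single {n : ℕ} (a b : Fin n) (i j : Fin (n + 1)) :
    cum (Matrix.single a b 1) i j = if (a : ℕ) < i ∧ (b : ℕ) < j then 1 else 0 := by
  unfold cum
  have : (fun k => psum ((Matrix.single a b (1 : ℤ)) k) j) =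
      Pi.single a (if (b : ℕ) < j then 1 else 0) := by
    funext k
    by_cases hk : k = a
    · subst hk
      rw [Pi.single_eq_same, ← psum_single b 1 j]
      congr 1
      funext l
      by_cases hl : l = b
      · subst hl; simp
      · simp [hl, Ne.symm hl]
    · rw [Pi.single_eq_of_ne hk]
      unfold psum
      simp [Ne.symm hk]
  rw [this, psum_single]
  split_ifs <;> simp_all

theorem cum_diagonal {n : ℕ} (μ : Fin n → ℤ) (i j : Fin (n + 1)) :
    cum (Matrix.diagonal μ) i j = psum μ (min i j) := by
  unfold cum
  have : (fun k => psum ((Matrix.diagonal μ) k) j) =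
      fun k : Fin n => if (k : ℕ) < j then μ k else 0 := by
    funext k
    have hk : (Matrix.diagonal μ) k = Pi.single k (μ k) := by
      funext l
      by_cases hl : l = k
      · subst hl; simp
      · simp [hl, Matrix.diagonal_apply_ne' _ hl]
    rw [hk, psum_single]
  rw [this]
  unfold psum
  refine Finset.sum_congr rfl fun k _ => ?_
  have : ((k : ℕ) < ((min i j : Fin (n + 1)) : ℕ)) ↔ (k : ℕ) < i ∧ (k : ℕ) < j := by
    rcases le_total i j with h | h
    · rw [min_eq_left h]; have := Fin.le_def.1 h; omega
    · rw [min_eq_right h]; have := Fin.le_def.1 h; omega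
  simp only [this]
  split_ifs <;> simp_all

/-! ### Relative position and dimensions of intersections -/

section Flags

variable {F E : Type} [Field F] [AddCommGroup E] [Module F E] {n : ℕ}

theorem StepFlag.ext' {V W : StepFlag F E n} (h : ∀ i, V.sub i = W.sub i) : V = W := by
  cases V; cases W
  congr
  exact funext h

/-- The dimension of `V_i ∩ V'_j`. -/
noncomputable def infDim (V V' : StepFlag F E n) (i j : Fin (n + 1)) : ℤ :=
  Module.finrank F ↥(V.sub i ⊓ V'.sub j)

/-- The relative position, with integer entries. -/
noncomputable def relPosZ (V V' : StepFlag F E n) : Matrix (Fin n) (Fin n) ℤ :=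
  fun i j => (relPos V V' i j : ℤ)

theorem relPosZ_nonneg (V V' : StepFlag F E n) (i j : Fin n) : 0 ≤ relPosZ V V' i j :=
  Int.natCast_nonneg _

theorem infDim_comm (V V' : StepFlag F E n) (i j : Fin (n + 1)) :
    infDim V V' i j = infDim V' V j i := by
  unfold infDim
  rw [inf_comm]

theorem infDim_zero_left (V V' : StepFlag F E n) (j : Fin (n + 1)) : infDim V V' 0 j = 0 := by
  unfold infDim
  rw [V.sub_zero, bot_inf_eq, finrank_bot]
  rfl

theorem infDim_zero_right (V V' : StepFlag F E n) (j : Fin (n + 1)) : infDim V V' j 0 = 0 := by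
  rw [infDim_comm, infDim_zero_left]

theorem infDim_last_left (V V' : StepFlag F E n) (j : Fin (n + 1)) :
    infDim V V' (Fin.last n) j = Module.finrank F (V'.sub j) := by
  unfold infDim
  rw [V.sub_last, top_inf_eq]

theorem infDim_last_right (V V' : StepFlag F E n) (j : Fin (n + 1)) :
    infDim V V' j (Fin.last n) = Module.finrank F (V.sub j) := by
  rw [infDim_comm, infDim_last_left]

variable [FiniteDimensional F E]

theorem finrank_sup_inf_flag (V V' : StepFlag F E n) (i : Fin n) (j : Fin (n + 1)) :
    (Module.finrank F ↥(V.sub i.castSucc ⊔ V.sub i.succ ⊓ V'.sub j) : ℤ) =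
      Module.finrank F (V.sub i.castSucc) + infDim V V' i.succ j - infDim V V' i.castSucc j := by
  have h := Submodule.finrank_sup_add_finrank_inf_eq (V.sub i.castSucc) (V.sub i.succ ⊓ V'.sub j)
  rw [← inf_assoc, inf_eq_left.2 (V.sub_mono (Fin.castSucc_lt_succ (i := i)).le)] at h
  unfold infDim
  omega

/-- Inclusion-exclusion for `V_{i-1} + V_i ∩ V'_j`, where `V_{i-1} ∩ V_i = V_{i-1}`, turns the
dimension of the quotient into a mixed second difference of the dimensions of the intersections `V_i
∩ V'_j`. -/
theorem relPosZ_apply (V V' : StepFlag F E n) (i j : Fin n) :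
    relPosZ V V' i j = infDim V V' i.succ j.succ - infDim V V' i.castSucc j.succ -
      (infDim V V' i.succ j.castSucc - infDim V V' i.castSucc j.castSucc) := by
  unfold relPosZ relPos
  have hle : V.sub i.castSucc ⊔ V.sub i.succ ⊓ V'.sub j.castSucc ≤
      V.sub i.castSucc ⊔ V.sub i.succ ⊓ V'.sub j.succ :=
    sup_le_sup_left (inf_le_inf_left _ (V'.sub_mono (Fin.castSucc_lt_succ (i := j)).le)) _
  have h1 := Submodule.finrank_quotient_add_finrank
    ((V.sub i.castSucc ⊔ V.sub i.succ ⊓ V'.sub j.castSucc).submoduleOf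
      (V.sub i.castSucc ⊔ V.sub i.succ ⊓ V'.sub j.succ))
  rw [(Submodule.submoduleOfEquivOfLe hle).finrank_eq] at h1
  have h2 := finrank_sup_inf_flag V V' i j.castSucc
  have h3 := finrank_sup_inf_flag V V' i j.succ
  omega

theorem infDim_eq_cum (V V' : StepFlag F E n) (i j : Fin (n + 1)) :
    infDim V V' i j = cum (relPosZ V V') i j := by
  unfold cum
  refine eq_psum (R := fun i => infDim V V' i j) (infDim_zero_left V V' j) (fun k => ?_) i
  refine eq_psum (R := fun j => infDim V V' k.succ j - infDim V V' k.castSucc j)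
    (by simp [infDim_zero_right]) (fun l => ?_) j
  rw [relPosZ_apply]

theorem cum_injective {A B : Matrix (Fin n) (Fin n) ℤ} (h : ∀ i j, cum A i j = cum B i j) :
    A = B := by
  have key : ∀ (A : Matrix (Fin n) (Fin n) ℤ) i j, A i j = cum A i.succ j.succ -
      cum A i.castSucc j.succ - (cum A i.succ j.castSucc - cum A i.castSucc j.castSucc) := by
    intro A i j
    unfold cum
    rw [psum_succ, psum_succ, psum_succ]
    ring
  ext i j
  rw [key A, key B, h, h, h, h]

/-- A matrix and its corner sums determine each other, so an orbit can be recognized from the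
dimensions of intersections alone. All later computations of relative positions go through this
criterion. -/
theorem relPosZ_eq_iff (V V' : StepFlag F E n) (A : Matrix (Fin n) (Fin n) ℤ) :
    relPosZ V V' = A ↔ ∀ i j, infDim V V' i j = cum A i j := by
  constructor
  · rintro rfl i j
    exact infDim_eq_cum V V' i j
  · intro h
    exact cum_injective fun i j => (infDim_eq_cum V V' i j).symm.trans (h i j)

theorem relPosZ_transpose (V V' : StepFlag F E n) : (relPosZ V V').transpose = relPosZ V' V := by
  ext i j
  rw [Matrix.transpose_apply, relPosZ_apply, relPosZ_apply]
  simp only [infDim_comm V V']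
  ring

theorem finrank_sub_eq_ro (V V' : StepFlag F E n) (i : Fin (n + 1)) :
    (Module.finrank F (V.sub i) : ℤ) = psum (ro (relPosZ V V')) i := by
  rw [← infDim_last_right V V', infDim_eq_cum]
  unfold cum ro
  simp only [psum_last]

theorem finrank_sub_eq_co (V V' : StepFlag F E n) (i : Fin (n + 1)) :
    (Module.finrank F (V'.sub i) : ℤ) = psum (co (relPosZ V V')) i := by
  rw [finrank_sub_eq_ro V' V, ← relPosZ_transpose]
  rfl

theorem psum_injective {g g' : Fin n → ℤ} (h : ∀ i, psum g i = psum g' i) : g = g' := by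
  funext i
  have h1 := psum_succ g i
  have h2 := psum_succ g' i
  rw [h, h] at h1
  linarith

theorem ro_relPosZ_eq_co (V V' V'' : StepFlag F E n) :
    co (relPosZ V V') = ro (relPosZ V' V'') :=
  psum_injective fun i => (finrank_sub_eq_co V V' i).symm.trans (finrank_sub_eq_ro V' V'' i)

theorem sum_relPosZ (V V' : StepFlag F E n) :
    ∑ i, ∑ j, relPosZ V V' i j = Module.finrank F E := by
  have h := finrank_sub_eq_ro V V' (Fin.last n)
  rw [psum_last, V.sub_last, finrank_top] at h
  exact h.symm

end Flags

end QSchur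

/-! ### Elementary products: flags that differ in one subspace -/

namespace QSchur

/-- The matrix with one off-diagonal unit at `(b, a)` and column sums `μ`. -/
def elemMat {n : ℕ} (μ : Fin n → ℤ) (a b : Fin n) : Matrix (Fin n) (Fin n) ℤ :=
  Matrix.diagonal (fun i => μ i - (Pi.single a 1 : Fin n → ℤ) i) + Matrix.single b a 1

theorem co_elemMat {n : ℕ} (μ : Fin n → ℤ) (a b : Fin n) : co (elemMat μ a b) = μ := by
  funext j
  unfold co elemMat
  simp only [Matrix.add_apply, Finset.sum_add_distrib]
  rw [Finset.sum_eq_single j (fun i _ hi => Matrix.diagonal_apply_ne _ hi) (by simp),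
    Matrix.diagonal_apply_eq]
  by_cases hj : j = a
  · subst hj
    rw [Finset.sum_eq_single b (fun i _ hi => by simp [Ne.symm hi]) (by simp)]
    simp
  · simp [hj, Ne.symm hj]

theorem transpose_elemMat {n : ℕ} (μ : Fin n → ℤ) (a b : Fin n) :
    (elemMat μ a b).transpose =
      elemMat (fun i => μ i - (Pi.single a 1 : Fin n → ℤ) i + (Pi.single b 1 : Fin n → ℤ) i) b a := by
  unfold elemMat
  rw [Matrix.transpose_add, Matrix.diagonal_transpose, Matrix.transpose_single]
  simp

theorem ro_eq_co_transpose {n : ℕ} (A : Matrix (Fin n) (Fin n) ℤ) : ro A = co A.transpose := rfl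

theorem cum_elemMat {n : ℕ} (μ : Fin n → ℤ) (a b : Fin n) (i j : Fin (n + 1)) :
    cum (elemMat μ a b) i j = psum μ (min i j) - (if (a : ℕ) < i ∧ (a : ℕ) < j then 1 else 0) +
      if (b : ℕ) < i ∧ (a : ℕ) < j then 1 else 0 := by
  unfold elemMat
  rw [cum_add, cum_single, cum_diagonal, psum_sub, psum_single]
  have : ((a : ℕ) < ((min i j : Fin (n + 1)) : ℕ)) ↔ (a : ℕ) < i ∧ (a : ℕ) < j := by
    rcases le_total i j with h | h
    · rw [min_eq_left h]; have := Fin.le_def.1 h; omega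
    · rw [min_eq_right h]; have := Fin.le_def.1 h; omega
  simp only [this]

/-- `W` differs from `V` only at the position `k`, where it has codimension one in `V`. -/
def StepDown {F E : Type} [Field F] [AddCommGroup E] [Module F E] {n : ℕ}
    (V W : StepFlag F E n) (k : Fin (n + 1)) : Prop :=
  (∀ i, i ≠ k → V.sub i = W.sub i) ∧ W.sub k ≤ V.sub k ∧
    Module.finrank F (W.sub k) + 1 = Module.finrank F (V.sub k)

theorem finrank_sub_of_stepDown {F E : Type} [Field F] [AddCommGroup E] [Module F E] {n : ℕ}
    {V W : StepFlag F E n} {k : Fin (n + 1)} (h : StepDown V W k)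
    (i : Fin (n + 1)) : (Module.finrank F (V.sub i) : ℤ) =
      Module.finrank F (W.sub i) + if i = k then 1 else 0 := by
  by_cases hi : i = k
  · subst hi
    have := h.2.2
    simp
    omega
  · rw [h.1 i hi]
    simp [hi]

section

variable {F E : Type} [Field F] [AddCommGroup E] [Module F E] {n : ℕ} [FiniteDimensional F E]

/-- The rows counted in the subspace with index `a.castSucc` are those up to `b`, the predecessor of
`a`. Moving a unit of the row sums from `a` to `b` therefore enlarges exactly this subspace by one
dimension. -/
theorem relPosZ_eq_elemMat_iff (V W V' : StepFlag F E n) {a b : Fin n} (hab : (b : ℕ) + 1 = a) :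
    relPosZ V W = elemMat (ro (relPosZ W V')) a b ↔ StepDown V W a.castSucc := by
  rw [relPosZ_eq_iff]
  simp only [cum_elemMat]
  have hty := finrank_sub_eq_ro W V'
  set μ := ro (relPosZ W V')
  constructor
  · intro h
    have hV : ∀ i, (Module.finrank F (V.sub i) : ℤ) =
        psum μ i - (if (a : ℕ) < i then 1 else 0) + if (b : ℕ) < i then 1 else 0 := by
      intro i
      have := h i (Fin.last n)
      rw [infDim_last_right, min_eq_left (Fin.le_last i)] at this
      simpa [a.is_lt] using this
    -- On the diagonal `i = j` the two corrections in `cum_elemMat` cancel, since `a < i` implies `b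
    -- < i`. So `W_i` has the dimension of `V_i ∩ W_i`, which forces `W_i ≤ V_i`.
    have hI : ∀ i, (Module.finrank F ↥(V.sub i ⊓ W.sub i) : ℤ) = Module.finrank F (W.sub i) := by
      intro i
      have := h i i
      rw [min_self] at this
      rw [hty]
      unfold infDim at this
      rw [this]
      split_ifs <;> omega
    have hWV : ∀ i, W.sub i ≤ V.sub i := by
      intro i
      have := Submodule.eq_of_le_of_finrank_eq (inf_le_right : V.sub i ⊓ W.sub i ≤ W.sub i)
        (by exact_mod_cast hI i)
      rw [← this]
      exact inf_le_left
    refine ⟨fun i hi => ?_, hWV _, ?_⟩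
    · refine (Submodule.eq_of_le_of_finrank_eq (hWV i) ?_).symm
      have h1 := hV i
      have h2 := hty i
      have h3 : (i : ℕ) ≠ a := fun h => hi (Fin.ext h)
      zify
      rw [h1, h2]
      split_ifs <;> omega
    · have h1 := hV a.castSucc
      have h2 := hty a.castSucc
      zify
      rw [h1, h2]
      simp only [Fin.val_castSucc]
      split_ifs <;> omega
  -- The members of the two flags form a chain except for the order at equal index, where `W_i ≤
  -- V_i`. Hence `V_i ∩ W_j` is `V_i` for `i < j` and `W_j` for `j ≤ i`.
  · intro h i j
    have hWV : ∀ i, W.sub i ≤ V.sub i := by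
      intro i
      by_cases hi : i = a.castSucc
      · rw [hi]; exact h.2.1
      · rw [h.1 i hi]
    unfold infDim
    rcases lt_or_ge i j with hij | hij
    · have hle : V.sub i ≤ W.sub j := by
        by_cases hi : i = a.castSucc
        · have : j ≠ a.castSucc := by rw [← hi]; exact hij.ne'
          rw [← h.1 j this]
          exact V.sub_mono hij.le
        · rw [h.1 i hi]
          exact W.sub_mono hij.le
      rw [inf_eq_left.2 hle, min_eq_left hij.le, finrank_sub_of_stepDown h, hty]
      have : i = a.castSucc ↔ (i : ℕ) = a := Fin.ext_iff
      have := Fin.lt_def.1 hij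
      simp only [*]
      split_ifs <;> omega
    · rw [inf_eq_right.2 ((hWV j).trans (V.sub_mono hij)), min_eq_right hij, hty]
      have := Fin.le_def.1 hij
      split_ifs <;> omega

/-- Exchanging the two flags transposes the relative position. The transpose of an elementary matrix
is again elementary, with `a` and `b` exchanged, which reduces this to the previous case. -/
theorem relPosZ_eq_elemMat_iff' (V W V' : StepFlag F E n) {a b : Fin n} (hab : (a : ℕ) + 1 = b) :
    relPosZ V W = elemMat (ro (relPosZ W V')) a b ↔ StepDown W V b.castSucc := by
  rw [← relPosZ_eq_elemMat_iff W V W hab, ← relPosZ_transpose V W, ← ro_relPosZ_eq_co V W V']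
  constructor
  · intro h
    rw [ro_eq_co_transpose]
    have h1 := congrArg Matrix.transpose h
    rw [transpose_elemMat] at h1
    rw [h1, co_elemMat]
  · intro h
    have h1 := congrArg Matrix.transpose h
    rw [Matrix.transpose_transpose, transpose_elemMat] at h1
    rw [h1, co_elemMat]

/-- `w` is the first column in which the relative positions to `V'` of `V` and of its modification
`W` differ. -/
def JumpAt (V W V' : StepFlag F E n) (k : Fin (n + 1)) (w : Fin n) : Prop :=
  V.sub k ⊓ V'.sub w.castSucc ≤ W.sub k ∧ ¬ V.sub k ⊓ V'.sub w.succ ≤ W.sub k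

theorem exists_jumpAt {V W : StepFlag F E n} (V' : StepFlag F E n) {k : Fin (n + 1)}
    (h : StepDown V W k) : ∃ w, JumpAt V W V' k w := by
  by_contra hc
  have key : ∀ j, V.sub k ⊓ V'.sub j ≤ W.sub k := by
    intro j
    induction j using Fin.induction with
    | zero => rw [V'.sub_zero, inf_bot_eq]; exact bot_le
    | succ j ih =>
      by_contra h1
      exact hc ⟨j, ih, h1⟩
  have h1 := key (Fin.last n)
  rw [V'.sub_last, inf_top_eq] at h1
  have h2 := Submodule.finrank_mono h1
  have := h.2.2
  omega

/-- As `W_k` is a hyperplane of `V_k`, intersecting with `V'_j` loses one dimension exactly when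
`V_k ∩ V'_j` is not contained in `W_k`, and this happens for all `j` beyond the jump. -/
theorem infDim_of_jumpAt {V W : StepFlag F E n} {V' : StepFlag F E n} {k : Fin (n + 1)} {w : Fin n}
    (h : StepDown V W k) (hw : JumpAt V W V' k w) (i j : Fin (n + 1)) :
    infDim V V' i j = infDim W V' i j + if i = k ∧ (w : ℕ) < j then 1 else 0 := by
  unfold infDim
  by_cases hi : i = k
  swap
  · rw [h.1 i hi]
    simp [hi]
  subst hi
  have hle : W.sub i ⊓ V'.sub j ≤ V.sub i ⊓ V'.sub j := inf_le_inf_right _ h.2.1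
  by_cases hj : (w : ℕ) < j
  · have h1 : ¬ V.sub i ⊓ V'.sub j ≤ W.sub i := fun h2 =>
      hw.2 ((inf_le_inf_left _ (V'.sub_mono (Fin.le_def.2 (by simpa using hj)))).trans h2)
    -- A subspace of `V_i` that is not contained in the hyperplane `W_i` spans `V_i` together with
    -- it.
    have h2 : V.sub i ⊓ V'.sub j ⊔ W.sub i = V.sub i := by
      refine Submodule.eq_of_le_of_finrank_le (sup_le inf_le_left h.2.1) ?_
      rw [← h.2.2]
      refine Submodule.finrank_lt_finrank_of_lt (lt_of_le_of_ne le_sup_right fun h3 => h1 ?_)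
      rw [h3]
      exact le_sup_left
    have h3 := Submodule.finrank_sup_add_finrank_inf_eq (V.sub i ⊓ V'.sub j) (W.sub i)
    rw [h2, inf_right_comm, inf_eq_right.2 h.2.1] at h3
    have := h.2.2
    simp only [hj, and_self, if_true]
    omega
  · have h1 : V.sub i ⊓ V'.sub j ≤ V.sub i ⊓ V'.sub w.castSucc :=
      inf_le_inf_left _ (V'.sub_mono (Fin.le_def.2 (by simpa using hj)))
    rw [le_antisymm (le_inf (h1.trans hw.1) inf_le_right) hle]
    simp [hj]

theorem relPosZ_of_jumpAt {V W : StepFlag F E n} {V' : StepFlag F E n} {a b w : Fin n}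
    (hab : (b : ℕ) + 1 = a) (h : StepDown V W a.castSucc) (hw : JumpAt V W V' a.castSucc w) :
    relPosZ V V' = relPosZ W V' + Matrix.single b w 1 - Matrix.single a w 1 := by
  rw [relPosZ_eq_iff]
  intro i j
  rw [infDim_of_jumpAt h hw, cum_sub, cum_add, cum_single, cum_single, ← infDim_eq_cum]
  have : i = a.castSucc ↔ (i : ℕ) = a := Fin.ext_iff
  simp only [this]
  split_ifs <;> omega

theorem move_injective {a b w w' : Fin n} {A : Matrix (Fin n) (Fin n) ℤ} (hab : a ≠ b)
    (h : A + Matrix.single b w 1 - Matrix.single a w 1 =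
      A + Matrix.single b w' 1 - Matrix.single a w' 1) : w = w' := by
  have h1 := congrFun (congrFun h b) w
  by_contra hne
  simp [hab, Ne.symm hne] at h1

theorem relPosZ_move_iff {V W : StepFlag F E n} {V' : StepFlag F E n} {a b w : Fin n}
    (hab : (b : ℕ) + 1 = a) (h : StepDown V W a.castSucc) :
    relPosZ V V' = relPosZ W V' + Matrix.single b w 1 - Matrix.single a w 1 ↔
      JumpAt V W V' a.castSucc w := by
  constructor
  · intro h1
    obtain ⟨w', hw'⟩ := exists_jumpAt V' h
    have h2 := relPosZ_of_jumpAt hab h hw'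
    have hne : a ≠ b := by rintro rfl; omega
    rwa [move_injective hne (h1.symm.trans h2)]
  · exact relPosZ_of_jumpAt hab h

/-- The flag that is obtained from `V` by replacing its member at the position `i.succ`. -/
def StepFlag.replace (V : StepFlag F E n) (i j : Fin n) (hij : (i : ℕ) + 1 = j)
    (H : Submodule F E) (h1 : V.sub i.castSucc ≤ H) (h2 : H ≤ V.sub j.succ) : StepFlag F E n where
  sub := Function.update V.sub j.castSucc H
  sub_mono := by
    intro x y hxy
    by_cases hx : x = j.castSucc <;> by_cases hy : y = j.castSucc
    · simp [hx, hy]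
    · subst hx
      rw [Function.update_self, Function.update_of_ne hy]
      refine h2.trans (V.sub_mono (Fin.le_def.2 ?_))
      have := Fin.le_def.1 hxy
      have h3 : (y : ℕ) ≠ j := fun h => hy (Fin.ext h)
      simp at this ⊢
      omega
    · subst hy
      rw [Function.update_self, Function.update_of_ne hx]
      refine (V.sub_mono (Fin.le_def.2 ?_)).trans h1
      have := Fin.le_def.1 hxy
      have h3 : (x : ℕ) ≠ j := fun h => hx (Fin.ext h)
      simp at this ⊢
      omega
    · rw [Function.update_of_ne hx, Function.update_of_ne hy]
      exact V.sub_mono hxy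
  sub_zero := by
    rw [Function.update_of_ne, V.sub_zero]
    intro h
    have := congrArg Fin.val h
    simp at this
    omega
  sub_last := by
    rw [Function.update_of_ne, V.sub_last]
    intro h
    have := congrArg Fin.val h
    simp at this
    omega

/-- Flags that agree with `V` outside of one position are given by their member there. -/
def replaceEquiv (V : StepFlag F E n) {i j : Fin n} (hij : (i : ℕ) + 1 = j)
    (P : Submodule F E → Prop) :
    {W : StepFlag F E n // (∀ x, x ≠ j.castSucc → V.sub x = W.sub x) ∧ P (W.sub j.castSucc)} ≃
      {H : Submodule F E // V.sub i.castSucc ≤ H ∧ H ≤ V.sub j.succ ∧ P H} where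
  toFun W := ⟨W.1.sub j.castSucc, by
    rw [W.2.1 i.castSucc fun h => by have := congrArg Fin.val h; simp at this; omega]
    exact W.1.sub_mono (Fin.le_def.2 (by simp; omega)), by
    rw [W.2.1 j.succ fun h => by have := congrArg Fin.val h; simp at this]
    exact W.1.sub_mono (Fin.le_def.2 (by simp)), W.2.2⟩
  invFun H := ⟨V.replace i j hij H.1 H.2.1 H.2.2.1, fun x hx => (Function.update_of_ne hx _ _).symm, by
    have : (V.replace i j hij H.1 H.2.1 H.2.2.1).sub j.castSucc = H.1 := Function.update_self _ _ _
    rw [this]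
    exact H.2.2.2⟩
  left_inv W := by
    apply Subtype.ext
    apply StepFlag.ext'
    intro x
    by_cases hx : x = j.castSucc
    · subst hx
      exact Function.update_self _ _ _
    · exact (Function.update_of_ne hx _ _).trans (W.2.1 x hx)
  right_inv H := Subtype.ext (Function.update_self _ _ _)

theorem finrank_sup_inf_psum (V V' : StepFlag F E n) (i : Fin n) (j : Fin (n + 1)) :
    (Module.finrank F ↥(V.sub i.castSucc ⊔ V.sub i.succ ⊓ V'.sub j) : ℤ) =
      Module.finrank F (V.sub i.castSucc) + psum (relPosZ V V' i) j := by
  rw [finrank_sup_inf_flag, infDim_eq_cum, infDim_eq_cum]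
  unfold cum
  rw [psum_succ]
  ring

variable [Finite F]

theorem finite_submodule : Finite (Submodule F E) := by
  have : Finite E := Module.finite_of_finite F
  exact Finite.of_injective _ SetLike.coe_injective

theorem card_sub_of_imp {α : Type} [Finite α] {P Q : α → Prop} (h : ∀ x, Q x → P x) :
    (Nat.card {x // P x ∧ ¬ Q x} : ℤ) = Nat.card {x // P x} - Nat.card {x // Q x} := by
  have hle : {x | Q x} ⊆ {x | P x} := h
  have h1 := Set.ncard_sdiff_add_ncard_of_subset hle (Set.toFinite _)
  have h2 : (Nat.card {x // P x ∧ ¬ Q x} : ℤ) = (({x | P x} \ {x | Q x}).ncard : ℤ) := rfl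
  rw [h2]
  change _ = (({x | P x}.ncard : ℕ) : ℤ) - (({x | Q x}.ncard : ℕ) : ℤ)
  omega

theorem sum_range_sub_sum_range (q : ℤ) {x y c : ℕ} (h : x = y + c) :
    ∑ i ∈ Finset.range x, q ^ i - ∑ i ∈ Finset.range y, q ^ i =
      ∑ i ∈ Finset.range c, q ^ (y + i) := by
  rw [h, Finset.sum_range_add]
  ring

/-- The admissible `W` are the hyperplanes of `V_k` (with `k` the index `a.castSucc`) that contain
`X w.castSucc` but not `X w.succ`. Their number is a difference of two `q`-integers. The lower one,
the codimension of `X w.succ` in `V_k`, is the sum of the entries of row `b` to the right of `w`. -/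
theorem card_stepDown (V V' : StepFlag F E n) {a b : Fin n} (hab : (b : ℕ) + 1 = a) (w : Fin n) :
    (Nat.card {W : StepFlag F E n // StepDown V W a.castSucc ∧ JumpAt V W V' a.castSucc w} : ℤ) =
      ∑ i ∈ Finset.range (relPosZ V V' b w).toNat,
        (Nat.card F : ℤ) ^ ((∑ l, if w < l then relPosZ V V' b l else 0).toNat + i) := by
  have hba : b.succ = a.castSucc := Fin.ext (by simpa using hab)
  set X : Fin (n + 1) → Submodule F E := fun j => V.sub b.castSucc ⊔ V.sub b.succ ⊓ V'.sub j with hX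
  have hXle : ∀ j, X j ≤ V.sub a.castSucc := fun j => by
    rw [← hba]
    exact sup_le (V.sub_mono (Fin.castSucc_lt_succ (i := b)).le) inf_le_left
  have hXmono : X w.castSucc ≤ X w.succ :=
    sup_le_sup_left (inf_le_inf_left _ (V'.sub_mono (Fin.castSucc_lt_succ (i := w)).le)) _
  have := finite_submodule (F := F) (E := E)
  -- The common clauses are repeated inside the negation, so that the set becomes a difference of
  -- two sets of hyperplanes, one contained in the other.
  have e1 : (Nat.card {W : StepFlag F E n // StepDown V W a.castSucc ∧ JumpAt V W V' a.castSucc w} : ℤ) =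
      Nat.card {H : Submodule F E //
        (X w.castSucc ≤ H ∧ H ≤ V.sub a.castSucc ∧
          Module.finrank F H + 1 = Module.finrank F (V.sub a.castSucc)) ∧
        ¬ (X w.succ ≤ H ∧ H ≤ V.sub a.castSucc ∧
          Module.finrank F H + 1 = Module.finrank F (V.sub a.castSucc))} := by
    congr 1
    refine (Nat.card_congr (Equiv.subtypeEquivRight fun W => ?_)).trans
      ((Nat.card_congr (replaceEquiv V hab fun H => (H ≤ V.sub a.castSucc ∧
        Module.finrank F H + 1 = Module.finrank F (V.sub a.castSucc)) ∧
        V.sub a.castSucc ⊓ V'.sub w.castSucc ≤ H ∧ ¬ V.sub a.castSucc ⊓ V'.sub w.succ ≤ H)).trans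
      (Nat.card_congr (Equiv.subtypeEquivRight fun H => ?_)))
    · unfold StepDown JumpAt
      tauto
    · have : V.sub a.castSucc ≤ V.sub a.succ := V.sub_mono (Fin.castSucc_lt_succ (i := a)).le
      simp only [hX, sup_le_iff, hba]
      constructor
      · tauto
      · rintro ⟨⟨⟨h1, h2⟩, h3, h4⟩, h5⟩
        exact ⟨h1, h3.trans this, ⟨h3, h4⟩, h2, fun h => h5 ⟨⟨h1, h⟩, h3, h4⟩⟩
  rw [e1, card_sub_of_imp fun H hH => ⟨hXmono.trans hH.1, hH.2⟩,
    card_hyperplanes_between (hXle _), card_hyperplanes_between (hXle _)]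
  push_cast
  have hd : ∀ j, (Module.finrank F (X j) : ℤ) =
      Module.finrank F (V.sub b.castSucc) + psum (relPosZ V V' b) j := finrank_sup_inf_psum V V' b
  have hn := hd (Fin.last n)
  have hXn : X (Fin.last n) = V.sub a.castSucc := by
    rw [hX]
    simp only
    rw [V'.sub_last, inf_top_eq, sup_eq_right.2 (V.sub_mono (Fin.castSucc_lt_succ (i := b)).le), hba]
  rw [hXn] at hn
  have h1 := hd w.castSucc
  have h2 := hd w.succ
  have hs := psum_succ (relPosZ V V' b) w
  have hsum : (∑ l, if w < l then relPosZ V V' b l else 0) =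
      psum (relPosZ V V' b) (Fin.last n) - psum (relPosZ V V' b) w.succ := by
    unfold psum
    rw [← Finset.sum_sub_distrib]
    refine Finset.sum_congr rfl fun l _ => ?_
    simp only [Fin.lt_def, Fin.val_succ, Fin.val_last, l.is_lt, if_true]
    split_ifs <;> omega
  have h0 := relPosZ_nonneg V V' b w
  have h3 := Submodule.finrank_mono (hXle w.succ)
  rw [hsum, sum_range_sub_sum_range _ (c := (relPosZ V V' b w).toNat)]
  · refine Finset.sum_congr rfl fun i _ => ?_
    congr 2
    omega
  · omega

/-- Dual to the previous count: `W` is now given by a line over `V_k`, with `k` the index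
`b.castSucc`, that lies in `X w.succ` but not in `X w.castSucc`. The exponent is the dimension of `X
w.castSucc` over `V_k`, the sum of row `b` to the left of `w`. -/
theorem card_stepUp (V V' : StepFlag F E n) {a b : Fin n} (hab : (a : ℕ) + 1 = b) (w : Fin n) :
    (Nat.card {W : StepFlag F E n // StepDown W V b.castSucc ∧ JumpAt W V V' b.castSucc w} : ℤ) =
      ∑ i ∈ Finset.range (relPosZ V V' b w).toNat,
        (Nat.card F : ℤ) ^ ((∑ l, if l < w then relPosZ V V' b l else 0).toNat + i) := by
  set X : Fin (n + 1) → Submodule F E := fun j => V.sub b.castSucc ⊔ V.sub b.succ ⊓ V'.sub j with hX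
  have hXle : ∀ j, V.sub b.castSucc ≤ X j := fun j => le_sup_left
  have hXmono : X w.castSucc ≤ X w.succ :=
    sup_le_sup_left (inf_le_inf_left _ (V'.sub_mono (Fin.castSucc_lt_succ (i := w)).le)) _
  have := finite_submodule (F := F) (E := E)
  have e1 : (Nat.card {W : StepFlag F E n // StepDown W V b.castSucc ∧ JumpAt W V V' b.castSucc w} : ℤ) =
      Nat.card {H : Submodule F E //
        (V.sub b.castSucc ≤ H ∧ H ≤ X w.succ ∧
          Module.finrank F H = Module.finrank F (V.sub b.castSucc) + 1) ∧
        ¬ (V.sub b.castSucc ≤ H ∧ H ≤ X w.castSucc ∧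
          Module.finrank F H = Module.finrank F (V.sub b.castSucc) + 1)} := by
    congr 1
    refine (Nat.card_congr (Equiv.subtypeEquivRight fun W => ?_)).trans
      ((Nat.card_congr (replaceEquiv V hab fun H => (V.sub b.castSucc ≤ H ∧
        Module.finrank F H = Module.finrank F (V.sub b.castSucc) + 1) ∧
        H ⊓ V'.sub w.castSucc ≤ V.sub b.castSucc ∧ ¬ H ⊓ V'.sub w.succ ≤ V.sub b.castSucc)).trans
      (Nat.card_congr (Equiv.subtypeEquivRight fun H => ?_)))
    · unfold StepDown JumpAt
      have : (∀ i, i ≠ b.castSucc → W.sub i = V.sub i) ↔ ∀ i, i ≠ b.castSucc → V.sub i = W.sub i :=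
        forall_congr' fun _ => forall_congr' fun _ => eq_comm
      rw [this, eq_comm (a := Module.finrank F (W.sub b.castSucc))]
      tauto
    · have hle : V.sub a.castSucc ≤ V.sub b.castSucc :=
        V.sub_mono (Fin.le_def.2 (by simp; omega))
      -- For `H` one dimension above `V_k`, any vector of `H ∩ V'_j` outside `V_k` generates `H`
      -- over `V_k`. So `H` meets `V'_j` outside `V_k` exactly when it is contained in `V_k +
      -- V_{k+1} ∩ V'_j`.
      have key : ∀ j, V.sub b.castSucc ≤ H → H ≤ V.sub b.succ →
          Module.finrank F H = Module.finrank F (V.sub b.castSucc) + 1 →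
          (¬ H ⊓ V'.sub j ≤ V.sub b.castSucc ↔ H ≤ X j) := by
        intro j h1 h2 h3
        constructor
        · intro h4
          have h5 : V.sub b.castSucc ⊔ H ⊓ V'.sub j = H := by
            refine Submodule.eq_of_le_of_finrank_le (sup_le h1 inf_le_left) ?_
            rw [h3]
            refine Submodule.finrank_lt_finrank_of_lt (lt_of_le_of_ne le_sup_left fun h6 => h4 ?_)
            rw [h6]
            exact le_sup_right
          rw [← h5]
          exact sup_le_sup_left (inf_le_inf_right _ h2) _
        · intro h4 h5
          -- The modular law, applicable because `V_k ≤ H`.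
          have h6 : H = V.sub b.castSucc ⊔ V.sub b.succ ⊓ V'.sub j ⊓ H := by
            rw [← sup_inf_assoc_of_le _ h1]
            exact (inf_eq_right.2 h4).symm
          have h7 : H ≤ V.sub b.castSucc := by
            rw [h6]
            refine sup_le le_rfl (le_trans ?_ h5)
            exact le_inf inf_le_right (inf_le_left.trans inf_le_right)
          have := Submodule.finrank_mono h7
          omega
      have hXs : ∀ j, X j ≤ V.sub b.succ := fun j =>
        sup_le (V.sub_mono (Fin.castSucc_lt_succ (i := b)).le) inf_le_left
      constructor
      · rintro ⟨h1, h2, ⟨h3, h4⟩, h5, h6⟩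
        refine ⟨⟨h3, (key _ h3 h2 h4).1 h6, h4⟩, fun h7 => (key _ h3 h2 h4).2 h7.2.1 h5⟩
      · rintro ⟨⟨h3, h4, h5⟩, h6⟩
        have h2 := h4.trans (hXs _)
        refine ⟨hle.trans h3, h2, ⟨h3, h5⟩, ?_, (key _ h3 h2 h5).2 h4⟩
        by_contra h7
        exact h6 ⟨h3, (key _ h3 h2 h5).1 h7, h5⟩
  rw [e1, card_sub_of_imp fun H hH => ⟨hH.1, hH.2.1.trans hXmono, hH.2.2⟩,
    card_lines_between (hXle _), card_lines_between (hXle _)]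
  push_cast
  have hd : ∀ j, (Module.finrank F (X j) : ℤ) =
      Module.finrank F (V.sub b.castSucc) + psum (relPosZ V V' b) j := finrank_sup_inf_psum V V' b
  have h1 := hd w.castSucc
  have h2 := hd w.succ
  have hs := psum_succ (relPosZ V V' b) w
  have hsum : (∑ l, if l < w then relPosZ V V' b l else 0) = psum (relPosZ V V' b) w.castSucc := rfl
  have h0 := relPosZ_nonneg V V' b w
  have h3 := Submodule.finrank_mono (hXle w.castSucc)
  rw [hsum, sum_range_sub_sum_range _ (c := (relPosZ V V' b w).toNat)]
  · refine Finset.sum_congr rfl fun i _ => ?_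
    congr 2
    omega
  · omega

/-- The sum of the entries of the row `b` in the columns beyond `w`, on the side of `w` that is
opposite to the move from the row `a` to the row `b`. -/
def beyondSum (A : Matrix (Fin n) (Fin n) ℤ) (a b w : Fin n) : ℤ :=
  ∑ l, if (b < a ∧ w < l) ∨ (a < b ∧ l < w) then A b l else 0

/-- The matrix obtained from `A` by moving a unit in the column `w` from the row `a` to the
row `b`. -/
def move (A : Matrix (Fin n) (Fin n) ℤ) (a b w : Fin n) : Matrix (Fin n) (Fin n) ℤ :=
  A + Matrix.single b w 1 - Matrix.single a w 1

/-- The coefficient of `move A a b w` in the product of `elemMat (ro A) a b` and `A`. -/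
noncomputable def moveCoeff (A : Matrix (Fin n) (Fin n) ℤ) (a b w : Fin n) : Polynomial ℤ :=
  ∑ i ∈ Finset.range (A b w + 1).toNat, Polynomial.X ^ ((beyondSum A a b w).toNat + i)

/-- At most one `w` contributes, since the column of the moved unit can be read off the result. Row
`b` of the relative position of `(V, V')` agrees with row `b` of `A` except for one extra unit in
column `w`; this accounts for the `A b w + 1` in `moveCoeff`. -/
theorem card_elemMat (V V' : StepFlag F E n) (A : Matrix (Fin n) (Fin n) ℤ) {a b : Fin n}
    (hab : (b : ℕ) + 1 = a ∨ (a : ℕ) + 1 = b) :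
    (Nat.card {W : StepFlag F E n // relPosZ V W = elemMat (ro A) a b ∧ relPosZ W V' = A} : ℤ) =
      ∑ w, if relPosZ V V' = move A a b w then (moveCoeff A a b w).eval (Nat.card F : ℤ) else 0 := by
  have hne : a ≠ b := by rintro rfl; omega
  by_cases hw : ∃ w, relPosZ V V' = move A a b w
  · obtain ⟨w, hw⟩ := hw
    rw [Finset.sum_eq_single w (fun w' _ hw' => if_neg fun h => hw' (move_injective hne (h.symm.trans hw)))
      (by simp), if_pos hw]
    have hb : relPosZ V V' b w = A b w + 1 := by
      rw [hw]
      simp [move, hne]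
    have hl : ∀ l, l ≠ w → relPosZ V V' b l = A b l := by
      intro l hl
      rw [hw]
      simp [move, hne, Ne.symm hl]
    unfold moveCoeff beyondSum
    rw [← hb]
    simp only [Polynomial.eval_finsetSum, Polynomial.eval_pow, Polynomial.eval_X]
    rcases hab with hab | hab
    · have hlt : b < a := Fin.lt_def.2 (by omega)
      have : (∑ l, if (b < a ∧ w < l) ∨ (a < b ∧ l < w) then A b l else 0) =
          ∑ l, if w < l then relPosZ V V' b l else 0 := by
        refine Finset.sum_congr rfl fun l _ => ?_
        simp only [hlt, hlt.not_gt, true_and, false_and, or_false]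
        split_ifs with h
        · rw [hl l h.ne']
        · rfl
      rw [this, ← card_stepDown V V' hab w]
      congr 1
      refine Nat.card_congr (Equiv.subtypeEquivRight fun W => ?_)
      constructor
      · rintro ⟨h1, rfl⟩
        rw [relPosZ_eq_elemMat_iff V W V' hab] at h1
        exact ⟨h1, (relPosZ_move_iff hab h1).1 hw⟩
      · rintro ⟨h1, h2⟩
        have h3 := (relPosZ_move_iff hab h1).2 h2
        have h4 : relPosZ W V' = A := by
          have := h3.symm.trans hw
          unfold move at this
          simpa using this
        rw [← h4]
        exact ⟨(relPosZ_eq_elemMat_iff V W V' hab).2 h1, rfl⟩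
    · have hlt : a < b := Fin.lt_def.2 (by omega)
      have : (∑ l, if (b < a ∧ w < l) ∨ (a < b ∧ l < w) then A b l else 0) =
          ∑ l, if l < w then relPosZ V V' b l else 0 := by
        refine Finset.sum_congr rfl fun l _ => ?_
        simp only [hlt, hlt.not_gt, true_and, false_and, false_or]
        split_ifs with h
        · rw [hl l h.ne]
        · rfl
      have hmv : ∀ W : StepFlag F E n, relPosZ V V' = move (relPosZ W V') a b w ↔
          relPosZ W V' = relPosZ V V' + Matrix.single a w 1 - Matrix.single b w 1 := by
        intro W
        unfold move
        constructor <;> intro h <;> rw [h] <;> abel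
      rw [this, ← card_stepUp V V' hab w]
      congr 1
      refine Nat.card_congr (Equiv.subtypeEquivRight fun W => ?_)
      constructor
      · rintro ⟨h1, rfl⟩
        rw [relPosZ_eq_elemMat_iff' V W V' hab] at h1
        exact ⟨h1, (relPosZ_move_iff hab h1).1 ((hmv W).1 hw)⟩
      · rintro ⟨h1, h2⟩
        have h3 := (hmv W).2 ((relPosZ_move_iff hab h1).2 h2)
        have h4 : relPosZ W V' = A := by
          have := h3.symm.trans hw
          unfold move at this
          simpa using this
        rw [← h4]
        exact ⟨(relPosZ_eq_elemMat_iff' V W V' hab).2 h1, rfl⟩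
  · push Not at hw
    rw [Finset.sum_eq_zero fun w _ => if_neg (hw w)]
    have : IsEmpty {W : StepFlag F E n // relPosZ V W = elemMat (ro A) a b ∧ relPosZ W V' = A} := by
      refine ⟨?_⟩
      rintro ⟨W, h1, rfl⟩
      rcases hab with hab | hab
      · rw [relPosZ_eq_elemMat_iff V W V' hab] at h1
        obtain ⟨w, h2⟩ := exists_jumpAt V' h1
        exact hw w (relPosZ_of_jumpAt hab h1 h2)
      · rw [relPosZ_eq_elemMat_iff' V W V' hab] at h1
        obtain ⟨w, h2⟩ := exists_jumpAt V' h1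
        refine hw w ?_
        rw [relPosZ_of_jumpAt hab h1 h2]
        unfold move
        abel
    simp

end

end QSchur

/-! ### Triangularity with respect to the distance from the diagonal -/

namespace QSchur

open Polynomial

/-- A weighted sum of the entries of a matrix. -/
def wsum {n : ℕ} (ω : Fin n → Fin n → ℤ) (A : Matrix (Fin n) (Fin n) ℤ) : ℤ :=
  ∑ i, ∑ j, ω i j * A i j

theorem wsum_add {n : ℕ} (ω : Fin n → Fin n → ℤ) (A B : Matrix (Fin n) (Fin n) ℤ) :
    wsum ω (A + B) = wsum ω A + wsum ω B := by
  simp [wsum, mul_add, Finset.sum_add_distrib]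

theorem wsum_sub {n : ℕ} (ω : Fin n → Fin n → ℤ) (A B : Matrix (Fin n) (Fin n) ℤ) :
    wsum ω (A - B) = wsum ω A - wsum ω B := by
  simp [wsum, mul_sub, Finset.sum_sub_distrib]

theorem wsum_single {n : ℕ} (ω : Fin n → Fin n → ℤ) (a b : Fin n) :
    wsum ω (Matrix.single a b 1) = ω a b := by
  unfold wsum
  rw [Finset.sum_eq_single a (fun i _ hi => by simp [Ne.symm hi]) (by simp),
    Finset.sum_eq_single b (fun j _ hj => by simp [Ne.symm hj]) (by simp)]
  simp

theorem wsum_diagonal {n : ℕ} (ω : Fin n → Fin n → ℤ) (μ : Fin n → ℤ) :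
    wsum ω (Matrix.diagonal μ) = ∑ i, ω i i * μ i := by
  unfold wsum
  refine Finset.sum_congr rfl fun i _ => ?_
  rw [Finset.sum_eq_single i (fun j _ hj => by simp [Matrix.diagonal_apply_ne' _ hj]) (by simp)]
  simp

theorem wsum_move {n : ℕ} (ω : Fin n → Fin n → ℤ) (A : Matrix (Fin n) (Fin n) ℤ) (a b w : Fin n) :
    wsum ω (move A a b w) = wsum ω A + ω b w - ω a w := by
  unfold move
  rw [wsum_sub, wsum_add, wsum_single, wsum_single]

theorem move_move {n : ℕ} (A : Matrix (Fin n) (Fin n) ℤ) (a b w : Fin n) :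
    move (move A b a w) a b w = A := by
  unfold move
  abel

theorem move_apply {n : ℕ} (A : Matrix (Fin n) (Fin n) ℤ) (a b w i j : Fin n) :
    move A a b w i j = A i j + (if b = i ∧ w = j then 1 else 0) - if a = i ∧ w = j then 1 else 0 := by
  simp [move, Matrix.single_apply]

/-- The off-diagonal entries are nonnegative. -/
def OffNonneg {n : ℕ} (A : Matrix (Fin n) (Fin n) ℤ) : Prop := ∀ i j, i ≠ j → 0 ≤ A i j

/-- The rows `a` and `b` are adjacent. -/
def Adjacent {n : ℕ} (a b : Fin n) : Prop := (b : ℕ) + 1 = a ∨ (a : ℕ) + 1 = b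

theorem Adjacent.ne {n : ℕ} {a b : Fin n} (h : Adjacent a b) : a ≠ b := by
  rintro rfl
  unfold Adjacent at h
  omega

/-- The sum of the squared distances to the diagonal. -/
def spread {n : ℕ} (A : Matrix (Fin n) (Fin n) ℤ) : ℤ := wsum (fun i j => ((i : ℤ) - j) ^ 2) A

theorem spread_nonneg {n : ℕ} {A : Matrix (Fin n) (Fin n) ℤ} (h : OffNonneg A) : 0 ≤ spread A := by
  unfold spread wsum
  refine Finset.sum_nonneg fun i _ => Finset.sum_nonneg fun j _ => ?_
  by_cases hij : i = j
  · simp [hij]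
  · exact mul_nonneg (sq_nonneg ((i : ℤ) - j)) (h i j hij)

/-- Take for `u` the rightmost column with a nonzero entry above the diagonal. Then nothing above
the diagonal to the right of `u` can be moved. -/
theorem exists_upper_move {n : ℕ} {A : Matrix (Fin n) (Fin n) ℤ} (h : OffNonneg A)
    (hA : ∃ i j, i < j ∧ A i j ≠ 0) :
    ∃ a b u : Fin n, (b : ℕ) + 1 = a ∧ b < u ∧ 0 < A b u ∧ ∀ w, u < w → A a w = 0 ∨ w ≤ a := by
  classical
  obtain ⟨i₀, j₀, hij, h0⟩ := hA
  let S : Finset (Fin n) := Finset.univ.filter fun j => ∃ i, i < j ∧ A i j ≠ 0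
  have hS : S.Nonempty := ⟨j₀, by simp only [S, Finset.mem_filter_univ]; exact ⟨i₀, hij, h0⟩⟩
  obtain ⟨b, hbu, hb⟩ := (Finset.mem_filter_univ _).1 (S.max'_mem hS)
  set u := S.max' hS
  refine ⟨⟨b + 1, by have := Fin.lt_def.1 hbu; omega⟩, b, u, rfl, hbu,
    lt_of_le_of_ne (h b u hbu.ne) (Ne.symm hb), fun w hw => ?_⟩
  by_contra hc
  push Not at hc
  exact absurd (S.le_max' w ((Finset.mem_filter_univ _).2 ⟨_, hc.2, hc.1⟩)) (not_le.2 hw)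

/-- The mirror image, with the leftmost column that has a nonzero entry below the diagonal. -/
theorem exists_lower_move {n : ℕ} {A : Matrix (Fin n) (Fin n) ℤ} (h : OffNonneg A)
    (hA : ∃ i j, j < i ∧ A i j ≠ 0) :
    ∃ a b u : Fin n, (a : ℕ) + 1 = b ∧ u < b ∧ 0 < A b u ∧ ∀ w, w < u → A a w = 0 ∨ a ≤ w := by
  classical
  obtain ⟨i₀, j₀, hij, h0⟩ := hA
  let S : Finset (Fin n) := Finset.univ.filter fun j => ∃ i, j < i ∧ A i j ≠ 0
  have hS : S.Nonempty := ⟨j₀, by simp only [S, Finset.mem_filter_univ]; exact ⟨i₀, hij, h0⟩⟩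
  obtain ⟨b, hbu, hb⟩ := (Finset.mem_filter_univ _).1 (S.min'_mem hS)
  set u := S.min' hS
  refine ⟨⟨b - 1, by omega⟩, b, u, by have := Fin.lt_def.1 hbu; simp; omega, hbu,
    lt_of_le_of_ne (h b u hbu.ne') (Ne.symm hb), fun w hw => ?_⟩
  by_contra hc
  push Not at hc
  exact absurd (S.min'_le w ((Finset.mem_filter_univ _).2 ⟨_, hc.2, hc.1⟩)) (not_le.2 hw)

/-- A matrix that is not diagonal is the leading term of an elementary product. -/
theorem exists_move {n : ℕ} {A : Matrix (Fin n) (Fin n) ℤ} (h : OffNonneg A)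
    (hA : ∃ i j, i ≠ j ∧ A i j ≠ 0) :
    ∃ a b u, Adjacent a b ∧ u ≠ b ∧ ¬ ((b < a ∧ u < b) ∨ (a < b ∧ b < u)) ∧ 0 < A b u ∧
      spread (move A b a u) < spread A ∧
      ∀ w, w ≠ u → OffNonneg (move (move A b a u) a b w) →
        spread (move (move A b a u) a b w) < spread A := by
  by_cases hU : ∃ i j, i < j ∧ A i j ≠ 0
  · obtain ⟨a, b, u, hab, hbu, h0, hmax⟩ := exists_upper_move h hU
    have hab' : (a : ℤ) = b + 1 := by exact_mod_cast hab.symm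
    have hba : b < a := Fin.lt_def.2 (by omega)
    have hbu' : (b : ℤ) < u := by exact_mod_cast hbu
    refine ⟨a, b, u, Or.inl hab, hbu.ne', ?_, h0, ?_, fun w hwu hw => ?_⟩
    · rintro (⟨_, h2⟩ | ⟨h2, _⟩)
      · exact absurd hbu h2.not_gt
      · exact absurd hba h2.not_gt
    · unfold spread
      rw [wsum_move, hab']
      nlinarith
    · rcases lt_trichotomy w u with hlt | heq | hgt
      -- With quadratic weights, moving a unit from `b` to `a` in column `u` and one back in column
      -- `w` changes `spread` by exactly `2 (w - u)`, which is negative here.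
      · have : (w : ℤ) < u := by exact_mod_cast hlt
        unfold spread
        rw [wsum_move, wsum_move, hab']
        nlinarith
      · exact absurd heq hwu
      -- To the right of `u` the position `(a, w)` lies above the diagonal and carries a zero, so
      -- the move would make it `-1`.
      · exfalso
        have haw : a < w := Fin.lt_def.2 (by have := Fin.lt_def.1 hgt; have := Fin.lt_def.1 hbu; omega)
        have h1 := hw a w haw.ne
        have h2 := (hmax w hgt).resolve_right haw.not_ge
        rw [move_apply, move_apply, h2] at h1
        simp [hba.ne, hgt.ne] at h1
  · have hL : ∃ i j, j < i ∧ A i j ≠ 0 := by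
      obtain ⟨i, j, hij, h0⟩ := hA
      rcases lt_or_gt_of_ne hij with h1 | h1
      · exact absurd ⟨i, j, h1, h0⟩ hU
      · exact ⟨i, j, h1, h0⟩
    obtain ⟨a, b, u, hab, hbu, h0, hmin⟩ := exists_lower_move h hL
    have hab' : (b : ℤ) = a + 1 := by exact_mod_cast hab.symm
    have hba : a < b := Fin.lt_def.2 (by omega)
    have hbu' : (u : ℤ) < b := by exact_mod_cast hbu
    refine ⟨a, b, u, Or.inr hab, hbu.ne, ?_, h0, ?_, fun w hwu hw => ?_⟩
    · rintro (⟨h2, _⟩ | ⟨_, h2⟩)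
      · exact absurd hba h2.not_gt
      · exact absurd hbu h2.not_gt
    · unfold spread
      rw [wsum_move]
      rw [hab'] at hbu' ⊢
      nlinarith
    · rcases lt_trichotomy w u with hgt | heq | hlt
      · exfalso
        have haw : w < a := Fin.lt_def.2 (by have := Fin.lt_def.1 hgt; have := Fin.lt_def.1 hbu; omega)
        have h1 := hw a w haw.ne'
        have h2 := (hmin w hgt).resolve_right haw.not_ge
        rw [move_apply, move_apply, h2] at h1
        simp [hba.ne', hgt.ne'] at h1
      · exact absurd heq hwu
      -- Below the diagonal the total change of `spread` is `2 (u - w)`.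
      · have : (u : ℤ) < w := by exact_mod_cast hlt
        unfold spread
        rw [wsum_move, wsum_move, hab']
        nlinarith

theorem offNonneg_move {n : ℕ} {A : Matrix (Fin n) (Fin n) ℤ} (h : OffNonneg A) {a b u : Fin n}
    (hu : 0 < A b u) : OffNonneg (move A b a u) := by
  intro i j hij
  rw [move_apply]
  have h1 := h i j hij
  split_ifs with h2 h3 h3
  · omega
  · omega
  · obtain ⟨rfl, rfl⟩ := h3
    omega
  · omega

theorem moveCoeff_eq {n : ℕ} (A : Matrix (Fin n) (Fin n) ℤ) (a b w : Fin n) :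
    moveCoeff A a b w = X ^ (beyondSum A a b w).toNat *
      ∑ i ∈ Finset.range (A b w + 1).toNat, X ^ i := by
  unfold moveCoeff
  rw [Finset.mul_sum]
  exact Finset.sum_congr rfl fun i _ => pow_add _ _ _

/-- Monicity is what later allows division by this coefficient in `ℤ[X]` instead of `ℚ[X]`. -/
theorem moveCoeff_monic {n : ℕ} {A : Matrix (Fin n) (Fin n) ℤ} {a b w : Fin n} (h : 0 ≤ A b w) :
    (moveCoeff A a b w).Monic := by
  rw [moveCoeff_eq]
  exact (monic_X_pow _).mul (monic_geom_sum_X (by omega))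

theorem moveCoeff_eval_pos {n : ℕ} {A : Matrix (Fin n) (Fin n) ℤ} {a b w : Fin n} (h : 0 ≤ A b w)
    {q : ℤ} (hq : 0 < q) : 0 < (moveCoeff A a b w).eval q := by
  unfold moveCoeff
  rw [eval_finsetSum]
  refine Finset.sum_pos (fun i _ => by simp; positivity) ?_
  rw [Finset.nonempty_range_iff]
  omega

end QSchur

/-! ### Convolution of orbits over finite fields -/

namespace QSchur

open Polynomial

section Orbits

variable {F E E' : Type} [Field F] [AddCommGroup E] [Module F E] [AddCommGroup E'] [Module F E']
  {n : ℕ}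

/-- The image of a flag under a linear equivalence. -/
def StepFlag.map (e : E ≃ₗ[F] E') (V : StepFlag F E n) : StepFlag F E' n where
  sub i := (V.sub i).map (e : E →ₗ[F] E')
  sub_mono _ _ h := Submodule.map_mono (V.sub_mono h)
  sub_zero := by rw [V.sub_zero, Submodule.map_bot]
  sub_last := by rw [V.sub_last, Submodule.map_top, LinearEquiv.range]

theorem relPosZ_map [FiniteDimensional F E] [FiniteDimensional F E'] (e : E ≃ₗ[F] E')
    (V V' : StepFlag F E n) : relPosZ (V.map e) (V'.map e) = relPosZ V V' := by
  have h : ∀ i j, infDim (V.map e) (V'.map e) i j = infDim V V' i j := by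
    intro i j
    unfold infDim StepFlag.map
    simp only
    rw [← Submodule.map_inf _ e.injective]
    exact congrArg _ (LinearEquiv.finrank_map_eq e _)
  ext i j
  simp only [relPosZ_apply, h]

theorem relPosZ_self [FiniteDimensional F E] (V V' : StepFlag F E n) :
    relPosZ V V = Matrix.diagonal (ro (relPosZ V V')) := by
  rw [relPosZ_eq_iff]
  intro i j
  rw [cum_diagonal, ← finrank_sub_eq_ro]
  unfold infDim
  rcases le_total i j with h | h
  · rw [min_eq_left h, inf_eq_left.2 (V.sub_mono h)]
  · rw [min_eq_right h, inf_eq_right.2 (V.sub_mono h)]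

/-- A diagonal relative position gives `V_i`, `W_i` and `V_i ∩ W_i` the same dimension. Diagonal
matrices are therefore orbits of pairs of equal flags and act as local identities. -/
theorem eq_of_relPosZ_eq_diagonal [FiniteDimensional F E] {V W : StepFlag F E n} {μ : Fin n → ℤ}
    (h : relPosZ V W = Matrix.diagonal μ) : V = W := by
  have hr : ro (relPosZ V W) = μ := by
    rw [h]
    funext i
    unfold ro
    rw [Finset.sum_eq_single i (fun j _ hj => Matrix.diagonal_apply_ne' _ hj) (by simp)]
    simp
  have hc : co (relPosZ V W) = μ := by
    rw [h]
    funext i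
    unfold co
    rw [Finset.sum_eq_single i (fun j _ hj => Matrix.diagonal_apply_ne _ hj) (by simp)]
    simp
  apply StepFlag.ext'
  intro i
  have h1 := infDim_eq_cum V W i i
  rw [h, cum_diagonal, min_self] at h1
  have h2 := finrank_sub_eq_ro V W i
  have h3 := finrank_sub_eq_co V W i
  rw [hr] at h2
  rw [hc] at h3
  unfold infDim at h1
  have e1 := Submodule.eq_of_le_of_finrank_eq (inf_le_left : V.sub i ⊓ W.sub i ≤ V.sub i) (by omega)
  have e2 := Submodule.eq_of_le_of_finrank_eq (inf_le_right : V.sub i ⊓ W.sub i ≤ W.sub i) (by omega)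
  exact e1.symm.trans e2

end Orbits

/-- A matrix in `Θ_d`, with integer entries. -/
def Theta.toInt {n d : ℕ} (A : Theta n d) : Matrix (Fin n) (Fin n) ℤ := fun i j => (A.1 i j : ℤ)

theorem Theta.toInt_injective {n d : ℕ} : Function.Injective (Theta.toInt (n := n) (d := d)) := by
  intro A B h
  apply Subtype.ext
  ext i j
  exact Int.ofNat_inj.1 (congrFun (congrFun h i) j)

theorem Theta.inTheta {n d : ℕ} (A : Theta n d) : InTheta d A.toInt :=
  ⟨fun _ _ => Int.natCast_nonneg _, by
    have := A.2
    unfold Theta.toInt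
    exact_mod_cast this⟩

theorem InTheta.toInt_toTheta {n d : ℕ} {M : Matrix (Fin n) (Fin n) ℤ} (h : InTheta d M) :
    h.toTheta.toInt = M := by
  ext i j
  exact Int.toNat_of_nonneg (h.1 i j)

theorem relPosZ_eq_toInt_iff {F E : Type} [Field F] [AddCommGroup E] [Module F E] {n d : ℕ}
    (V V' : StepFlag F E n) (A : Theta n d) : relPosZ V V' = A.toInt ↔ relPos V V' = A.1 := by
  constructor
  · intro h
    ext i j
    exact Int.ofNat_inj.1 (congrFun (congrFun h i) j)
  · intro h
    ext i j
    unfold relPosZ Theta.toInt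
    rw [h]

theorem inTheta_relPosZ {F : Type} [Field F] {n d : ℕ} (V V' : StepFlag F (Fin d → F) n) :
    InTheta d (relPosZ V V') :=
  ⟨relPosZ_nonneg V V', by rw [sum_relPosZ, Module.finrank_fin_fun]⟩

/-- The pair of row and column flags on the cells of `A`, transported to `F^d`. Nonemptiness of
every orbit makes the coefficients of a combination of orbits readable as matrix entries. -/
theorem exists_relPosZ_eq (F : Type) [Field F] {n d : ℕ} (A : Theta n d) :
    ∃ V V' : StepFlag F (Fin d → F) n, relPosZ V V' = A.toInt := by
  have hcard : Module.finrank F (Cell A.1 →₀ F) = Module.finrank F (Fin d → F) := by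
    rw [Module.finrank_finsupp_self, Module.finrank_fin_fun]
    have h := sum_cell A.1 fun _ _ => 1
    have h2 := A.2
    simp only [Finset.sum_const, Finset.card_univ, mul_one, nsmul_eq_mul] at h
    refine Eq.trans ?_ h2
    exact_mod_cast h
  let e := LinearEquiv.ofFinrankEq _ _ hcard
  exact ⟨(rowFlag F A.1).map e, (colFlag F A.1).map e, by
    rw [relPosZ_map, relPosZ_eq_toInt_iff]
    exact relPos_rowFlag_colFlag F A.1⟩

instance {F : Type} [Field F] [Finite F] {n d : ℕ} : Finite (StepFlag F (Fin d → F) n) := by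
  have := finite_submodule (F := F) (E := Fin d → F)
  refine Finite.of_injective (fun V : StepFlag F (Fin d → F) n => V.sub) fun V W h =>
    StepFlag.ext' fun i => congrFun h i

noncomputable instance {F : Type} [Field F] [Finite F] {n d : ℕ} :
    Fintype (StepFlag F (Fin d → F) n) := Fintype.ofFinite _

/-- The square matrices over `ℤ` that are indexed by flags. -/
abbrev FlagMatrix (F : Type) [Field F] (n d : ℕ) : Type :=
  Matrix (StepFlag F (Fin d → F) n) (StepFlag F (Fin d → F) n) ℤ

open Classical in
/-- The characteristic function of an orbit on pairs of flags. -/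
noncomputable def orbitMatrix (F : Type) [Field F] {n : ℕ} (d : ℕ) (A : Matrix (Fin n) (Fin n) ℤ) :
    FlagMatrix F n d := fun V W => if relPosZ V W = A then 1 else 0

section OrbitMatrix

variable {F : Type} [Field F] {n d : ℕ}

theorem orbitMatrix_eq_zero {A : Matrix (Fin n) (Fin n) ℤ} (h : ¬ InTheta d A) :
    orbitMatrix F d A = 0 := by
  ext V W
  exact if_neg fun h1 : relPosZ V W = A => h (h1 ▸ inTheta_relPosZ V W)

theorem sum_smul_orbitMatrix_apply (c : Theta n d → ℤ) (C : Theta n d)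
    {V W : StepFlag F (Fin d → F) n} (h : relPosZ V W = C.toInt) :
    (∑ A, c A • orbitMatrix F d A.toInt) V W = c C := by
  rw [Matrix.sum_apply, Finset.sum_eq_single C _ (by simp)]
  · simp [orbitMatrix, h]
  · intro A _ hA
    have : ¬ C.toInt = A.toInt := fun h1 => hA (Theta.toInt_injective h1).symm
    simp [orbitMatrix, h, this]

variable [Finite F]

theorem orbitMatrix_mul_apply (A B : Matrix (Fin n) (Fin n) ℤ) (V V' : StepFlag F (Fin d → F) n) :
    (orbitMatrix F d A * orbitMatrix F d B) V V' =
      Nat.card {W : StepFlag F (Fin d → F) n // relPosZ V W = A ∧ relPosZ W V' = B} := by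
  classical
  rw [Matrix.mul_apply, Nat.card_eq_fintype_card, Fintype.card_subtype, Finset.card_filter]
  push_cast
  refine Finset.sum_congr rfl fun W _ => ?_
  unfold orbitMatrix
  by_cases h1 : relPosZ V W = A <;> by_cases h2 : relPosZ W V' = B <;> simp [h1, h2]

theorem orbitMatrix_mul_eq_zero {A B : Matrix (Fin n) (Fin n) ℤ} (h : co A ≠ ro B) :
    orbitMatrix F d A * orbitMatrix F d B = 0 := by
  ext V V'
  rw [orbitMatrix_mul_apply]
  have : IsEmpty {W : StepFlag F (Fin d → F) n // relPosZ V W = A ∧ relPosZ W V' = B} := by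
    refine ⟨?_⟩
    rintro ⟨W, rfl, rfl⟩
    exact h (ro_relPosZ_eq_co V W V')
  simp

theorem orbitMatrix_diagonal_mul (B : Matrix (Fin n) (Fin n) ℤ) :
    orbitMatrix F d (Matrix.diagonal (ro B)) * orbitMatrix F d B = orbitMatrix F d B := by
  ext V V'
  rw [orbitMatrix_mul_apply]
  by_cases h : relPosZ V V' = B
  · have e : {W : StepFlag F (Fin d → F) n // relPosZ V W = Matrix.diagonal (ro B) ∧
        relPosZ W V' = B} ≃ Unit :=
      { toFun := fun _ => ()
        invFun := fun _ => ⟨V, h ▸ relPosZ_self V V', h⟩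
        left_inv := fun W => Subtype.ext (eq_of_relPosZ_eq_diagonal W.2.1)
        right_inv := fun _ => rfl }
    rw [Nat.card_congr e]
    simp [orbitMatrix, h]
  · have : IsEmpty {W : StepFlag F (Fin d → F) n // relPosZ V W = Matrix.diagonal (ro B) ∧
        relPosZ W V' = B} := by
      refine ⟨?_⟩
      rintro ⟨W, h1, h2⟩
      obtain rfl := eq_of_relPosZ_eq_diagonal h1
      exact h h2
    simp [orbitMatrix, h]

theorem orbitMatrix_elemMat_mul (A : Matrix (Fin n) (Fin n) ℤ) {a b : Fin n} (hab : Adjacent a b) :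
    orbitMatrix F d (elemMat (ro A) a b) * orbitMatrix F d A =
      ∑ w, (moveCoeff A a b w).eval (Nat.card F : ℤ) • orbitMatrix F d (move A a b w) := by
  ext V V'
  rw [orbitMatrix_mul_apply, card_elemMat V V' A hab, Matrix.sum_apply]
  exact Finset.sum_congr rfl fun w _ => by simp [orbitMatrix]

end OrbitMatrix

/-! ### Existence of the structure polynomials -/

/-- A family of matrices, one for every finite field, is polynomial if it is a combination of
orbits with coefficients that are polynomials in the number of elements of the field. -/
def IsPolyFamily {n d : ℕ} (M : ∀ (F : Type) [Field F] [Finite F], FlagMatrix F n d) : Prop :=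
  ∃ g : Theta n d → ℤ[X], ∀ (F : Type) [Field F] [Finite F],
    M F = ∑ C, (g C).eval (Nat.card F : ℤ) • orbitMatrix F d C.toInt

section PolyFamily

variable {n d : ℕ}

theorem isPolyFamily_orbitMatrix (A : Matrix (Fin n) (Fin n) ℤ) :
    IsPolyFamily fun F _ _ => orbitMatrix F d A := by
  by_cases h : InTheta d A
  · refine ⟨Pi.single h.toTheta 1, fun F _ _ => ?_⟩
    rw [Finset.sum_eq_single h.toTheta (fun B _ hB => by simp [hB]) (by simp),
      h.toInt_toTheta]
    simp
  · exact ⟨0, fun F _ _ => by simp [orbitMatrix_eq_zero h]⟩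

theorem isPolyFamily_zero : IsPolyFamily (n := n) (d := d) fun _ _ _ => 0 :=
  ⟨0, fun F _ _ => by simp⟩

variable {M M' : ∀ (F : Type) [Field F] [Finite F], FlagMatrix F n d}

theorem IsPolyFamily.sub (h : IsPolyFamily M) (h' : IsPolyFamily M') :
    IsPolyFamily fun F _ _ => M F - M' F := by
  obtain ⟨g, hg⟩ := h
  obtain ⟨g', hg'⟩ := h'
  refine ⟨g - g', fun F _ _ => ?_⟩
  beta_reduce
  rw [hg F, hg' F, ← Finset.sum_sub_distrib]
  simp [sub_smul]

theorem IsPolyFamily.smul (h : IsPolyFamily M) (f : ℤ[X]) :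
    IsPolyFamily fun F _ _ => f.eval (Nat.card F : ℤ) • M F := by
  obtain ⟨g, hg⟩ := h
  refine ⟨f • g, fun F _ _ => ?_⟩
  beta_reduce
  rw [hg F, Finset.smul_sum]
  simp [mul_smul]

theorem IsPolyFamily.sum {ι : Type} (s : Finset ι)
    {M : ι → ∀ (F : Type) [Field F] [Finite F], FlagMatrix F n d}
    (h : ∀ i ∈ s, IsPolyFamily (M i)) : IsPolyFamily fun F _ _ => ∑ i ∈ s, M i F := by
  choose! g hg using h
  refine ⟨∑ i ∈ s, g i, fun F _ _ => ?_⟩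
  beta_reduce
  rw [Finset.sum_congr rfl fun i hi => hg i hi F, Finset.sum_comm]
  refine Finset.sum_congr rfl fun C _ => ?_
  rw [← Finset.sum_smul, Finset.sum_apply, eval_finsetSum]

/-- Products with polynomial families may be checked on orbits. -/
theorem IsPolyFamily.mul {B : Matrix (Fin n) (Fin n) ℤ} (h : IsPolyFamily M)
    (hB : ∀ Y, IsPolyFamily fun F _ _ => orbitMatrix F d B * orbitMatrix F d Y) :
    IsPolyFamily fun F _ _ => orbitMatrix F d B * M F := by
  obtain ⟨g, hg⟩ := h
  have h1 : IsPolyFamily fun F _ _ => ∑ C : Theta n d, (g C).eval (Nat.card F : ℤ) •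
      (orbitMatrix F d B * orbitMatrix F d C.toInt) :=
    IsPolyFamily.sum Finset.univ fun C _ => (hB C.toInt).smul (g C)
  obtain ⟨g', hg'⟩ := h1
  refine ⟨g', fun F _ _ => ?_⟩
  rw [← hg' F]
  beta_reduce
  rw [hg F, Finset.mul_sum]
  simp

theorem infinite_setOf_odd_prime : {p : ℕ | p.Prime ∧ p ≠ 2}.Infinite :=
  (Nat.infinite_setOfPred_prime.sdiff (Set.finite_singleton 2)).mono fun _ h => h

theorem infinite_range_odd_card {P : ℤ → Prop}
    (h : ∀ (F : Type) [Field F] [Finite F], ringChar F ≠ 2 → P (Nat.card F)) :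
    {a | P a}.Infinite := by
  refine (infinite_setOf_odd_prime.image (Nat.cast_injective (R := ℤ)).injOn).mono ?_
  rintro _ ⟨p, ⟨hp, hp2⟩, rfl⟩
  have : Fact p.Prime := ⟨hp⟩
  have := h (ZMod p) (by rwa [ZMod.ringChar_zmod_n])
  rwa [Nat.card_zmod] at this

/-- The entries of `M F` are integers, so `D(q)` divides the value at `q` of each coefficient for
infinitely many `q`. For a monic `D` this forces divisibility of polynomials. Positivity of `D(q)`
then permits cancellation over every finite field. -/
theorem IsPolyFamily.of_smul {D : ℤ[X]} (hD : D.Monic)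
    (hpos : ∀ q : ℤ, 0 < q → 0 < D.eval q)
    (h : IsPolyFamily fun F _ _ => D.eval (Nat.card F : ℤ) • M F) : IsPolyFamily M := by
  obtain ⟨f, hf⟩ := h
  have hdvd : ∀ C, ∃ g, f C = D * g := by
    intro C
    refine dvd_of_infinite_eval_dvd_eval hD (infinite_range_odd_card fun F _ _ _ => ?_)
    obtain ⟨V, W, hVW⟩ := exists_relPosZ_eq F C
    have h1 := congrFun (congrFun (hf F) V) W
    rw [sum_smul_orbitMatrix_apply _ C hVW] at h1
    exact ⟨M F V W, h1.symm⟩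
  choose g hg using hdvd
  refine ⟨g, fun F _ _ => ?_⟩
  have h0 : D.eval (Nat.card F : ℤ) ≠ 0 := (hpos _ (by exact_mod_cast Nat.card_pos)).ne'
  refine smul_right_injective _ h0 ?_
  have hfF := hf F
  beta_reduce at hfF ⊢
  rw [hfF, Finset.smul_sum]
  refine Finset.sum_congr rfl fun C _ => ?_
  rw [hg C, eval_mul, mul_smul]

theorem isPolyFamily_elemMat_mul {a b : Fin n} (hab : Adjacent a b) (μ : Fin n → ℤ)
    (Y : Matrix (Fin n) (Fin n) ℤ) :
    IsPolyFamily fun F _ _ => orbitMatrix F d (elemMat μ a b) * orbitMatrix F d Y := by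
  by_cases h : μ = ro Y
  · subst h
    simp only [orbitMatrix_elemMat_mul Y hab]
    exact IsPolyFamily.sum _ fun w _ => (isPolyFamily_orbitMatrix _).smul _
  · have h1 : co (elemMat μ a b) ≠ ro Y := by rwa [co_elemMat]
    simp only [orbitMatrix_mul_eq_zero h1]
    exact isPolyFamily_zero

/-- Induction on `spread A`. Multiply the elementary product that contains `A` by the orbit of `Y`:
by associativity the left side is an elementary product applied to a family known to be polynomial,
and all terms except the multiple of the wanted one are known by induction. -/
theorem isPolyFamily_orbitMatrix_mul (A Y : Matrix (Fin n) (Fin n) ℤ) :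
    IsPolyFamily fun F _ _ => orbitMatrix F d A * orbitMatrix F d Y := by
  by_cases hA : InTheta d A
  swap
  · simp only [orbitMatrix_eq_zero hA, zero_mul]
    exact isPolyFamily_zero
  obtain ⟨k, hk⟩ : ∃ k : ℕ, spread A = k := Int.eq_ofNat_of_zero_le (spread_nonneg fun i j _ => hA.1 i j)
  induction k using Nat.strong_induction_on generalizing A Y with
  | _ k ih =>
  by_cases hdiag : ∃ i j, i ≠ j ∧ A i j ≠ 0
  swap
  · push Not at hdiag
    have hA' : A = Matrix.diagonal fun i => A i i := by
      ext i j
      by_cases hij : i = j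
      · subst hij; simp
      · rw [Matrix.diagonal_apply_ne _ hij, hdiag i j hij]
    by_cases hco : co A = ro Y
    · have : A = Matrix.diagonal (ro Y) := by
        rw [← hco]
        conv_lhs => rw [hA']
        congr 1
        funext i
        unfold co
        rw [Finset.sum_eq_single i (fun j _ hj => hdiag j i hj) (by simp)]
      simp only [this, orbitMatrix_diagonal_mul]
      exact isPolyFamily_orbitMatrix Y
    · simp only [orbitMatrix_mul_eq_zero hco]
      exact isPolyFamily_zero
  obtain ⟨a, b, u, hab, hub, -, h0, hlt, hw⟩ := exists_move (fun i j _ => hA.1 i j) hdiag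
  set A' := move A b a u with hA'
  -- The bound on `spread` is available only for matrices with nonnegative off-diagonal entries. The
  -- others lie outside `Θ_d`, and their orbits are empty.
  have key : ∀ B : Matrix (Fin n) (Fin n) ℤ, (OffNonneg B → spread B < spread A) →
      ∀ Y, IsPolyFamily fun F _ _ => orbitMatrix F d B * orbitMatrix F d Y := by
    intro B hB Y
    by_cases hBt : InTheta d B
    · have h1 := spread_nonneg (A := B) fun i j _ => hBt.1 i j
      have h2 := hB fun i j _ => hBt.1 i j
      exact ih (spread B).toNat (by omega) B Y hBt (by omega)
    · simp only [orbitMatrix_eq_zero hBt, zero_mul]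
      exact isPolyFamily_zero
  have hlead : 0 ≤ A' b u := by
    rw [hA', move_apply]
    simp [hab.ne]
    omega
  refine IsPolyFamily.of_smul (D := moveCoeff A' a b u) (moveCoeff_monic hlead)
    (fun q hq => moveCoeff_eval_pos hlead hq) ?_
  have h1 : IsPolyFamily fun F _ _ => orbitMatrix F d (elemMat (ro A') a b) *
      (orbitMatrix F d A' * orbitMatrix F d Y) :=
    (key A' (fun _ => hlt) Y).mul fun Y => isPolyFamily_elemMat_mul hab _ Y
  have h2 : IsPolyFamily fun F _ _ => ∑ w ∈ Finset.univ.erase u,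
      (moveCoeff A' a b w).eval (Nat.card F : ℤ) •
        (orbitMatrix F d (move A' a b w) * orbitMatrix F d Y) :=
    IsPolyFamily.sum _ fun w hw' => (key _ (hw w (Finset.ne_of_mem_erase hw')) Y).smul _
  obtain ⟨g, hg⟩ := h1.sub h2
  refine ⟨g, fun F _ _ => ?_⟩
  rw [← hg F]
  beta_reduce
  rw [← mul_assoc, orbitMatrix_elemMat_mul A' hab, Finset.sum_mul,
    ← Finset.add_sum_erase _ _ (Finset.mem_univ u), hA', move_move]
  simp

end PolyFamily

theorem exists_isStructPoly {n d : ℕ} (A B C : Theta n d) : ∃ g, IsStructPoly A B C g := by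
  obtain ⟨g, hg⟩ := isPolyFamily_orbitMatrix_mul (d := d) A.toInt B.toInt
  refine ⟨g C, fun F _ _ _ V V' h => ?_⟩
  have h1 := congrFun (congrFun (hg F) V) V'
  beta_reduce at h1
  rw [sum_smul_orbitMatrix_apply _ C ((relPosZ_eq_toInt_iff V V' C).2 h), orbitMatrix_mul_apply] at h1
  rw [← h1]
  congr 1
  refine Nat.card_congr (Equiv.subtypeEquivRight fun W => ?_)
  rw [relPosZ_eq_toInt_iff, relPosZ_eq_toInt_iff]

theorem isStructPoly_structPoly {n d : ℕ} (A B C : Theta n d) :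
    IsStructPoly A B C (structPoly A B C) := by
  have h := exists_isStructPoly A B C
  unfold structPoly
  rw [dif_pos h]
  exact h.choose_spec

theorem orbitMatrix_mul {F : Type} [Field F] [Finite F] (hF : ringChar F ≠ 2) {n d : ℕ}
    (A B : Theta n d) : orbitMatrix F d A.toInt * orbitMatrix F d B.toInt =
      ∑ C, (structPoly A B C).eval (Nat.card F : ℤ) • orbitMatrix F d C.toInt := by
  ext V V'
  set C := (inTheta_relPosZ V V').toTheta
  have hC : relPosZ V V' = C.toInt := (InTheta.toInt_toTheta _).symm
  rw [sum_smul_orbitMatrix_apply _ C hC, orbitMatrix_mul_apply,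
    ← isStructPoly_structPoly A B C F hF V V' ((relPosZ_eq_toInt_iff V V' C).1 hC)]
  congr 1
  refine Nat.card_congr (Equiv.subtypeEquivRight fun W => ?_)
  rw [relPosZ_eq_toInt_iff, relPosZ_eq_toInt_iff]

/-- Polynomial relations between orbits may be checked over finite fields of odd characteristic. -/
theorem eq_of_forall_sum_smul_orbitMatrix {n d : ℕ} {g g' : Theta n d → ℤ[X]}
    (h : ∀ (F : Type) [Field F] [Finite F], ringChar F ≠ 2 →
      ∑ C, (g C).eval (Nat.card F : ℤ) • orbitMatrix F d C.toInt =
        ∑ C, (g' C).eval (Nat.card F : ℤ) • orbitMatrix F d C.toInt) : g = g' := by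
  funext C
  refine Polynomial.eq_of_infinite_eval_eq _ _ (infinite_range_odd_card fun F _ _ hF => ?_)
  obtain ⟨V, W, hVW⟩ := exists_relPosZ_eq F C
  have h1 := congrFun (congrFun (h F hF) V) W
  rwa [sum_smul_orbitMatrix_apply _ C hVW, sum_smul_orbitMatrix_apply _ C hVW] at h1

/-- Compare both sides as combinations of orbits over each finite field of odd characteristic, where
the identity is associativity of matrix multiplication. Infinitely many values of `q` determine the
polynomials. -/
theorem structPoly_assoc {n d : ℕ} (A B C Y : Theta n d) :
    ∑ X, structPoly A B X * structPoly X C Y = ∑ X, structPoly B C X * structPoly A X Y := by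
  refine congrFun (eq_of_forall_sum_smul_orbitMatrix (g := fun Y =>
    ∑ X, structPoly A B X * structPoly X C Y) (g' := fun Y =>
    ∑ X, structPoly B C X * structPoly A X Y) fun F _ _ hF => ?_) Y
  have h := mul_assoc (orbitMatrix F d A.toInt) (orbitMatrix F d B.toInt) (orbitMatrix F d C.toInt)
  rw [orbitMatrix_mul hF, orbitMatrix_mul hF, Finset.sum_mul, Finset.mul_sum] at h
  simp only [Matrix.smul_mul, Matrix.mul_smul, orbitMatrix_mul hF, Finset.smul_sum] at h
  rw [Finset.sum_comm] at h
  conv_rhs at h => rw [Finset.sum_comm]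
  simp only [eval_finsetSum, Finset.sum_smul, eval_mul, mul_smul]
  exact h

theorem structPoly_eq_zero {n d : ℕ} {A B : Theta n d} (h : co A.toInt ≠ ro B.toInt)
    (C : Theta n d) : structPoly A B C = 0 := by
  refine congrFun (eq_of_forall_sum_smul_orbitMatrix (g := structPoly A B) (g' := 0)
    fun F _ _ hF => ?_) C
  rw [← orbitMatrix_mul hF, orbitMatrix_mul_eq_zero h]
  simp

theorem structPoly_diagonal {n d : ℕ} {A B : Theta n d} (h : A.toInt = Matrix.diagonal (ro B.toInt)) :
    structPoly A B = Pi.single B 1 := by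
  refine eq_of_forall_sum_smul_orbitMatrix fun F _ _ hF => ?_
  rw [← orbitMatrix_mul hF, h, orbitMatrix_diagonal_mul,
    Finset.sum_eq_single B (fun C _ hC => by simp [hC]) (by simp)]
  simp

open Classical in
theorem structPoly_elemMat {n d : ℕ} {A B : Theta n d} {a b : Fin n} (hab : Adjacent a b)
    (h : A.toInt = elemMat (ro B.toInt) a b) (C : Theta n d) : structPoly A B C =
      ∑ w, if C.toInt = move B.toInt a b w then moveCoeff B.toInt a b w else 0 := by
  refine congrFun (eq_of_forall_sum_smul_orbitMatrix (g := structPoly A B) (g' := fun C =>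
    ∑ w, if C.toInt = move B.toInt a b w then moveCoeff B.toInt a b w else 0)
    fun F _ _ hF => ?_) C
  rw [← orbitMatrix_mul hF, h, orbitMatrix_elemMat_mul _ hab]
  simp only [eval_finsetSum, Finset.sum_smul]
  rw [Finset.sum_comm]
  refine Finset.sum_congr rfl fun w _ => ?_
  by_cases hw : InTheta d (move B.toInt a b w)
  · rw [Finset.sum_eq_single hw.toTheta (fun C _ hC => ?_) (by simp)]
    · simp [hw.toInt_toTheta]
    · rw [if_neg, eval_zero, zero_smul]
      intro h1
      exact hC (Theta.toInt_injective (h1.trans hw.toInt_toTheta.symm))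
  · rw [orbitMatrix_eq_zero hw, smul_zero]
    refine (Finset.sum_eq_zero fun C _ => ?_).symm
    rw [if_neg, eval_zero, zero_smul]
    intro h1
    exact hw (h1 ▸ C.inTheta)

end QSchur

namespace QSchur

open Polynomial

/-! Extension of scalars to `ℚ(v, t)`. -/

/-- An element of `𝒮_d` with coefficients in `ℚ(v, t)`. -/
noncomputable def toQ {n d : ℕ} (x : SchurAlg n d) : Theta n d → Qvt := fun C => (x C : Qvt)

/-- The value of the structure polynomial at `v²`. -/
noncomputable def structVal {n d : ℕ} (A B C : Theta n d) : Qvt := aeval (vK ^ 2) (structPoly A B C)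

/-- The product of `𝒮_d`, with coefficients in `ℚ(v, t)`. -/
noncomputable def convQ (n d : ℕ) : (Theta n d → Qvt) →ₗ[Qvt] (Theta n d → Qvt) →ₗ[Qvt]
    (Theta n d → Qvt) :=
  LinearMap.mk₂ Qvt (fun f g C => ∑ A, ∑ B, f A * g B * structVal A B C)
    (fun f f' g => by
      funext C
      simp only [Pi.add_apply, add_mul, Finset.sum_add_distrib])
    (fun c f g => by
      funext C
      simp only [Pi.smul_apply, smul_eq_mul, Finset.mul_sum, mul_assoc])
    (fun f g g' => by
      funext C
      simp only [Pi.add_apply, mul_add, add_mul, Finset.sum_add_distrib])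
    (fun c f g => by
      funext C
      simp only [Pi.smul_apply, smul_eq_mul, Finset.mul_sum]
      exact Finset.sum_congr rfl fun A _ => Finset.sum_congr rfl fun B _ => by ring)

theorem convQ_apply {n d : ℕ} (f g : Theta n d → Qvt) (C : Theta n d) :
    convQ n d f g C = ∑ A, ∑ B, f A * g B * structVal A B C := rfl

theorem toQ_conv {n d : ℕ} (f g : SchurAlg n d) : toQ (conv f g) = convQ n d (toQ f) (toQ g) := by
  funext C
  rw [convQ_apply]
  unfold toQ conv structVal
  push_cast
  refine Finset.sum_congr rfl fun A _ => Finset.sum_congr rfl fun B _ => ?_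
  rfl

theorem convQ_single {n d : ℕ} (A B : Theta n d) (x y : Qvt) :
    convQ n d (Pi.single A x) (Pi.single B y) = (x * y) • structVal A B := by
  funext C
  rw [convQ_apply, Finset.sum_eq_single A (fun A' _ hA => by simp [hA]) (by simp),
    Finset.sum_eq_single B (fun B' _ hB => by simp [hB]) (by simp)]
  simp

theorem fun_eq_sum_single {n d : ℕ} (f : Theta n d → Qvt) :
    f = ∑ A, f A • (Pi.single A 1 : Theta n d → Qvt) := by
  funext C
  simp [Finset.sum_apply, Pi.single_apply]

theorem convQ_assoc {n d : ℕ} (f g h : Theta n d → Qvt) :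
    convQ n d (convQ n d f g) h = convQ n d f (convQ n d g h) := by
  have key : ∀ A B C : Theta n d,
      convQ n d (convQ n d (Pi.single A 1) (Pi.single B 1)) (Pi.single C 1) =
        convQ n d (Pi.single A 1) (convQ n d (Pi.single B 1) (Pi.single C 1)) := by
    intro A B C
    rw [convQ_single, convQ_single, mul_one, one_smul, one_smul,
      fun_eq_sum_single (structVal A B), fun_eq_sum_single (structVal B C)]
    simp only [map_sum, map_smul, LinearMap.sum_apply, LinearMap.smul_apply, convQ_single, mul_one,
      one_smul]
    funext Y
    simp only [Finset.sum_apply, Pi.smul_apply, smul_eq_mul]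
    have := congrArg (aeval (vK ^ 2)) (structPoly_assoc A B C Y)
    simpa [structVal] using this
  rw [fun_eq_sum_single f, fun_eq_sum_single g, fun_eq_sum_single h]
  simp only [map_sum, map_smul, LinearMap.sum_apply, LinearMap.smul_apply, key]

/-! The basis `{A}`. -/

/-- `d(A) - r(A)`, for a matrix with integer entries. -/
def braceExpZ {n : ℕ} (A : Matrix (Fin n) (Fin n) ℤ) : ℤ :=
  ∑ i, ∑ j, ∑ k, ∑ l, if k ≤ i ∧ j < l then A i j * A k l else 0

/-- `v^{-e} t^e`. -/
noncomputable def scale (e : ℤ) : Qvt := vK ^ (-e) * tK ^ e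

theorem scale_add (e e' : ℤ) : scale (e + e') = scale e * scale e' := by
  unfold scale
  rw [neg_add, zpow_add₀ vK_ne_zero, zpow_add₀ tK_ne_zero]
  ring

theorem scale_ne_zero (e : ℤ) : scale e ≠ 0 :=
  mul_ne_zero (zpow_ne_zero _ vK_ne_zero) (zpow_ne_zero _ tK_ne_zero)

theorem scale_zero : scale 0 = 1 := by simp [scale]

theorem scale_sub (e e' : ℤ) : scale (e - e') * scale e' = scale e := by
  rw [← scale_add]
  congr 1
  ring

open Classical in
/-- The basis element `{A}`, or `0` if `A` does not lie in `Θ_d`. -/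
noncomputable def braceQ {n : ℕ} (d : ℕ) (A : Matrix (Fin n) (Fin n) ℤ) : Theta n d → Qvt :=
  if h : InTheta d A then Pi.single h.toTheta (scale (braceExpZ A)) else 0

section Brace

variable {n d : ℕ}

theorem braceQ_of_inTheta {A : Matrix (Fin n) (Fin n) ℤ} (h : InTheta d A) :
    braceQ d A = Pi.single h.toTheta (scale (braceExpZ A)) := dif_pos h

theorem braceQ_of_not_inTheta {A : Matrix (Fin n) (Fin n) ℤ} (h : ¬ InTheta d A) :
    braceQ d A = 0 := dif_neg h

theorem braceQ_toInt (A : Theta n d) :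
    braceQ d A.toInt = Pi.single A (scale (braceExpZ A.toInt)) := by
  rw [braceQ_of_inTheta A.inTheta]
  congr 1

theorem toQ_brace {A : Matrix (Fin n) (Fin n) ℤ} (h : InTheta d A) :
    toQ (brace h.toTheta) = braceQ d A := by
  rw [braceQ_of_inTheta h]
  have he : braceExp h.toTheta.1 = braceExpZ A := by
    rw [braceExp_eq]
    conv_rhs => rw [← h.toInt_toTheta]
    rfl
  funext C
  unfold toQ brace
  by_cases hC : C = h.toTheta
  · subst hC
    rw [Pi.single_eq_same, Pi.single_eq_same, he]
    have hv : ∀ z : ℤ, (((vA ^ z : LaurentAˣ) : LaurentA) : Qvt) = vK ^ z := by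
      intro z
      have h1 := map_zpow (Units.map (LaurentA.val : LaurentA →* Qvt)) vA z
      have h2 := congrArg Units.val h1
      rw [Units.val_zpow_eq_zpow_val] at h2
      exact h2
    have ht : ∀ z : ℤ, (((tA ^ z : LaurentAˣ) : LaurentA) : Qvt) = tK ^ z := by
      intro z
      have h1 := map_zpow (Units.map (LaurentA.val : LaurentA →* Qvt)) tA z
      have h2 := congrArg Units.val h1
      rw [Units.val_zpow_eq_zpow_val] at h2
      exact h2
    unfold scale
    rw [← hv, ← ht]
    rfl
  · rw [Pi.single_eq_of_ne hC, Pi.single_eq_of_ne hC]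
    rfl

theorem convQ_braceQ_eq_zero {A B : Matrix (Fin n) (Fin n) ℤ} (h : co A ≠ ro B) :
    convQ n d (braceQ d A) (braceQ d B) = 0 := by
  by_cases hA : InTheta d A
  swap
  · rw [braceQ_of_not_inTheta hA, map_zero, LinearMap.zero_apply]
  by_cases hB : InTheta d B
  swap
  · rw [braceQ_of_not_inTheta hB, map_zero]
  rw [braceQ_of_inTheta hA, braceQ_of_inTheta hB, convQ_single]
  have : structVal hA.toTheta hB.toTheta = 0 := by
    funext C
    unfold structVal
    rw [structPoly_eq_zero (by rwa [hA.toInt_toTheta, hB.toInt_toTheta]), map_zero]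
    rfl
  rw [this, smul_zero]

theorem ro_diagonal (μ : Fin n → ℤ) : ro (Matrix.diagonal μ) = μ := by
  funext i
  unfold ro
  rw [Finset.sum_eq_single i (fun j _ hj => Matrix.diagonal_apply_ne' _ hj) (by simp)]
  simp

theorem co_diagonal (μ : Fin n → ℤ) : co (Matrix.diagonal μ) = μ := by
  funext i
  unfold co
  rw [Finset.sum_eq_single i (fun j _ hj => Matrix.diagonal_apply_ne _ hj) (by simp)]
  simp

theorem braceExpZ_diagonal (μ : Fin n → ℤ) : braceExpZ (Matrix.diagonal μ) = 0 := by
  unfold braceExpZ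
  refine Finset.sum_eq_zero fun i _ => Finset.sum_eq_zero fun j _ => Finset.sum_eq_zero fun k _ =>
    Finset.sum_eq_zero fun l _ => ?_
  by_cases hij : i = j
  · by_cases hkl : k = l
    · subst hij hkl
      rw [if_neg]
      rintro ⟨h1, h2⟩
      exact absurd h1 h2.not_ge
    · simp [hkl]
  · simp [hij]

theorem inTheta_diagonal_ro {B : Matrix (Fin n) (Fin n) ℤ} (h : InTheta d B) :
    InTheta d (Matrix.diagonal (ro B)) := by
  constructor
  · intro i j
    by_cases hij : i = j
    · subst hij
      rw [Matrix.diagonal_apply_eq]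
      exact Finset.sum_nonneg fun k _ => h.1 i k
    · rw [Matrix.diagonal_apply_ne _ hij]
  · rw [← h.2]
    exact Finset.sum_congr rfl fun i _ => congrFun (ro_diagonal (ro B)) i

theorem convQ_braceQ_diagonal (B : Matrix (Fin n) (Fin n) ℤ) :
    convQ n d (braceQ d (Matrix.diagonal (ro B))) (braceQ d B) = braceQ d B := by
  by_cases hB : InTheta d B
  swap
  · rw [braceQ_of_not_inTheta hB, map_zero]
  have hA := inTheta_diagonal_ro hB
  rw [braceQ_of_inTheta hA, braceQ_of_inTheta hB, convQ_single, braceExpZ_diagonal, scale_zero,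
    one_mul]
  have h1 := structPoly_diagonal (A := hA.toTheta) (B := hB.toTheta)
    (by rw [hA.toInt_toTheta, hB.toInt_toTheta])
  funext C
  unfold structVal
  rw [Pi.smul_apply, h1]
  by_cases hC : C = hB.toTheta
  · subst hC; simp
  · simp [hC]

/-- Terms whose moved matrix leaves `Θ_d` do not have to be excluded from the sum, because `braceQ`
vanishes there. The factor `scale` compares the normalizations of the two factors with that of the
result. -/
theorem convQ_braceQ_elemMat {A : Matrix (Fin n) (Fin n) ℤ} {a b : Fin n} (hab : Adjacent a b)
    (hA : InTheta d A) (hB : InTheta d (elemMat (ro A) a b)) :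
    convQ n d (braceQ d (elemMat (ro A) a b)) (braceQ d A) =
      ∑ w, (scale (braceExpZ (elemMat (ro A) a b) + braceExpZ A - braceExpZ (move A a b w)) *
        aeval (vK ^ 2) (moveCoeff A a b w)) • braceQ d (move A a b w) := by
  classical
  rw [braceQ_of_inTheta hA, braceQ_of_inTheta hB, convQ_single, ← scale_add]
  funext C
  unfold structVal
  rw [Pi.smul_apply, structPoly_elemMat hab (by rw [hA.toInt_toTheta, hB.toInt_toTheta]) C,
    hA.toInt_toTheta, map_sum, Finset.smul_sum, Finset.sum_apply]
  refine Finset.sum_congr rfl fun w _ => ?_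
  rw [Pi.smul_apply]
  by_cases h : C.toInt = move A a b w
  · rw [if_pos h, ← h, braceQ_toInt, Pi.single_eq_same, ← scale_sub _ (braceExpZ C.toInt)]
    simp only [smul_eq_mul]
    ring
  · rw [if_neg h, map_zero, smul_zero]
    by_cases hm : InTheta d (move A a b w)
    · rw [braceQ_of_inTheta hm, Pi.single_eq_of_ne, smul_zero]
      rintro rfl
      exact h hm.toInt_toTheta
    · rw [braceQ_of_not_inTheta hm, Pi.zero_apply, smul_zero]

end Brace

/-! Dependence on the shift. -/

/-- `A + p I`, for a matrix with integer entries. -/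
def shiftZ {n : ℕ} (p : ℕ) (A : Matrix (Fin n) (Fin n) ℤ) : Matrix (Fin n) (Fin n) ℤ :=
  A + (p : ℤ) • (1 : Matrix (Fin n) (Fin n) ℤ)

section Shift

variable {n : ℕ}

theorem shiftZ_apply (p : ℕ) (A : Matrix (Fin n) (Fin n) ℤ) (i j : Fin n) :
    shiftZ p A i j = A i j + if i = j then (p : ℤ) else 0 := by
  rw [shiftZ, Matrix.add_apply, Matrix.smul_apply, Matrix.one_apply]
  split_ifs <;> simp

theorem ro_shiftZ (p : ℕ) (A : Matrix (Fin n) (Fin n) ℤ) (i : Fin n) :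
    ro (shiftZ p A) i = ro A i + p := by
  simp [ro, shiftZ_apply, Finset.sum_add_distrib]

theorem co_shiftZ (p : ℕ) (A : Matrix (Fin n) (Fin n) ℤ) (i : Fin n) :
    co (shiftZ p A) i = co A i + p := by
  simp [co, shiftZ_apply, Finset.sum_add_distrib]

theorem shiftZ_diagonal (p : ℕ) (μ : Fin n → ℤ) :
    shiftZ p (Matrix.diagonal μ) = Matrix.diagonal fun i => μ i + p := by
  ext i j
  rw [shiftZ_apply]
  by_cases hij : i = j
  · subst hij; simp
  · simp [hij]

theorem shiftZ_diagonal_ro (p : ℕ) (A : Matrix (Fin n) (Fin n) ℤ) :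
    shiftZ p (Matrix.diagonal (ro A)) = Matrix.diagonal (ro (shiftZ p A)) := by
  rw [shiftZ_diagonal]
  congr 1
  funext i
  rw [ro_shiftZ]

theorem shiftZ_move (p : ℕ) (A : Matrix (Fin n) (Fin n) ℤ) (a b w : Fin n) :
    shiftZ p (move A a b w) = move (shiftZ p A) a b w := by
  unfold shiftZ move
  abel

theorem shiftZ_elemMat (p : ℕ) (A : Matrix (Fin n) (Fin n) ℤ) (a b : Fin n) :
    shiftZ p (elemMat (ro A) a b) = elemMat (ro (shiftZ p A)) a b := by
  unfold elemMat
  have h : Matrix.diagonal (fun i => ro (shiftZ p A) i - (Pi.single a 1 : Fin n → ℤ) i) =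
      shiftZ p (Matrix.diagonal fun i => ro A i - (Pi.single a 1 : Fin n → ℤ) i) := by
    rw [shiftZ_diagonal]
    congr 1
    funext i
    rw [ro_shiftZ]
    ring
  rw [h]
  unfold shiftZ
  abel

/-- The sum of the distances to the diagonal. -/
def diagDist (A : Matrix (Fin n) (Fin n) ℤ) : ℤ := wsum (fun i j => |(i : ℤ) - j|) A

theorem sum_ite_le_lt (i j : Fin n) : (∑ k : Fin n, if k ≤ i ∧ j < k then (1 : ℤ) else 0) =
    ((i : ℤ) - j) ⊔ 0 := by
  rw [Finset.sum_boole]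
  have : Finset.univ.filter (fun k : Fin n => k ≤ i ∧ j < k) = Finset.Ioc j i := by
    ext k
    simp [and_comm]
  rw [this, Fin.card_Ioc]
  rcases le_total (i : ℕ) j with h | h
  · rw [max_eq_right (by omega)]
    omega
  · rw [max_eq_left (by omega)]
    omega

theorem sum_ite_le_lt' (i j : Fin n) : (∑ k : Fin n, if i ≤ k ∧ k < j then (1 : ℤ) else 0) =
    ((j : ℤ) - i) ⊔ 0 := by
  rw [Finset.sum_boole]
  have : Finset.univ.filter (fun k : Fin n => i ≤ k ∧ k < j) = Finset.Ico i j := by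
    ext k
    simp
  rw [this, Fin.card_Ico]
  rcases le_total (i : ℕ) j with h | h
  · rw [max_eq_left (by omega)]
    omega
  · rw [max_eq_right (by omega)]
    omega

/-- The form is quadratic in the entries. Its restriction to diagonal matrices is zero, and its
polarization with the identity matrix is the sum of the distances to the diagonal, so the exponent
is affine in `p`. -/
theorem braceExpZ_shiftZ (p : ℕ) (A : Matrix (Fin n) (Fin n) ℤ) :
    braceExpZ (shiftZ p A) = braceExpZ A + p * diagDist A := by
  have h1 : braceExpZ (shiftZ p A) = braceExpZ A +
      p * ((∑ i, ∑ j, ∑ k, ∑ l, if k ≤ i ∧ j < l then A i j * (if k = l then 1 else 0) else 0) +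
        ∑ i, ∑ j, ∑ k, ∑ l, if k ≤ i ∧ j < l then (if i = j then 1 else 0) * A k l else 0) +
      p ^ 2 * ∑ i : Fin n, ∑ j : Fin n, ∑ k : Fin n, ∑ l : Fin n,
        if k ≤ i ∧ j < l then (if i = j then 1 else 0) * (if k = l then 1 else 0) else 0 := by
    unfold braceExpZ
    simp only [shiftZ_apply, mul_add, Finset.mul_sum, ← Finset.sum_add_distrib]
    refine Finset.sum_congr rfl fun i _ => Finset.sum_congr rfl fun j _ =>
      Finset.sum_congr rfl fun k _ => Finset.sum_congr rfl fun l _ => ?_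
    split_ifs <;> ring
  -- The coefficient of `p²` is zero, because `k ≤ i = j < l = k` is impossible.
  have h2 : (∑ i : Fin n, ∑ j : Fin n, ∑ k : Fin n, ∑ l : Fin n,
        if k ≤ i ∧ j < l then (if i = j then 1 else 0) * (if k = l then (1 : ℤ) else 0) else 0) = 0 := by
    refine Finset.sum_eq_zero fun i _ => Finset.sum_eq_zero fun j _ => Finset.sum_eq_zero fun k _ =>
      Finset.sum_eq_zero fun l _ => ?_
    split_ifs with h h3 h4
    · subst h3 h4
      exact absurd h.1 h.2.not_ge
    all_goals simp
  -- The two cross terms weight the entry `(i, j)` by the positive and the negative part of `i - j`;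
  -- together they give `|i - j|`.
  have h3 : (∑ i, ∑ j, ∑ k, ∑ l, if k ≤ i ∧ j < l then A i j * (if k = l then 1 else 0) else 0) =
      ∑ i : Fin n, ∑ j : Fin n, ((((i : ℕ) : ℤ) - (j : ℕ)) ⊔ 0) * A i j := by
    refine Finset.sum_congr rfl fun i _ => Finset.sum_congr rfl fun j _ => ?_
    rw [← sum_ite_le_lt, Finset.sum_mul]
    refine Finset.sum_congr rfl fun k _ => ?_
    rw [Finset.sum_eq_single k (fun l _ hl => by simp [Ne.symm hl]) (by simp), if_pos rfl, mul_one]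
    split_ifs <;> simp
  have h4 : (∑ i, ∑ j, ∑ k, ∑ l, if k ≤ i ∧ j < l then (if i = j then 1 else 0) * A k l else 0) =
      ∑ k : Fin n, ∑ l : Fin n, ((((l : ℕ) : ℤ) - (k : ℕ)) ⊔ 0) * A k l := by
    have e : ∀ i : Fin n, (∑ j, ∑ k, ∑ l, if k ≤ i ∧ j < l then (if i = j then 1 else 0) * A k l else 0) =
        ∑ k, ∑ l, if k ≤ i ∧ i < l then A k l else 0 := by
      intro i
      rw [Finset.sum_eq_single i (fun j _ hj => by simp [Ne.symm hj]) (by simp)]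
      simp
    rw [Finset.sum_congr rfl fun i _ => e i, Finset.sum_comm]
    refine Finset.sum_congr rfl fun k _ => ?_
    rw [Finset.sum_comm]
    refine Finset.sum_congr rfl fun l _ => ?_
    rw [← sum_ite_le_lt', Finset.sum_mul]
    refine Finset.sum_congr rfl fun i _ => ?_
    split_ifs <;> simp
  rw [h1, h2, h3, h4, mul_zero, add_zero]
  congr 2
  unfold diagDist wsum
  simp only [← Finset.sum_add_distrib, ← add_mul]
  refine Finset.sum_congr rfl fun i _ => Finset.sum_congr rfl fun j _ => ?_
  congr 1
  rcases le_total ((i : ℕ) : ℤ) (j : ℕ) with h | h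
  · rw [max_eq_right (by omega), max_eq_left (by omega), abs_of_nonpos (by omega)]
    ring
  · rw [max_eq_left (by omega), max_eq_right (by omega), abs_of_nonneg (by omega)]
    ring

/-- The dimension `d` for which shifts by `p` of matrices with sum of entries `s` lie in `Θ_d`. -/
def shiftDim (n : ℕ) (s : ℤ) (p : ℕ) : ℕ := (s + p * n).toNat

theorem inTheta_shiftZ {s : ℤ} {A : Matrix (Fin n) (Fin n) ℤ} (hA : OffNonneg A)
    (hs : ∑ i, ∑ j, A i j = s) : ∀ᶠ p : ℕ in Filter.atTop, InTheta (shiftDim n s p) (shiftZ p A) := by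
  have h1 : ∀ i, ∀ᶠ p : ℕ in Filter.atTop, 0 ≤ A i i + p := fun i =>
    (Filter.eventually_ge_atTop (-A i i).toNat).mono fun p hp => by omega
  filter_upwards [Filter.eventually_all.2 h1] with p hp
  have h0 : ∀ i j, 0 ≤ shiftZ p A i j := by
    intro i j
    rw [shiftZ_apply]
    by_cases hij : i = j
    · subst hij
      simpa using hp i
    · simpa [hij] using hA i j hij
  have hsum : ∑ i, ∑ j, shiftZ p A i j = s + p * n := by
    simp only [shiftZ_apply, Finset.sum_add_distrib, hs]
    simp [mul_comm]
  refine ⟨h0, ?_⟩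
  unfold shiftDim
  rw [Int.toNat_of_nonneg, hsum]
  rw [← hsum]
  exact Finset.sum_nonneg fun i _ => Finset.sum_nonneg fun j _ => h0 i j

/-- Once `p ≥ -s`, the truncation in `shiftDim` does nothing because `p ≤ p n`. The sum of the
entries can then be compared, and off-diagonal entries are not affected by the shift. -/
theorem not_inTheta_shiftZ {s : ℤ} {A : Matrix (Fin n) (Fin n) ℤ} (hn : 1 ≤ n)
    (h : ¬ (OffNonneg A ∧ ∑ i, ∑ j, A i j = s)) :
    ∀ᶠ p : ℕ in Filter.atTop, ¬ InTheta (shiftDim n s p) (shiftZ p A) := by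
  filter_upwards [Filter.eventually_ge_atTop (-s).toNat] with p hp hin
  refine h ⟨fun i j hij => ?_, ?_⟩
  · have := hin.1 i j
    rw [shiftZ_apply] at this
    simpa [hij] using this
  · have h2 := hin.2
    unfold shiftDim at h2
    have hpn : (p : ℤ) ≤ p * n := by
      have : (1 : ℤ) ≤ n := by exact_mod_cast hn
      nlinarith [Int.natCast_nonneg p]
    rw [Int.toNat_of_nonneg (by omega)] at h2
    simp only [shiftZ_apply, Finset.sum_add_distrib] at h2
    simp [mul_comm] at h2
    linarith

end Shift

end QSchur

/-! ### Stabilization of products with a fixed left factor -/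

namespace QSchur

open Polynomial Filter

/-- Distinct monomials in two indeterminates are different, and the polynomial ring embeds in its
fraction field. This separates the exponentials in `p` later on. -/
theorem vK_pow_mul_tK_pow_injective {a b c d : ℕ} (h : vK ^ a * tK ^ b = vK ^ c * tK ^ d) :
    a = c ∧ b = d := by
  unfold vK tK at h
  rw [← map_pow, ← map_pow, ← map_pow, ← map_pow, ← map_mul, ← map_mul] at h
  have h1 := IsFractionRing.injective (MvPolynomial (Fin 2) ℚ) Qvt h
  rw [MvPolynomial.X_pow_eq_monomial, MvPolynomial.X_pow_eq_monomial,
    MvPolynomial.X_pow_eq_monomial, MvPolynomial.X_pow_eq_monomial, MvPolynomial.monomial_mul,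
    MvPolynomial.monomial_mul] at h1
  have h2 := MvPolynomial.monomial_left_injective (by simp) h1
  have h3 := DFunLike.congr_fun h2 0
  have h4 := DFunLike.congr_fun h2 1
  simpa using And.intro h3 h4

theorem vK_pow_ne_one {a : ℕ} (ha : a ≠ 0) : vK ^ a ≠ 1 := fun h =>
  ha (vK_pow_mul_tK_pow_injective (b := 0) (c := 0) (d := 0) (by simpa using h)).1

theorem vK_sq_ne_one : vK ^ 2 ≠ 1 := vK_pow_ne_one two_ne_zero

/-- The evaluation at `v' = v^{-p}`, `t' = t^p`. -/
noncomputable def evalAt (p : ℕ) : PolyR →+* Qvt := MvPolynomial.eval ![vK ^ (-(p : ℤ)), tK ^ p]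

theorem evalAt_C (p : ℕ) (x : Qvt) : evalAt p (MvPolynomial.C x) = x := MvPolynomial.eval_C _

theorem evalAt_X_zero (p : ℕ) : evalAt p (MvPolynomial.X 0) = vK ^ (-(p : ℤ)) := by
  simp [evalAt]

theorem evalAt_X_one (p : ℕ) : evalAt p (MvPolynomial.X 1) = tK ^ p := by
  simp [evalAt]

section

variable {n : ℕ}

/-- The coefficient of `{move A a b w}` in the product of `{elemMat (ro A) a b}` and `{A}`. -/
noncomputable def moveVal (A : Matrix (Fin n) (Fin n) ℤ) (a b w : Fin n) : Qvt :=
  scale (braceExpZ (elemMat (ro A) a b) + braceExpZ A - braceExpZ (move A a b w)) *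
    aeval (vK ^ 2) (moveCoeff A a b w)

theorem moveVal_eq (A : Matrix (Fin n) (Fin n) ℤ) (a b w : Fin n) :
    moveVal A a b w =
      scale (braceExpZ (elemMat (ro A) a b) + braceExpZ A - braceExpZ (move A a b w)) *
        (vK ^ (2 * (beyondSum A a b w).toNat) *
          ((vK ^ (2 * (A b w + 1).toNat) - 1) / (vK ^ 2 - 1))) := by
  unfold moveVal
  rw [moveCoeff_eq, map_mul, map_sum]
  simp only [map_pow, aeval_X]
  rw [geom_sum_eq vK_sq_ne_one, ← pow_mul, ← pow_mul]

theorem diagDist_elemMat (μ : Fin n → ℤ) {a b : Fin n} (hab : Adjacent a b) :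
    diagDist (elemMat μ a b) = 1 := by
  unfold diagDist elemMat
  rw [wsum_add, wsum_diagonal, wsum_single]
  unfold Adjacent at hab
  rcases hab with h | h
  · rw [← h]; simp
  · rw [← h]; simp

theorem braceExpZ_move_shiftZ (p : ℕ) (A : Matrix (Fin n) (Fin n) ℤ) {a b : Fin n}
    (hab : Adjacent a b) (w : Fin n) :
    braceExpZ (elemMat (ro (shiftZ p A)) a b) + braceExpZ (shiftZ p A) -
        braceExpZ (move (shiftZ p A) a b w) =
      (braceExpZ (elemMat (ro A) a b) + braceExpZ A - braceExpZ (move A a b w)) +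
        p * (1 + |(a : ℤ) - w| - |(b : ℤ) - w|) := by
  rw [← shiftZ_elemMat, ← shiftZ_move, braceExpZ_shiftZ, braceExpZ_shiftZ, braceExpZ_shiftZ,
    diagDist_elemMat _ hab]
  unfold diagDist
  rw [wsum_move]
  ring

/-- Moving a unit from row `a` to row `b` changes the distance to the diagonal by one. The
elementary factor contributes one more, so the sum is `2` if the move goes away from column `w` as
seen along the rows backwards from `b` to `a`, that is if `b` lies between `a` and `w` or equals
`w`, and `0` otherwise. -/
theorem dist_sub_dist {a b w : Fin n} (hab : Adjacent a b) :
    1 + |(a : ℤ) - w| - |(b : ℤ) - w| =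
      if w = b ∨ (b < a ∧ w < b) ∨ (a < b ∧ b < w) then 2 else 0 := by
  unfold Adjacent at hab
  simp only [Fin.ext_iff, Fin.lt_def]
  rcases abs_cases ((a : ℤ) - w) with h1 | h1 <;> rcases abs_cases ((b : ℤ) - w) with h2 | h2 <;>
    split_ifs <;> omega

theorem beyondSum_shiftZ (p : ℕ) (A : Matrix (Fin n) (Fin n) ℤ) (a b w : Fin n) :
    beyondSum (shiftZ p A) a b w =
      beyondSum A a b w + if (b < a ∧ w < b) ∨ (a < b ∧ b < w) then (p : ℤ) else 0 := by
  unfold beyondSum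
  have : (if (b < a ∧ w < b) ∨ (a < b ∧ b < w) then (p : ℤ) else 0) =
      ∑ l, if b = l then (if (b < a ∧ w < l) ∨ (a < b ∧ l < w) then (p : ℤ) else 0) else 0 := by
    simp
  rw [this, ← Finset.sum_add_distrib]
  refine Finset.sum_congr rfl fun l _ => ?_
  rw [shiftZ_apply]
  split_ifs <;> simp

/-- The terms on the far side of the diagonal and on the diagonal grow with the shift, the other
ones do not. -/
theorem moveVal_shiftZ_near {A : Matrix (Fin n) (Fin n) ℤ} {a b u : Fin n} (hab : Adjacent a b)
    (hub : u ≠ b) (hu : ¬ ((b < a ∧ u < b) ∨ (a < b ∧ b < u))) (p : ℕ) :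
    moveVal (shiftZ p A) a b u = moveVal A a b u := by
  rw [moveVal_eq, moveVal_eq, braceExpZ_move_shiftZ p A hab, dist_sub_dist hab, if_neg (by tauto),
    beyondSum_shiftZ, if_neg hu, shiftZ_apply, if_neg (Ne.symm hub)]
  simp

theorem moveVal_ne_zero {A : Matrix (Fin n) (Fin n) ℤ} {a b u : Fin n} (h : 0 ≤ A b u) :
    moveVal A a b u ≠ 0 := by
  rw [moveVal_eq]
  refine mul_ne_zero (scale_ne_zero _) (mul_ne_zero (pow_ne_zero _ vK_ne_zero) (div_ne_zero ?_
    (sub_ne_zero.2 vK_sq_ne_one)))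
  refine sub_ne_zero.2 (vK_pow_ne_one ?_)
  omega

theorem scale_two_mul (p : ℕ) : scale (p * 2) * vK ^ (2 * p) = (tK ^ p) ^ 2 := by
  unfold scale
  have h : vK ^ (-((p : ℤ) * 2)) * vK ^ (2 * p) = 1 := by
    rw [← zpow_natCast vK, ← zpow_add₀ vK_ne_zero]
    convert zpow_zero vK using 2
    push_cast
    ring
  have h2 : tK ^ ((p : ℤ) * 2) = (tK ^ p) ^ 2 := by
    rw [zpow_mul, zpow_natCast]
    rfl
  rw [h2]
  linear_combination (tK ^ p) ^ 2 * h

theorem scale_two_mul' (p : ℕ) : scale (p * 2) = (vK ^ (-(p : ℤ))) ^ 2 * (tK ^ p) ^ 2 := by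
  unfold scale
  rw [zpow_mul tK, zpow_natCast, ← neg_mul, zpow_mul vK]
  rfl

/-- Only two sources of `p` occur: the normalization gives `v^{-2p} t^{2p}` or nothing, and the
shifted diagonal entry of row `b` enters either the `q`-integer or the power of `q`. In each case
the growing factor `v^{2p}` is absorbed by the normalization. -/
theorem moveVal_shiftZ {A : Matrix (Fin n) (Fin n) ℤ} {a b : Fin n} (hab : Adjacent a b)
    (w : Fin n) : ∃ H : PolyR, ∀ᶠ p in atTop, moveVal (shiftZ p A) a b w = evalAt p H := by
  set e := braceExpZ (elemMat (ro A) a b) + braceExpZ A - braceExpZ (move A a b w)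
  by_cases hwb : w = b
  · subst hwb
    -- The unit lands on the diagonal, so the `q`-integer grows: its numerator `v^{2(A w w + 1 + p)}
    -- - 1` times `v^{-2p} t^{2p}` equals `v^{2(A w w + 1)} t'² - v'² t'²`.
    refine ⟨MvPolynomial.C (scale e * vK ^ (2 * (beyondSum A a w w).toNat) / (vK ^ 2 - 1)) *
      (MvPolynomial.C (vK ^ (2 * (A w w + 1))) * MvPolynomial.X 1 ^ 2 -
        MvPolynomial.X 0 ^ 2 * MvPolynomial.X 1 ^ 2), ?_⟩
    filter_upwards [eventually_ge_atTop (-(A w w)).toNat] with p hp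
    rw [moveVal_eq, braceExpZ_move_shiftZ p A hab, dist_sub_dist hab, if_pos (Or.inl rfl),
      beyondSum_shiftZ, if_neg (by simp), add_zero, scale_add, shiftZ_apply, if_pos rfl]
    simp only [map_mul, map_sub, map_pow, evalAt_C, evalAt_X_zero, evalAt_X_one]
    have h1 : vK ^ (2 * (A w w + p + 1).toNat) = vK ^ (2 * (A w w + 1)) * vK ^ (2 * p) := by
      rw [← zpow_natCast, ← zpow_natCast vK (2 * p), ← zpow_add₀ vK_ne_zero]
      congr 1
      push_cast
      rw [Int.toNat_of_nonneg (by omega)]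
      ring
    rw [h1]
    linear_combination (scale e * vK ^ (2 * (beyondSum A a w w).toNat) / (vK ^ 2 - 1)) *
      (vK ^ (2 * (A w w + 1)) * scale_two_mul p - scale_two_mul' p)
  · by_cases hbe : (b < a ∧ w < b) ∨ (a < b ∧ b < w)
    -- Here the shifted diagonal entry lies in the part of row `b` that fixes the power of `q`; its
    -- `v^{2p}` cancels the normalization and `t'²` remains. The exponent of `v` is an integer
    -- power, since `beyondSum` contains a diagonal entry and may be negative before the shift.
    · refine ⟨MvPolynomial.C (scale e * vK ^ (2 * (beyondSum A a b w)) *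
        ((vK ^ (2 * (A b w + 1).toNat) - 1) / (vK ^ 2 - 1))) * MvPolynomial.X 1 ^ 2, ?_⟩
      filter_upwards [eventually_ge_atTop (-(beyondSum A a b w)).toNat] with p hp
      rw [moveVal_eq, braceExpZ_move_shiftZ p A hab, dist_sub_dist hab, if_pos (Or.inr hbe),
        beyondSum_shiftZ, if_pos hbe, scale_add, shiftZ_apply, if_neg (Ne.symm hwb), add_zero]
      simp only [map_mul, map_pow, evalAt_C, evalAt_X_one]
      have h1 : vK ^ (2 * (beyondSum A a b w + p).toNat) =
          vK ^ (2 * (beyondSum A a b w)) * vK ^ (2 * p) := by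
        rw [← zpow_natCast, ← zpow_natCast vK (2 * p), ← zpow_add₀ vK_ne_zero]
        congr 1
        push_cast
        rw [Int.toNat_of_nonneg (by omega)]
        ring
      rw [h1]
      linear_combination (scale e * vK ^ (2 * (beyondSum A a b w)) *
        ((vK ^ (2 * (A b w + 1).toNat) - 1) / (vK ^ 2 - 1))) * scale_two_mul p
    · refine ⟨MvPolynomial.C (moveVal A a b w), Eventually.of_forall fun p => ?_⟩
      rw [moveVal_shiftZ_near hab hwb hbe, evalAt_C]

/-- The element `∑_Z G_Z(v, v^{-p}, t, t^p) {ₚZ}` of `𝒮_d`. -/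
noncomputable def specialize (s : ℤ) (p : ℕ) :
    (ThetaTilde n →₀ PolyR) →+ (Theta n (shiftDim n s p) → Qvt) :=
  Finsupp.liftAddHom fun Z => (LinearMap.toSpanSingleton Qvt _
    (braceQ (shiftDim n s p) (shiftZ p Z.1))).toAddMonoidHom.comp (evalAt p).toAddMonoidHom

theorem specialize_single (s : ℤ) (p : ℕ) (Z : ThetaTilde n) (g : PolyR) :
    specialize s p (Finsupp.single Z g) =
      evalAt p g • braceQ (shiftDim n s p) (shiftZ p Z.1) := by
  unfold specialize
  rw [Finsupp.liftAddHom_apply_single]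
  rfl

theorem specialize_smul (s : ℤ) (p : ℕ) (c : PolyR) (G : ThetaTilde n →₀ PolyR) :
    specialize s p (c • G) = evalAt p c • specialize s p G := by
  induction G using Finsupp.induction_linear with
  | zero => simp
  | add f g hf hg => rw [smul_add, map_add, map_add, hf, hg, smul_add]
  | single Z g => rw [Finsupp.smul_single, specialize_single, specialize_single, smul_eq_mul, map_mul,
      mul_smul]

/-- An element of `Θ̃`, from an integer matrix. -/
def OffNonneg.toTilde {A : Matrix (Fin n) (Fin n) ℤ} (h : OffNonneg A) : ThetaTilde n := ⟨A, h⟩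

/-- The products of `{ₚA}` with the `{ₚY}` stabilize. -/
def LeftStable (s : ℤ) (A : Matrix (Fin n) (Fin n) ℤ) : Prop :=
  ∀ Y, OffNonneg Y → ∃ G : ThetaTilde n →₀ PolyR, ∀ᶠ p in atTop,
    convQ n _ (braceQ (shiftDim n s p) (shiftZ p A)) (braceQ (shiftDim n s p) (shiftZ p Y)) =
      specialize s p G

theorem leftStable_of_eventually_eq_zero {s : ℤ} {A : Matrix (Fin n) (Fin n) ℤ}
    (h : ∀ᶠ p in atTop, braceQ (shiftDim n s p) (shiftZ p A) = 0) : LeftStable s A := by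
  intro Y _
  refine ⟨0, h.mono fun p hp => ?_⟩
  rw [hp, map_zero, map_zero, LinearMap.zero_apply]

theorem LeftStable.convQ_specialize {s : ℤ} {A : Matrix (Fin n) (Fin n) ℤ} (h : LeftStable s A)
    (G : ThetaTilde n →₀ PolyR) : ∃ G' : ThetaTilde n →₀ PolyR, ∀ᶠ p in atTop,
      convQ n _ (braceQ (shiftDim n s p) (shiftZ p A)) (specialize s p G) = specialize s p G' := by
  induction G using Finsupp.induction_linear with
  | zero => exact ⟨0, Eventually.of_forall fun p => by simp⟩
  | add f g hf hg =>
    obtain ⟨f', hf⟩ := hf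
    obtain ⟨g', hg⟩ := hg
    refine ⟨f' + g', ?_⟩
    filter_upwards [hf, hg] with p h1 h2
    rw [map_add, map_add, h1, h2, map_add]
  | single Z g =>
    obtain ⟨G, hG⟩ := h Z.1 Z.2
    refine ⟨g • G, hG.mono fun p hp => ?_⟩
    rw [specialize_single, map_smul, hp, specialize_smul]

theorem braceQ_shiftZ_eventually_eq_zero {s : ℤ} {A : Matrix (Fin n) (Fin n) ℤ} (hn : 1 ≤ n)
    (h : ¬ (OffNonneg A ∧ ∑ i, ∑ j, A i j = s)) :
    ∀ᶠ p in atTop, braceQ (shiftDim n s p) (shiftZ p A) = 0 :=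
  (not_inTheta_shiftZ hn h).mono fun _ hp => braceQ_of_not_inTheta hp

theorem co_shiftZ_ne {A Y : Matrix (Fin n) (Fin n) ℤ} (h : co A ≠ ro Y) (p : ℕ) :
    co (shiftZ p A) ≠ ro (shiftZ p Y) := by
  intro h1
  refine h (funext fun i => ?_)
  have := congrFun h1 i
  rw [co_shiftZ, ro_shiftZ] at this
  linarith

theorem offNonneg_elemMat (μ : Fin n → ℤ) (a b : Fin n) : OffNonneg (elemMat μ a b) := by
  intro i j hij
  unfold elemMat
  rw [Matrix.add_apply, Matrix.diagonal_apply_ne _ hij, Matrix.single_apply]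
  split_ifs <;> simp

theorem sum_elemMat (A : Matrix (Fin n) (Fin n) ℤ) (a b : Fin n) :
    ∑ i, ∑ j, elemMat (ro A) a b i j = ∑ i, ∑ j, A i j := by
  refine (Finset.sum_comm (f := fun i j => elemMat (ro A) a b i j)).trans ?_
  exact Finset.sum_congr rfl fun i _ => congrFun (co_elemMat (ro A) a b) i

theorem sum_move (A : Matrix (Fin n) (Fin n) ℤ) (a b w : Fin n) :
    ∑ i, ∑ j, move A a b w i j = ∑ i, ∑ j, A i j := by
  have := wsum_move (fun _ _ => 1) A a b w
  unfold wsum at this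
  simpa using this

theorem convQ_elemMat_shiftZ {s : ℤ} {A : Matrix (Fin n) (Fin n) ℤ} (hA : OffNonneg A)
    (hs : ∑ i, ∑ j, A i j = s) {a b : Fin n} (hab : Adjacent a b) : ∀ᶠ p in atTop,
    convQ n _ (braceQ (shiftDim n s p) (shiftZ p (elemMat (ro A) a b)))
      (braceQ (shiftDim n s p) (shiftZ p A)) =
      ∑ w, moveVal (shiftZ p A) a b w • braceQ (shiftDim n s p) (shiftZ p (move A a b w)) := by
  filter_upwards [inTheta_shiftZ hA hs,
    inTheta_shiftZ (offNonneg_elemMat (ro A) a b) ((sum_elemMat A a b).trans hs)] with p h1 h2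
  rw [shiftZ_elemMat] at h2 ⊢
  rw [convQ_braceQ_elemMat hab h1 h2]
  simp only [shiftZ_move]
  rfl

theorem leftStable_elemMat (hn : 1 ≤ n) (s : ℤ) (μ : Fin n → ℤ) {a b : Fin n}
    (hab : Adjacent a b) : LeftStable s (elemMat μ a b) := by
  classical
  intro Y hY
  by_cases hμ : μ = ro Y
  swap
  · refine ⟨0, Eventually.of_forall fun p => ?_⟩
    rw [convQ_braceQ_eq_zero (co_shiftZ_ne (by rwa [co_elemMat]) p), map_zero]
  subst hμ
  by_cases hs : ∑ i, ∑ j, Y i j = s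
  swap
  · refine ⟨0, (braceQ_shiftZ_eventually_eq_zero hn fun h => hs h.2).mono fun p hp => ?_⟩
    rw [hp, map_zero, map_zero]
  choose H hH using fun w => moveVal_shiftZ (A := Y) hab w
  refine ⟨∑ w, if h : OffNonneg (move Y a b w) then Finsupp.single h.toTilde (H w) else 0, ?_⟩
  have hz : ∀ w, ∀ᶠ p in atTop, ¬ OffNonneg (move Y a b w) →
      braceQ (shiftDim n s p) (shiftZ p (move Y a b w)) = 0 := by
    intro w
    by_cases h : OffNonneg (move Y a b w)
    · exact Eventually.of_forall fun p h' => absurd h h'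
    · exact (braceQ_shiftZ_eventually_eq_zero hn fun h' => h h'.1).mono fun p hp _ => hp
  filter_upwards [convQ_elemMat_shiftZ hY hs hab, eventually_all.2 hH, eventually_all.2 hz]
    with p h1 h2 h3
  rw [h1, map_sum]
  refine Finset.sum_congr rfl fun w _ => ?_
  by_cases h : OffNonneg (move Y a b w)
  · rw [dif_pos h, specialize_single, h2]
    rfl
  · rw [dif_neg h, h3 w h, smul_zero, map_zero]

theorem leftStable_diagonal (s : ℤ) (μ : Fin n → ℤ) : LeftStable s (Matrix.diagonal μ) := by
  intro Y hY
  by_cases hμ : μ = ro Y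
  · subst hμ
    refine ⟨Finsupp.single hY.toTilde 1, Eventually.of_forall fun p => ?_⟩
    rw [shiftZ_diagonal_ro, convQ_braceQ_diagonal, specialize_single, map_one, one_smul]
    rfl
  · refine ⟨0, Eventually.of_forall fun p => ?_⟩
    rw [convQ_braceQ_eq_zero (co_shiftZ_ne (by rwa [co_diagonal]) p), map_zero]

/-- The induction on `spread` that gave the structure polynomials, now for all large shifts at once.
It closes because the coefficient of the leading term does not involve `p`: the unit `u` from
`exists_move` lies neither on the diagonal nor on its far side. -/
theorem leftStable (hn : 1 ≤ n) (s : ℤ) (A : Matrix (Fin n) (Fin n) ℤ) : LeftStable s A := by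
  by_cases hA : OffNonneg A ∧ ∑ i, ∑ j, A i j = s
  swap
  · exact leftStable_of_eventually_eq_zero (braceQ_shiftZ_eventually_eq_zero hn hA)
  obtain ⟨hA, hs⟩ := hA
  obtain ⟨k, hk⟩ : ∃ k : ℕ, spread A = k := Int.eq_ofNat_of_zero_le (spread_nonneg hA)
  induction k using Nat.strong_induction_on generalizing A with
  | _ k ih =>
  by_cases hdiag : ∃ i j, i ≠ j ∧ A i j ≠ 0
  swap
  · push Not at hdiag
    have hA' : A = Matrix.diagonal fun i => A i i := by
      ext i j
      by_cases hij : i = j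
      · subst hij; simp
      · rw [Matrix.diagonal_apply_ne _ hij, hdiag i j hij]
    rw [hA']
    exact leftStable_diagonal s _
  obtain ⟨a, b, u, hab, hub, hbe, h0, hlt, hw⟩ := exists_move hA hdiag
  set A' := move A b a u with hA'
  have hA'A : move A' a b u = A := move_move A a b u
  have hoff : OffNonneg A' := offNonneg_move hA h0
  have hs' : ∑ i, ∑ j, A' i j = s := (sum_move A b a u).trans hs
  have hlead : 0 ≤ A' b u := by
    rw [hA', move_apply]
    simp [hab.ne]
    omega
  -- A term with a negative off-diagonal entry keeps it under every shift, so its basis element is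
  -- eventually zero and needs no induction hypothesis.
  have key : ∀ B : Matrix (Fin n) (Fin n) ℤ, (OffNonneg B → spread B < spread A) →
      LeftStable s B := by
    intro B hB
    by_cases hBt : OffNonneg B ∧ ∑ i, ∑ j, B i j = s
    · have h1 := spread_nonneg hBt.1
      have h2 := hB hBt.1
      exact ih (spread B).toNat (by omega) B hBt.1 hBt.2 (by omega)
    · exact leftStable_of_eventually_eq_zero (braceQ_shiftZ_eventually_eq_zero hn hBt)
  intro Y hY
  obtain ⟨G₀, hG₀⟩ := key A' (fun _ => hlt) Y hY
  obtain ⟨G₁, hG₁⟩ := (leftStable_elemMat hn s (ro A') hab).convQ_specialize G₀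
  have hterm : ∀ w, ∃ G : ThetaTilde n →₀ PolyR, ∀ᶠ p in atTop, w ≠ u →
      moveVal (shiftZ p A') a b w • convQ n _ (braceQ (shiftDim n s p) (shiftZ p (move A' a b w)))
        (braceQ (shiftDim n s p) (shiftZ p Y)) = specialize s p G := by
    intro w
    by_cases hwu : w = u
    · exact ⟨0, Eventually.of_forall fun p h => absurd hwu h⟩
    obtain ⟨H, hH⟩ := moveVal_shiftZ (A := A') hab w
    obtain ⟨G, hG⟩ := key _ (hw w hwu) Y hY
    refine ⟨H • G, ?_⟩
    filter_upwards [hH, hG] with p h1 h2 _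
    rw [h1, h2, specialize_smul]
  choose Gw hGw using hterm
  -- The elementary product is solved for its term `w = u`. The inverted coefficient is a nonzero
  -- constant of `ℚ(v, t)`, hence a unit of the polynomial ring; `G₁` stands for the elementary
  -- factor times `{A'}{Y}`.
  refine ⟨(MvPolynomial.C (moveVal A' a b u)⁻¹ : PolyR) • (G₁ +
    (MvPolynomial.C (-1) : PolyR) • ∑ w ∈ Finset.univ.erase u, Gw w), ?_⟩
  filter_upwards [hG₀, hG₁, eventually_all.2 hGw, convQ_elemMat_shiftZ hoff hs' hab]
    with p h1 h2 h3 h4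
  rw [specialize_smul, evalAt_C, map_add, specialize_smul, evalAt_C, neg_one_smul, ← sub_eq_add_neg,
    map_sum, eq_inv_smul_iff₀ (moveVal_ne_zero hlead),
    ← h2, ← h1, ← convQ_assoc, h4, ← Finset.add_sum_erase _ _ (Finset.mem_univ u), hA'A,
    moveVal_shiftZ_near hab hub hbe, map_add, LinearMap.add_apply, map_smul, LinearMap.smul_apply,
    map_sum, LinearMap.sum_apply, eq_sub_iff_add_eq]
  congr 1
  refine Finset.sum_congr rfl fun w hw' => ?_
  rw [← h3 w (Finset.ne_of_mem_erase hw'), map_smul, LinearMap.smul_apply]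

end

end QSchur

namespace QSchur

open Filter

/-! Polynomials in `v'`, `t'` as functions of the shift. -/

/-- The value of a monomial at `v' = v^{-1}`, `t' = t`. -/
noncomputable def monoVal (m : Fin 2 →₀ ℕ) : Qvt := vK ^ (-(m 0 : ℤ)) * tK ^ (m 1 : ℤ)

theorem monoVal_ne_zero (m : Fin 2 →₀ ℕ) : monoVal m ≠ 0 :=
  mul_ne_zero (zpow_ne_zero _ vK_ne_zero) (zpow_ne_zero _ tK_ne_zero)

theorem monoVal_injective : Function.Injective monoVal := by
  intro m m' h
  unfold monoVal at h
  have h1 : vK ^ m' 0 * tK ^ m 1 = vK ^ m 0 * tK ^ m' 1 := by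
    rw [zpow_neg, zpow_neg, zpow_natCast, zpow_natCast, zpow_natCast, zpow_natCast] at h
    have hv := pow_ne_zero (m 0) vK_ne_zero
    have hv' := pow_ne_zero (m' 0) vK_ne_zero
    field_simp at h
    linear_combination h
  obtain ⟨h2, h3⟩ := vK_pow_mul_tK_pow_injective h1
  ext i
  fin_cases i
  · exact h2.symm
  · exact h3

theorem evalAt_eq_sum (p : ℕ) (G : PolyR) :
    evalAt p G = ∑ m ∈ G.support, G.coeff m * monoVal m ^ p := by
  unfold evalAt
  rw [MvPolynomial.eval_eq']
  refine Finset.sum_congr rfl fun m _ => ?_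
  congr 1
  rw [Fin.prod_univ_two]
  unfold monoVal
  simp only [Matrix.cons_val_zero, Matrix.cons_val_one]
  rw [mul_pow, ← zpow_natCast, ← zpow_mul, ← zpow_natCast (vK ^ _), ← zpow_mul, zpow_natCast, ← pow_mul,
    ← pow_mul]
  congr 2
  · ring
  · ring

/-- As a function of `p`, the value of `G` is a combination of the exponentials `monoVal m ^ p`. A
polynomial `P` in the shift operator multiplies each exponential by the value of `P` at its base. -/
theorem sum_coeff_mul_evalAt (P : Polynomial Qvt) (p : ℕ) (G : PolyR) {N : ℕ}
    (hN : P.natDegree < N) :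
    ∑ k ∈ Finset.range N, P.coeff k * evalAt (p + k) G =
      ∑ m ∈ G.support, G.coeff m * monoVal m ^ p * P.eval (monoVal m) := by
  simp only [evalAt_eq_sum, Finset.mul_sum]
  rw [Finset.sum_comm]
  refine Finset.sum_congr rfl fun m _ => ?_
  rw [Polynomial.eval_eq_sum_range' hN, Finset.mul_sum]
  refine Finset.sum_congr rfl fun k _ => ?_
  rw [pow_add]
  ring

theorem eq_zero_of_eventually_evalAt_eq_zero {G : PolyR} (h : ∀ᶠ p in atTop, evalAt p G = 0) :
    G = 0 := by
  obtain ⟨p₀, hp⟩ := eventually_atTop.1 h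
  by_contra hG
  obtain ⟨m, hm⟩ := MvPolynomial.support_nonempty.2 hG
  -- This recurrence operator kills every exponential except the one of `m`, whose coefficient would
  -- then have to vanish.
  set P : Polynomial Qvt := ∏ m' ∈ G.support.erase m, (Polynomial.X - Polynomial.C (monoVal m')) with hP
  have h1 := sum_coeff_mul_evalAt P p₀ G (Nat.lt_succ_self _)
  rw [Finset.sum_eq_zero fun k _ => by rw [hp _ (Nat.le_add_right _ _), mul_zero],
    Finset.sum_eq_single m] at h1
  · have h2 : P.eval (monoVal m) ≠ 0 := by
      rw [hP, Polynomial.eval_prod]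
      refine Finset.prod_ne_zero_iff.2 fun m' hm' => ?_
      rw [Polynomial.eval_sub, Polynomial.eval_X, Polynomial.eval_C, sub_ne_zero]
      exact fun he => Finset.ne_of_mem_erase hm' (monoVal_injective he).symm
    exact mul_ne_zero (mul_ne_zero (MvPolynomial.mem_support_iff.1 hm)
      (pow_ne_zero _ (monoVal_ne_zero m))) h2 h1.symm
  · intro m' hm' hne
    have : P.eval (monoVal m') = 0 := by
      rw [hP, Polynomial.eval_prod]
      exact Finset.prod_eq_zero (Finset.mem_erase.2 ⟨hne, hm'⟩) (by simp)
    rw [this, mul_zero]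
  · exact fun h => absurd hm h

theorem eq_of_eventually_evalAt_eq {G G' : PolyR} (h : ∀ᶠ p in atTop, evalAt p G = evalAt p G') :
    G = G' := by
  rw [← sub_eq_zero]
  refine eq_zero_of_eventually_evalAt_eq_zero (h.mono fun p hp => ?_)
  rw [map_sub, hp, sub_self]

theorem vK_zpow_mem (z : ℤ) : vK ^ z ∈ LaurentA := by
  rcases z with k | k
  · exact (zpow_natCast vK k) ▸ pow_mem vA.val.2 k
  · rw [zpow_negSucc, ← inv_pow]
    exact pow_mem vA.inv.2 _

theorem tK_zpow_mem (z : ℤ) : tK ^ z ∈ LaurentA := by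
  rcases z with k | k
  · exact (zpow_natCast tK k) ▸ pow_mem tA.val.2 k
  · rw [zpow_negSucc, ← inv_pow]
    exact pow_mem tA.inv.2 _

theorem scale_mem (e : ℤ) : scale e ∈ LaurentA := mul_mem (vK_zpow_mem _) (tK_zpow_mem _)

theorem monoVal_mem (m : Fin 2 →₀ ℕ) : monoVal m ∈ LaurentA := mul_mem (vK_zpow_mem _) (tK_zpow_mem _)

theorem inv_monoVal_mem (m : Fin 2 →₀ ℕ) : (monoVal m)⁻¹ ∈ LaurentA := by
  unfold monoVal
  rw [mul_inv, ← zpow_neg, ← zpow_neg]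
  exact mul_mem (vK_zpow_mem _) (tK_zpow_mem _)

/-- The operator with roots at all the bases annihilates the sequence of values. Its coefficients
lie in `𝒜`, and its constant term is up to sign a product of monomials in `v` and `t`, a unit of
`𝒜`; so the recurrence can be solved for the earliest value. -/
theorem evalAt_mem_of_succ {G : PolyR} {p : ℕ} (h : ∀ k, evalAt (p + 1 + k) G ∈ LaurentA) :
    evalAt p G ∈ LaurentA := by
  set P' : Polynomial LaurentA :=
    ∏ m ∈ G.support, (Polynomial.X - Polynomial.C ⟨monoVal m, monoVal_mem m⟩) with hP'
  set P : Polynomial Qvt := ∏ m ∈ G.support, (Polynomial.X - Polynomial.C (monoVal m)) with hP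
  have hPP : P'.map (LaurentA.val : LaurentA →+* Qvt) = P := by
    rw [hP', hP, Polynomial.map_prod]
    refine Finset.prod_congr rfl fun m _ => ?_
    rw [Polynomial.map_sub, Polynomial.map_X, Polynomial.map_C]
    rfl
  have hcoeff : ∀ k, P.coeff k ∈ LaurentA := by
    intro k
    rw [← hPP, Polynomial.coeff_map]
    exact (P'.coeff k).2
  have h1 := sum_coeff_mul_evalAt P p G (Nat.lt_succ_self _)
  rw [Finset.sum_range_succ', Finset.sum_eq_zero (s := G.support), add_zero] at h1
  swap
  · intro m hm
    have : P.eval (monoVal m) = 0 := by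
      rw [hP, Polynomial.eval_prod]
      exact Finset.prod_eq_zero hm (by simp)
    rw [this, mul_zero]
  have h0 : P.coeff 0 = ∏ m ∈ G.support, -monoVal m := by
    rw [Polynomial.coeff_zero_eq_eval_zero, hP, Polynomial.eval_prod]
    simp
  have hne : P.coeff 0 ≠ 0 := by
    rw [h0]
    exact Finset.prod_ne_zero_iff.2 fun m _ => neg_ne_zero.2 (monoVal_ne_zero m)
  have hinv : (P.coeff 0)⁻¹ ∈ LaurentA := by
    rw [h0, ← Finset.prod_inv_distrib]
    refine prod_mem fun m _ => ?_
    rw [inv_neg]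
    exact neg_mem (inv_monoVal_mem m)
  have h2 : evalAt p G = (P.coeff 0)⁻¹ *
      -∑ k ∈ Finset.range P.natDegree, P.coeff (k + 1) * evalAt (p + (k + 1)) G := by
    rw [eq_inv_mul_iff_mul_eq₀ hne]
    linear_combination h1
  rw [h2]
  refine mul_mem hinv (neg_mem (sum_mem fun k _ => mul_mem (hcoeff _) ?_))
  have := h k
  rwa [add_assoc, add_comm 1 k] at this

/-- The specialization `v' = t' = 1` is the member `p = 0` of the sequence of values. -/
theorem evalAt_zero (G : PolyR) : evalAt 0 G = evalR 1 1 G := by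
  unfold evalAt evalR
  simp

/-- If the values of `G` lie in `𝒜` for large `p`, then so does the value at `v' = t' = 1`. -/
theorem evalR_one_mem {G : PolyR} (h : ∀ᶠ p in atTop, evalAt p G ∈ LaurentA) :
    evalR 1 1 G ∈ LaurentA := by
  obtain ⟨p₀, hp⟩ := eventually_atTop.1 h
  rw [← evalAt_zero]
  -- Downward induction from `p₀`, with `k` bounding how far `p` is below it.
  have key : ∀ k, ∀ p, p₀ ≤ p + k → evalAt p G ∈ LaurentA := by
    intro k
    induction k with
    | zero => exact fun p h => hp p h
    | succ k ih => exact fun p h => evalAt_mem_of_succ fun j => ih _ (by omega)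
  exact key p₀ 0 (by omega)

/-! Products with given structure constants. -/

section StructMul

variable {ι R S : Type} [CommRing R] [CommRing S]

/-- The bilinear product with the structure constants `g`. -/
noncomputable def structMul (g : ι → ι → ι →₀ R) : (ι →₀ R) →ₗ[R] (ι →₀ R) →ₗ[R] (ι →₀ R) :=
  Finsupp.linearCombination R fun A => Finsupp.linearCombination R (g A)

theorem structMul_single (g : ι → ι → ι →₀ R) (A B : ι) (x y : R) :
    structMul g (Finsupp.single A x) (Finsupp.single B y) = x • y • g A B := by
  unfold structMul
  rw [Finsupp.linearCombination_single, LinearMap.smul_apply, Finsupp.linearCombination_single]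

theorem structMul_assoc {g : ι → ι → ι →₀ R}
    (h : ∀ A B C, structMul g (g A B) (Finsupp.single C 1) =
      structMul g (Finsupp.single A 1) (g B C)) (x y z : ι →₀ R) :
    structMul g (structMul g x y) z = structMul g x (structMul g y z) := by
  induction x using Finsupp.induction_linear with
  | zero => simp
  | add x x' hx hx' => simp only [map_add, LinearMap.add_apply, hx, hx']
  | single A a =>
    induction y using Finsupp.induction_linear with
    | zero => simp
    | add y y' hy hy' => simp only [map_add, LinearMap.add_apply, hy, hy']
    | single B b =>
      induction z using Finsupp.induction_linear with
      | zero => simp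
      | add z z' hz hz' => simp only [map_add, hz, hz']
      | single C c =>
        have h1 := h A B C
        rw [structMul_single, structMul_single, map_smul, map_smul, LinearMap.smul_apply,
          LinearMap.smul_apply, map_smul, map_smul]
        rw [← mul_one c, ← smul_eq_mul, ← Finsupp.smul_single, map_smul, h1,
          ← mul_one a, ← smul_eq_mul a, ← Finsupp.smul_single, map_smul, LinearMap.smul_apply]
        simp only [smul_smul, smul_eq_mul, mul_one]
        congr 1
        ring

/-- Application of a ring homomorphism to the coefficients. -/
noncomputable def mapCoeff (φ : R →+* S) : (ι →₀ R) →+ (ι →₀ S) :=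
  Finsupp.mapRange.addMonoidHom φ.toAddMonoidHom

theorem mapCoeff_apply (φ : R →+* S) (x : ι →₀ R) (Z : ι) : mapCoeff φ x Z = φ (x Z) := rfl

theorem mapCoeff_single (φ : R →+* S) (Z : ι) (r : R) :
    mapCoeff φ (Finsupp.single Z r) = Finsupp.single Z (φ r) := by
  ext Z'
  rw [mapCoeff_apply]
  by_cases h : Z = Z'
  · subst h; simp
  · simp [Finsupp.single_eq_of_ne' h]

theorem mapCoeff_smul (φ : R →+* S) (r : R) (x : ι →₀ R) :
    mapCoeff φ (r • x) = φ r • mapCoeff φ x := by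
  ext Z
  simp [mapCoeff_apply]

theorem mapCoeff_injective {φ : R →+* S} (h : Function.Injective φ) :
    Function.Injective (mapCoeff (ι := ι) φ) := by
  intro x y hxy
  ext Z
  exact h (DFunLike.congr_fun hxy Z)

theorem mapCoeff_structMul (φ : R →+* S) (g : ι → ι → ι →₀ R) (x y : ι →₀ R) :
    mapCoeff φ (structMul g x y) =
      structMul (fun A B => mapCoeff φ (g A B)) (mapCoeff φ x) (mapCoeff φ y) := by
  induction x using Finsupp.induction_linear with
  | zero => simp
  | add x x' hx hx' => simp only [map_add, LinearMap.add_apply, hx, hx']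
  | single A a =>
    induction y using Finsupp.induction_linear with
    | zero => simp
    | add y y' hy hy' => simp only [map_add, hy, hy']
    | single B b => simp only [structMul_single, mapCoeff_single, mapCoeff_smul]

theorem map_chainProd {M N : Type} [Zero M] [Zero N] {mul : M → M → M} {mul' : N → N → N}
    (f : M → N) (h0 : f 0 = 0) (h : ∀ x y, f (mul x y) = mul' (f x) (f y)) (l : List M) :
    f (chainProd mul l) = chainProd mul' (l.map f) := by
  cases l with
  | nil => exact h0
  | cons x l =>
    change f (l.foldl mul x) = (l.map f).foldl mul' (f x)
    induction l generalizing x with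
    | nil => rfl
    | cons y l ih => rw [List.foldl_cons, ih, List.map_cons, List.foldl_cons, h]

end StructMul

end QSchur

/-! ### The stable algebra and its specialization at `v' = t' = 1` -/

namespace QSchur

open Filter

section

variable {n : ℕ}

/-- The sum of the entries. -/
def tot (A : Matrix (Fin n) (Fin n) ℤ) : ℤ := ∑ i, ∑ j, A i j

theorem tot_eq_of_co_eq_ro {A B : Matrix (Fin n) (Fin n) ℤ} (h : co A = ro B) : tot A = tot B := by
  unfold tot
  refine (Finset.sum_comm (f := fun i j => A i j)).trans ?_
  exact Finset.sum_congr rfl fun i _ => congrFun h i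

theorem shiftZ_injective (p : ℕ) : Function.Injective (shiftZ (n := n) p) :=
  fun _ _ h => add_right_cancel h

theorem specialize_eventually_eq_zero (hn : 1 ≤ n) {s : ℤ} {G : ThetaTilde n →₀ PolyR}
    (h : ∀ Z, tot Z.1 = s → G Z = 0) : ∀ᶠ p in atTop, specialize s p G = 0 := by
  have h1 : ∀ Z ∈ G.support, ∀ᶠ p in atTop, braceQ (shiftDim n s p) (shiftZ p Z.1) = 0 :=
    fun Z hZ => braceQ_shiftZ_eventually_eq_zero hn fun h2 => Finsupp.mem_support_iff.1 hZ (h Z h2.2)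
  filter_upwards [(eventually_all_finset G.support).2 h1] with p hp
  conv_lhs => rw [← Finsupp.sum_single G, Finsupp.sum, map_sum]
  refine Finset.sum_eq_zero fun Z hZ => ?_
  rw [specialize_single, hp Z hZ, smul_zero]

open Classical in
theorem specialize_filter (hn : 1 ≤ n) (s : ℤ) (G : ThetaTilde n →₀ PolyR) : ∀ᶠ p in atTop,
    specialize s p (G.filter fun Z => tot Z.1 = s) = specialize s p G := by
  have h := specialize_eventually_eq_zero hn (s := s) (G := G.filter fun Z => ¬ tot Z.1 = s)
    fun Z hZ => Finsupp.filter_apply_neg _ _ (not_not.2 hZ)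
  filter_upwards [h] with p hp
  conv_rhs => rw [← Finsupp.filter_add_filter_not G fun Z => tot Z.1 = s, map_add, hp, add_zero]

theorem specialize_apply (s : ℤ) (p : ℕ) (G : ThetaTilde n →₀ PolyR) {Z : ThetaTilde n}
    (h : InTheta (shiftDim n s p) (shiftZ p Z.1)) :
    specialize s p G h.toTheta = evalAt p (G Z) * scale (braceExpZ (shiftZ p Z.1)) := by
  classical
  induction G using Finsupp.induction_linear with
  | zero => simp
  | add f g hf hg => rw [map_add, Pi.add_apply, hf, hg, Finsupp.add_apply, map_add, add_mul]
  | single Z' g =>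
    rw [specialize_single, Pi.smul_apply, smul_eq_mul]
    by_cases hZ : Z' = Z
    · subst hZ
      rw [braceQ_of_inTheta h, Pi.single_eq_same, Finsupp.single_eq_same]
    · rw [Finsupp.single_eq_of_ne' hZ, map_zero, zero_mul]
      by_cases h' : InTheta (shiftDim n s p) (shiftZ p Z'.1)
      · rw [braceQ_of_inTheta h', Pi.single_eq_of_ne, mul_zero]
        intro h1
        have h2 := congrArg Theta.toInt h1
        rw [h.toInt_toTheta, h'.toInt_toTheta] at h2
        exact hZ (Subtype.ext (shiftZ_injective p h2)).symm
      · rw [braceQ_of_not_inTheta h', Pi.zero_apply, mul_zero]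

/-- For a given `s` only matrices with sum of entries `s` are visible for large `p`, so all `s` are
needed. The coefficient of each `Z` is then determined by its values at large `p`. -/
theorem eq_of_forall_specialize_eq {G G' : ThetaTilde n →₀ PolyR}
    (h : ∀ s, ∀ᶠ p in atTop, specialize s p G = specialize s p G') : G = G' := by
  refine Finsupp.ext fun Z => eq_of_eventually_evalAt_eq ?_
  filter_upwards [h (tot Z.1), inTheta_shiftZ (s := tot Z.1) Z.2 rfl] with p h1 h2
  have h3 := congrFun h1 h2.toTheta
  rw [specialize_apply, specialize_apply] at h3
  exact mul_right_cancel₀ (scale_ne_zero _) h3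

open Classical in
/-- The stable structure constants: `{ₚA} * {ₚB} = ∑_Z G_Z(v, v^{-p}, t, t^p) {ₚZ}` for
large `p`. -/
noncomputable def stableCoeff (A B : ThetaTilde n) : ThetaTilde n →₀ PolyR :=
  if h : co A.1 = ro B.1 ∧ 1 ≤ n then
    (leftStable h.2 (tot A.1) A.1 B.1 B.2).choose.filter fun Z => tot Z.1 = tot A.1
  else 0

theorem stableCoeff_eq_zero {A B : ThetaTilde n} (h : co A.1 ≠ ro B.1) : stableCoeff A B = 0 :=
  dif_neg fun h' => h h'.1

/-- When `s` is not the sum of the entries of `A`, both sides are eventually zero: the left one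
because `stableCoeff` keeps only matrices with the same sum as `A`. -/
theorem specialize_stableCoeff (hn : 1 ≤ n) (s : ℤ) (A B : ThetaTilde n) : ∀ᶠ p in atTop,
    specialize s p (stableCoeff A B) = convQ n _ (braceQ (shiftDim n s p) (shiftZ p A.1))
      (braceQ (shiftDim n s p) (shiftZ p B.1)) := by
  classical
  by_cases h : co A.1 = ro B.1
  swap
  · refine Eventually.of_forall fun p => ?_
    rw [stableCoeff_eq_zero h, map_zero, convQ_braceQ_eq_zero (co_shiftZ_ne h p)]
  have hdef : stableCoeff A B =
      (leftStable hn (tot A.1) A.1 B.1 B.2).choose.filter fun Z => tot Z.1 = tot A.1 :=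
    dif_pos ⟨h, hn⟩
  by_cases hs : tot A.1 = s
  · subst hs
    have hspec := (leftStable hn (tot A.1) A.1 B.1 B.2).choose_spec
    rw [hdef]
    filter_upwards [hspec, specialize_filter hn (tot A.1)
      (leftStable hn (tot A.1) A.1 B.1 B.2).choose] with p h1 h2
    rw [h1, h2]
  · filter_upwards [braceQ_shiftZ_eventually_eq_zero hn (A := A.1) (s := s) fun h' => hs h'.2,
      specialize_eventually_eq_zero hn (s := s) (G := stableCoeff A B) fun Z hZ => by
        rw [hdef]
        exact Finsupp.filter_apply_neg _ _ fun h' => hs (h'.symm.trans hZ)] with p h1 h2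
    rw [h2, h1, map_zero, LinearMap.zero_apply]

theorem specialize_structMul (hn : 1 ≤ n) (s : ℤ) (x y : ThetaTilde n →₀ PolyR) :
    ∀ᶠ p in atTop, specialize s p (structMul stableCoeff x y) =
      convQ n _ (specialize s p x) (specialize s p y) := by
  induction x using Finsupp.induction_linear with
  | zero => exact Eventually.of_forall fun p => by simp
  | add x x' hx hx' =>
    filter_upwards [hx, hx'] with p h h'
    simp only [map_add, LinearMap.add_apply, h, h']
  | single A a =>
    induction y using Finsupp.induction_linear with
    | zero => exact Eventually.of_forall fun p => by simp
    | add y y' hy hy' =>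
      filter_upwards [hy, hy'] with p h h'
      simp only [map_add, h, h']
    | single B b =>
      filter_upwards [specialize_stableCoeff hn s A B] with p h
      rw [structMul_single, specialize_smul, specialize_smul, h, specialize_single,
        specialize_single, map_smul, map_smul, LinearMap.smul_apply]
      exact smul_comm _ _ _

/-- For every `s`, specialization is multiplicative on the products involved once `p` is large, and
the target is associative. Specializations at large `p` determine an element. -/
theorem structMul_stableCoeff_assoc (hn : 1 ≤ n) (x y z : ThetaTilde n →₀ PolyR) :
    structMul stableCoeff (structMul stableCoeff x y) z =
      structMul stableCoeff x (structMul stableCoeff y z) := by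
  refine eq_of_forall_specialize_eq fun s => ?_
  filter_upwards [specialize_structMul hn s x y, specialize_structMul hn s y z,
    specialize_structMul hn s (structMul stableCoeff x y) z,
    specialize_structMul hn s x (structMul stableCoeff y z)] with p h1 h2 h3 h4
  rw [h3, h4, h1, h2, convQ_assoc]

theorem specialize_chainProd (hn : 1 ≤ n) (s : ℤ) (l : List (ThetaTilde n →₀ PolyR)) :
    ∀ᶠ p in atTop, specialize s p (chainProd (fun x y => structMul stableCoeff x y) l) =
      chainProd (fun x y => convQ n _ x y) (l.map (specialize s p)) := by
  cases l with
  | nil => exact Eventually.of_forall fun p => map_zero _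
  | cons x l =>
    change ∀ᶠ p in atTop, specialize s p (l.foldl (fun x y => structMul stableCoeff x y) x) =
      (l.map (specialize s p)).foldl (fun x y => convQ n _ x y) (specialize s p x)
    induction l generalizing x with
    | nil => exact Eventually.of_forall fun p => rfl
    | cons y l ih =>
      filter_upwards [ih (structMul stableCoeff x y), specialize_structMul hn s x y] with p h1 h2
      rw [List.foldl_cons, h1, List.map_cons, List.foldl_cons, h2]

/-! Descent to `𝒜`. -/

theorem toQ_injective {d : ℕ} : Function.Injective (toQ (n := n) (d := d)) := by
  intro x y h
  funext C
  exact Subtype.ext (congrFun h C)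

theorem toQ_zero {d : ℕ} : toQ (0 : SchurAlg n d) = 0 := rfl

theorem toQ_sum_smul {d : ℕ} {α : Type} (t : Finset α) (c : α → LaurentA) (x : α → SchurAlg n d) :
    toQ (∑ j ∈ t, c j • x j) = ∑ j ∈ t, (c j : Qvt) • toQ (x j) := by
  funext C
  unfold toQ
  rw [Finset.sum_apply, Finset.sum_apply]
  push_cast
  rfl

/-- For large `p` the value is a coefficient of a product formed in `𝒮_d` over `𝒜`, up to a power of
`v` and of `t`, which are units of `𝒜`. -/
theorem evalAt_stableCoeff_mem (hn : 1 ≤ n) (A B Z : ThetaTilde n) :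
    ∀ᶠ p in atTop, evalAt p (stableCoeff A B Z) ∈ LaurentA := by
  classical
  by_cases h : co A.1 = ro B.1 ∧ tot Z.1 = tot A.1
  swap
  · have h0 : stableCoeff A B Z = 0 := by
      by_cases h1 : co A.1 = ro B.1
      · have hdef : stableCoeff A B =
          (leftStable hn (tot A.1) A.1 B.1 B.2).choose.filter fun Z => tot Z.1 = tot A.1 :=
          dif_pos ⟨h1, hn⟩
        rw [hdef]
        exact Finsupp.filter_apply_neg _ _ fun h' => h ⟨h1, h'⟩
      · rw [stableCoeff_eq_zero h1]
        rfl
    refine Eventually.of_forall fun p => ?_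
    rw [h0, map_zero]
    exact zero_mem _
  obtain ⟨h, hZ⟩ := h
  filter_upwards [specialize_stableCoeff hn (tot A.1) A B,
    inTheta_shiftZ (s := tot A.1) A.2 rfl,
    inTheta_shiftZ (s := tot A.1) B.2 (tot_eq_of_co_eq_ro h).symm,
    inTheta_shiftZ (s := tot A.1) Z.2 hZ] with p h1 hA hB hZ
  rw [← toQ_brace hA, ← toQ_brace hB, ← toQ_conv] at h1
  have h2 := congrFun h1 hZ.toTheta
  rw [specialize_apply] at h2
  have h3 : evalAt p (stableCoeff A B Z) =
      toQ (conv (brace hA.toTheta) (brace hB.toTheta)) hZ.toTheta *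
        scale (-braceExpZ (shiftZ p Z.1)) := by
    rw [← h2, mul_assoc, ← scale_add, add_neg_cancel, scale_zero, mul_one]
  rw [h3]
  exact mul_mem (Subtype.property _) (scale_mem _)

/-- The evaluation at `v' = t' = 1`. -/
noncomputable def evalOne : PolyR →+* Qvt := MvPolynomial.eval ![1, 1]

theorem exists_mapCoeff_val_eq {ι : Type} (x : ι →₀ Qvt) (h : ∀ Z, x Z ∈ LaurentA) :
    ∃ y : ι →₀ LaurentA, mapCoeff (LaurentA.val : LaurentA →+* Qvt) y = x := by
  refine ⟨Finsupp.onFinset x.support (fun Z => ⟨x Z, h Z⟩) fun Z hZ => ?_, ?_⟩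
  · rw [Finsupp.mem_support_iff]
    exact fun h0 => hZ (Subtype.ext h0)
  · ext Z
    rfl

theorem exists_limitCoeff (A B : ThetaTilde n) : ∃ y : ThetaTilde n →₀ LaurentA,
    mapCoeff (LaurentA.val : LaurentA →+* Qvt) y = mapCoeff evalOne (stableCoeff A B) := by
  refine exists_mapCoeff_val_eq _ fun Z => ?_
  by_cases hn : 1 ≤ n
  · exact evalR_one_mem (evalAt_stableCoeff_mem hn A B Z)
  · have : stableCoeff A B = 0 := dif_neg fun h => hn h.2
    rw [this, map_zero]
    exact zero_mem _

/-- The structure constants of `𝒦`. -/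
noncomputable def limitCoeff (A B : ThetaTilde n) : ThetaTilde n →₀ LaurentA :=
  (exists_limitCoeff A B).choose

theorem mapCoeff_limitCoeff (A B : ThetaTilde n) :
    mapCoeff (LaurentA.val : LaurentA →+* Qvt) (limitCoeff A B) =
      mapCoeff evalOne (stableCoeff A B) := (exists_limitCoeff A B).choose_spec

theorem mapCoeff_val_injective {ι : Type} :
    Function.Injective (mapCoeff (ι := ι) (LaurentA.val : LaurentA →+* Qvt)) :=
  mapCoeff_injective Subtype.val_injective

theorem mapCoeff_val_structMul (x y : KMod n) :
    mapCoeff (LaurentA.val : LaurentA →+* Qvt) (structMul limitCoeff x y) =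
      structMul (fun A B => mapCoeff evalOne (stableCoeff A B))
        (mapCoeff (LaurentA.val : LaurentA →+* Qvt) x)
        (mapCoeff (LaurentA.val : LaurentA →+* Qvt) y) := by
  rw [mapCoeff_structMul]
  simp only [mapCoeff_limitCoeff]

/-- Substituting `v' = t' = 1` is a ring homomorphism on coefficients, so it carries over the
associativity of the stable product. The inclusion of `𝒜` in `ℚ(v, t)` is injective, which brings
the identity down to `𝒜`. -/
theorem structMul_limitCoeff_assoc (hn : 1 ≤ n) (x y z : KMod n) :
    structMul limitCoeff (structMul limitCoeff x y) z =
      structMul limitCoeff x (structMul limitCoeff y z) := by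
  refine structMul_assoc (fun A B C => mapCoeff_val_injective ?_) x y z
  have h := congrArg (mapCoeff evalOne) (structMul_stableCoeff_assoc hn
    (Finsupp.single A 1) (Finsupp.single B 1) (Finsupp.single C 1))
  simp only [mapCoeff_structMul, mapCoeff_single, map_one] at h
  rw [mapCoeff_val_structMul, mapCoeff_val_structMul, mapCoeff_limitCoeff, mapCoeff_limitCoeff,
    mapCoeff_single, mapCoeff_single, map_one]
  simpa only [structMul_single, one_smul] using h

theorem mapCoeff_val_chainProd {r : ℕ} (A : Fin r → ThetaTilde n) :
    mapCoeff (LaurentA.val : LaurentA →+* Qvt)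
      (chainProd (fun x y => structMul limitCoeff x y) (List.ofFn fun i => kBrace (A i))) =
      mapCoeff evalOne (chainProd (fun x y => structMul stableCoeff x y)
        (List.ofFn fun i => Finsupp.single (A i) 1)) := by
  rw [map_chainProd (mul' := fun x y => structMul (fun A B => mapCoeff evalOne (stableCoeff A B)) x y)
      (mapCoeff (LaurentA.val : LaurentA →+* Qvt)) (map_zero _) mapCoeff_val_structMul,
    map_chainProd (mul' := fun x y => structMul (fun A B => mapCoeff evalOne (stableCoeff A B)) x y)
      (mapCoeff evalOne) (map_zero _) (mapCoeff_structMul evalOne stableCoeff),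
    List.map_ofFn, List.map_ofFn]
  congr 2
  funext i
  simp only [Function.comp, kBrace, mapCoeff_single, map_one]

/-! Stabilization of products. -/

theorem Composable.tot_eq {r : ℕ} {A : Fin r → ThetaTilde n} (h : Composable A) (i j : Fin r) :
    tot (A i).1 = tot (A j).1 := by
  have key : ∀ (k : ℕ) (hk : k < r), tot (A ⟨k, hk⟩).1 = tot (A ⟨0, by omega⟩).1 := by
    intro k
    induction k with
    | zero => exact fun _ => rfl
    | succ k ih =>
      intro hk
      rw [← ih (by omega)]
      exact (tot_eq_of_co_eq_ro (h ⟨k, by omega⟩ ⟨k + 1, hk⟩ rfl)).symm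
  rw [key i.1 i.2, key j.1 j.2]

theorem toQ_chainProd {d r : ℕ} {A : Fin r → Matrix (Fin n) (Fin n) ℤ} (hA : ∀ i, InTheta d (A i)) :
    toQ (chainProd conv (List.ofFn fun i => brace (hA i).toTheta)) =
      chainProd (fun x y => convQ n d x y) (List.ofFn fun i => braceQ d (A i)) := by
  rw [map_chainProd (mul' := fun x y => convQ n d x y) toQ toQ_zero toQ_conv, List.map_ofFn]
  congr 2
  funext i
  exact toQ_brace (hA i)

/-- The stable product of a sequence. -/
noncomputable def stableProd {r : ℕ} (A : Fin r → ThetaTilde n) : ThetaTilde n →₀ PolyR :=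
  chainProd (fun x y => structMul stableCoeff x y) (List.ofFn fun i => Finsupp.single (A i) 1)

theorem specialize_stableProd (hn : 1 ≤ n) (s : ℤ) {r : ℕ} (A : Fin r → ThetaTilde n) :
    ∀ᶠ p in atTop, specialize s p (stableProd A) = chainProd (fun x y => convQ n _ x y)
      (List.ofFn fun i => braceQ (shiftDim n s p) (shiftZ p (A i).1)) := by
  filter_upwards [specialize_chainProd hn s (List.ofFn fun i => Finsupp.single (A i) 1)] with p h
  refine h.trans ?_
  rw [List.map_ofFn]
  congr 2
  funext i
  simp only [Function.comp, specialize_single, map_one, one_smul]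

theorem exists_stabilizes (hn : 1 ≤ n) {r : ℕ} (hr : 2 ≤ r) {A : Fin r → ThetaTilde n}
    (hA : Composable A) : ∃ (m : ℕ) (Z : Fin m → ThetaTilde n) (G : Fin m → PolyR) (p₀ : ℕ),
      Stabilizes A Z G p₀ := by
  classical
  set s := tot (A ⟨0, by omega⟩).1 with hs
  -- A common `Θ_d` for all the `ₚZ_j` requires the right sum of entries. The filter makes this
  -- explicit and does not change the specialization for large `p`.
  set X := (stableProd A).filter fun Z => tot Z.1 = s with hX
  let e := X.support.equivFin.symm
  have hZs : ∀ j, tot (e j).1.1 = s := by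
    intro j
    by_contra h
    exact Finsupp.mem_support_iff.1 (e j).2 (Finsupp.filter_apply_neg _ _ h)
  have hpos : ∀ᶠ p : ℕ in atTop, 0 < shiftDim n s p := by
    filter_upwards [eventually_gt_atTop (-s).toNat] with p hp
    unfold shiftDim
    have hpn : (p : ℤ) ≤ p * n := by
      have : (1 : ℤ) ≤ n := by exact_mod_cast hn
      nlinarith [Int.natCast_nonneg p]
    omega
  have hAT : ∀ᶠ p in atTop, ∀ i, InTheta (shiftDim n s p) (shiftZ p (A i).1) :=
    eventually_all.2 fun i => inTheta_shiftZ (A i).2 (hA.tot_eq _ _)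
  have hZT : ∀ᶠ p in atTop, ∀ j, InTheta (shiftDim n s p) (shiftZ p (e j).1.1) :=
    eventually_all.2 fun j => inTheta_shiftZ (e j).1.2 (hZs j)
  obtain ⟨p₀, hp₀⟩ := eventually_atTop.1 (hpos.and (hAT.and (hZT.and
    ((specialize_stableProd hn s A).and (specialize_filter hn s (stableProd A))))))
  refine ⟨X.support.card, fun j => (e j).1, fun j => X (e j).1, p₀,
    Subtype.val_injective.comp e.injective, fun p hp => ?_⟩
  obtain ⟨h1, h2, h3, h4, h5⟩ := hp₀ p hp
  have h6 := h5.trans (h4.trans (toQ_chainProd h2).symm)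
  set y := chainProd conv (List.ofFn fun i => brace (h2 i).toTheta) with hy
  have hmem : ∀ j, evalAt p (X (e j).1) ∈ LaurentA := by
    intro j
    have h7 := congrFun h6 (h3 j).toTheta
    rw [specialize_apply] at h7
    have h8 : evalAt p (X (e j).1) =
        toQ y (h3 j).toTheta * scale (-braceExpZ (shiftZ p (e j).1.1)) := by
      rw [← h7, mul_assoc, ← scale_add, add_neg_cancel, scale_zero, mul_one]
    rw [h8]
    exact mul_mem (Subtype.property _) (scale_mem _)
  refine ⟨shiftDim n s p, h1, h2, h3, fun j => ⟨_, hmem j⟩, fun j => rfl, toQ_injective ?_⟩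
  change toQ y = _
  rw [toQ_sum_smul, ← h6]
  have hXsum : X = ∑ j, Finsupp.single (e j).1 (X (e j).1) := by
    conv_lhs => rw [← Finsupp.sum_single X, Finsupp.sum, ← Finset.sum_coe_sort]
    exact (Equiv.sum_comp e fun Z => Finsupp.single Z.1 (X Z.1)).symm
  conv_lhs => rw [← hX, hXsum, map_sum]
  refine Finset.sum_congr rfl fun j _ => ?_
  rw [specialize_single, ← toQ_brace (h3 j)]
  rfl

theorem chainProd_eq_zero {M : Type} [Zero M] {mul : M → M → M} (h : ∀ y, mul 0 y = 0) (l : List M) :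
    chainProd mul (0 :: l) = 0 := by
  change l.foldl mul 0 = 0
  induction l with
  | nil => rfl
  | cons y l ih => rw [List.foldl_cons, h, ih]

theorem sum_shiftZ (p : ℕ) (A : Matrix (Fin n) (Fin n) ℤ) :
    ∑ i, ∑ j, shiftZ p A i j = tot A + p * n := by
  unfold tot
  simp only [shiftZ_apply, Finset.sum_add_distrib]
  simp [mul_comm]

/-- Any stabilized form of a product agrees with the stable product for large `p`, hence
identically. For this reason the limit does not depend on the chosen `Z_j` and `G_j`. -/
theorem Stabilizes.stableProd_eq (hn : 1 ≤ n) {r : ℕ} (hr : 2 ≤ r) {A : Fin r → ThetaTilde n}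
    {m : ℕ} {Z : Fin m → ThetaTilde n} {G : Fin m → PolyR} {p₀ : ℕ}
    (h : Stabilizes A Z G p₀) : stableProd A = ∑ j, Finsupp.single (Z j) (G j) := by
  classical
  have i₀ : Fin r := ⟨0, by omega⟩
  -- Stabilization only asserts that some `d` exists; comparing sums of entries forces it to be
  -- `shiftDim`.
  have htot : ∀ p, p₀ ≤ p → ∀ d, (∀ i, InTheta d (shift p (A i))) → (∀ j, InTheta d (shift p (Z j))) →
      (∀ j, tot (Z j).1 = tot (A i₀).1) ∧ (∀ i, tot (A i).1 = tot (A i₀).1) ∧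
        d = shiftDim n (tot (A i₀).1) p := by
    intro p _ d hA hZ
    have h1 := fun i => (sum_shiftZ p (A i).1).symm.trans (hA i).2
    have h2 := fun j => (sum_shiftZ p (Z j).1).symm.trans (hZ j).2
    have h3 := h1 i₀
    refine ⟨fun j => ?_, fun i => ?_, ?_⟩
    · have := h2 j
      linarith
    · have := h1 i
      linarith
    · unfold shiftDim
      rw [h3, Int.toNat_natCast]
  have ht : (∀ j, tot (Z j).1 = tot (A i₀).1) ∧ (∀ i, tot (A i).1 = tot (A i₀).1) := by
    obtain ⟨d, -, hA, hZ, -⟩ := h.2 p₀ le_rfl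
    exact ⟨(htot p₀ le_rfl d hA hZ).1, (htot p₀ le_rfl d hA hZ).2.1⟩
  refine eq_of_forall_specialize_eq fun s => ?_
  by_cases hs : tot (A i₀).1 = s
  · subst hs
    filter_upwards [specialize_stableProd hn (tot (A i₀).1) A, eventually_ge_atTop p₀] with p h1 h2
    obtain ⟨d, -, hA, hZ, c, hc, hprod⟩ := h.2 p h2
    obtain rfl := (htot p h2 d hA hZ).2.2
    have h3 := congrArg toQ hprod
    rw [toQ_chainProd, toQ_sum_smul] at h3
    refine h1.trans (h3.trans ?_)
    rw [map_sum]
    refine Finset.sum_congr rfl fun j _ => ?_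
    rw [specialize_single, toQ_brace, hc]
    rfl
  -- For any other `s` both sides are eventually zero, on the left because the first factor of the
  -- product already vanishes.
  · obtain ⟨r, rfl⟩ : ∃ k, r = k + 1 := ⟨r - 1, by omega⟩
    have h0 : ∀ᶠ p in atTop, braceQ (shiftDim n s p) (shiftZ p (A 0).1) = 0 :=
      braceQ_shiftZ_eventually_eq_zero hn fun h' => hs ((ht.2 0).symm.trans h'.2)
    have hz : ∀ᶠ p in atTop, specialize s p (∑ j, Finsupp.single (Z j) (G j)) = 0 := by
      refine specialize_eventually_eq_zero hn fun Y hY => ?_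
      rw [Finsupp.finsetSum_apply]
      refine Finset.sum_eq_zero fun j _ => Finsupp.single_eq_of_ne' ?_
      rintro rfl
      exact hs ((ht.1 j).symm.trans hY)
    filter_upwards [specialize_stableProd hn s A, h0, hz] with p h1 h2 h3
    rw [h1, h3, List.ofFn_succ, h2]
    exact chainProd_eq_zero (fun y => by rw [map_zero, LinearMap.zero_apply]) _

theorem isLimitProduct_structMul (hn : 1 ≤ n) : IsLimitProduct (structMul (limitCoeff (n := n))) := by
  refine ⟨structMul_limitCoeff_assoc hn, fun A B h => ?_, fun r hr A _ m Z G p₀ h => ?_⟩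
  · unfold kBrace
    rw [structMul_single, one_smul, one_smul]
    apply mapCoeff_val_injective
    rw [mapCoeff_limitCoeff, stableCoeff_eq_zero h, map_zero, map_zero]
  · have hmem : ∀ j, evalR 1 1 (G j) ∈ LaurentA := by
      intro j
      refine evalR_one_mem ((eventually_ge_atTop p₀).mono fun p hp => ?_)
      obtain ⟨d, -, _, _, c, hc, -⟩ := h.2 p hp
      have h1 : evalAt p (G j) = (c j : Qvt) := (hc j).symm
      rw [h1]
      exact (c j).2
    refine ⟨fun j => ⟨_, hmem j⟩, fun j => rfl, mapCoeff_val_injective ?_⟩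
    rw [mapCoeff_val_chainProd]
    change mapCoeff evalOne (stableProd A) = _
    rw [h.stableProd_eq hn hr, map_sum, map_sum]
    refine Finset.sum_congr rfl fun j _ => ?_
    unfold kBrace
    rw [mapCoeff_single, mapCoeff_smul, mapCoeff_single, map_one, Finsupp.smul_single, smul_eq_mul,
      mul_one]
    rfl

/-- A bilinear product is determined on pairs of basis elements. These are fixed by the case `r = 2`
when the pair is composable and are zero otherwise. -/
theorem IsLimitProduct.unique (hn : 1 ≤ n)
    {mul mul' : KMod n →ₗ[LaurentA] KMod n →ₗ[LaurentA] KMod n}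
    (h : IsLimitProduct mul) (h' : IsLimitProduct mul') : mul = mul' := by
  refine Finsupp.lhom_ext' fun A => LinearMap.ext_ring (Finsupp.lhom_ext' fun B =>
    LinearMap.ext_ring ?_)
  change mul (kBrace A) (kBrace B) = mul' (kBrace A) (kBrace B)
  by_cases hAB : co A.1 = ro B.1
  swap
  · rw [h.2.1 A B hAB, h'.2.1 A B hAB]
  have hcomp : Composable ![A, B] := by
    intro i j hij
    have hi : i = 0 := Fin.ext (by have := j.2; simp; omega)
    have hj : j = 1 := Fin.ext (by rw [hi] at hij; simpa using hij.symm)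
    subst hi hj
    exact hAB
  obtain ⟨m, Z, G, p₀, hst⟩ := exists_stabilizes hn le_rfl hcomp
  obtain ⟨c, hc, h1⟩ := h.2.2 2 le_rfl _ hcomp m Z G p₀ hst
  obtain ⟨c', hc', h1'⟩ := h'.2.2 2 le_rfl _ hcomp m Z G p₀ hst
  have hcc : c = c' := funext fun j => Subtype.ext ((hc j).trans (hc' j).symm)
  subst hcc
  have h2 : ∀ mul : KMod n →ₗ[LaurentA] KMod n →ₗ[LaurentA] KMod n,
      chainProd (fun x y => mul x y) (List.ofFn fun i => kBrace (![A, B] i)) =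
        mul (kBrace A) (kBrace B) := fun mul => by
    rw [List.ofFn_succ, List.ofFn_succ]
    rfl
  rw [← h2, ← h2, h1, h1']

theorem IsLimitProduct.not_exists_unit (hn : 1 ≤ n)
    {mul : KMod n →ₗ[LaurentA] KMod n →ₗ[LaurentA] KMod n} (h : IsLimitProduct mul) :
    ¬ ∃ u : KMod n, ∀ x : KMod n, mul u x = x ∧ mul x u = x := by
  classical
  rintro ⟨u, hu⟩
  -- The integer `c` avoids the first column sums of all matrices in the support of `u`, so `u`
  -- annihilates the scalar matrix with diagonal entries `c`.
  obtain ⟨c, hc⟩ := Infinite.exists_notMem_finset (u.support.image fun A => co A.1 ⟨0, hn⟩)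
  let D : ThetaTilde n := ⟨Matrix.diagonal fun _ => c, fun i j hij => by
    rw [Matrix.diagonal_apply_ne _ hij]⟩
  have h0 : mul u (kBrace D) = 0 := by
    conv_lhs => rw [← Finsupp.sum_single u, Finsupp.sum, map_sum, LinearMap.sum_apply]
    refine Finset.sum_eq_zero fun A hA => ?_
    have h1 : Finsupp.single A (u A) = u A • kBrace A := by
      unfold kBrace
      rw [Finsupp.smul_single, smul_eq_mul, mul_one]
    rw [h1, LinearMap.map_smul₂, h.2.1 A D, smul_zero]
    intro h2
    refine hc (Finset.mem_image.2 ⟨A, hA, ?_⟩)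
    rw [h2]
    exact congrFun (ro_diagonal fun _ => c) _
  rw [(hu (kBrace D)).1] at h0
  exact one_ne_zero (Finsupp.single_eq_zero.1 h0)

end

end QSchur

theorem mainTheorem10 (n : ℕ) (hn : 1 ≤ n) :
    (∀ r : ℕ, 2 ≤ r → ∀ A : Fin r → ThetaTilde n, Composable A →
      ∃ (m : ℕ) (Z : Fin m → ThetaTilde n) (G : Fin m → PolyR) (p₀ : ℕ), Stabilizes A Z G p₀) ∧
    (∃! mul : KMod n →ₗ[LaurentA] KMod n →ₗ[LaurentA] KMod n, IsLimitProduct mul) ∧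
    (∀ mul : KMod n →ₗ[LaurentA] KMod n →ₗ[LaurentA] KMod n, IsLimitProduct mul →
      ¬ ∃ u : KMod n, ∀ x : KMod n, mul u x = x ∧ mul x u = x) :=
  ⟨fun _ hr _ hA => exists_stabilizes hn hr hA,
    ⟨structMul limitCoeff, isLimitProduct_structMul hn, fun _ h => h.unique hn
      (isLimitProduct_structMul hn)⟩,
    fun _ h => h.not_exists_unit hn⟩
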